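/- **Theorem (The Fast CUR Algorithm).** Let $A\in\mathbb R^{m\times n}$, let $k\ge 1$ be an integer with $k\le\min\{m,n\}$, and let $0<\epsilon\le 1$. Write $A_k$ for the truncation of a singular value decomposition of $A$ to its $k$ largest singular values, $\|\cdot\|_F$ for the Frobenius norm, $X^\dagger$ for the Moore–Penrose inverse of $X$, and $M(:,J)$ for the matrix of columns of $M$ with indices in the list $J$. For integers $s,c_1,c_2,r_1,r_2$, the *fast CUR algorithm* is the following randomized algorithm. 1. *Approximate truncated SVD by random projection.* Draw an $n\times s$ matrix $G$ of independent standard normal variables. Let $Q$ be an orthonormal basis of the range of $AG$, let $Z\in\mathbb R^{n\times k}$ consist of top $k$ orthonormal right singular vectors of $Q^TA$ (completed to $k$ orthonormal vectors if necessary), let $\tilde A_k=AZZ^T=\tilde U\tilde\Sigma\tilde V^T$ be an SVD with $\tilde U\in\mathbb R^{m\times k}$ and $\tilde V\in\mathbb R^{n\times k}$ having orthonormal columns, and let $E=A-\tilde A_k$. 2. *Near-optimal column selection.* Dual set sparsification, defined below, of the columns of $E$ and the rows of $\tilde V$ with $c_1$ iterations gives weights on $\{1,\dots,n\}$; let $C_1$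 consist of the at most $c_1$ columns of $A$ with positive weight. Then draw $c_2$ further columns of $A$ independently (adaptive sampling), each time column $i$ with probability $\|d_i\|_2^2/\|D\|_F^2$, where $d_i$ is the $i$-th column of $D=A-C_1C_1^\dagger A$ (uniformly if $D=0$). All these columns form $C$; put $c=c_1+c_2$. 3. *Fast row selection.* In the same way select at most $r_1$ rows $R_1$ of $A$ by dual set sparsification of the columns of $E^T$ and the rows of $\tilde U$ with $r_1$ iterations, and $r_2$ further rows by adaptive sampling from the squared norms of the rows of $A-AR_1^\dagger R_1$. All these rows form $R$; put $r=r_1+r_2$. 4. Compute $C^\dagger$ and $R^\dagger$, and let $U=C^\dagger A R^\dagger$, kept in this factored form. *Dual set sparsification* of vectors $x_1,\dots,x_N$ and $v_1,\dots,v_N\in\mathbb R^k$ with $\sum_iv_iv_i^T=I_k$, with $q>k$ iterations: put $\delta=\sum_i\|x_i\|_2^2/(1-\sqrt{k/q})$, $M_0=0\in\mathbb R^{k\times k}$, all weights $0$, and $\phi(L,M)=\sum_{i=1}^k(\lambda_i(M)-L)^{-1}$. For $\tau=0,\dots,q-1$ put $L_\tau=\tau-\sqrt{qk}$ and $$u_j=\frac{v_j^T(M_\tau-(L_\tau+1)I)^{-2}v_j}{\phi(L_\tau+1,M_\tau)-\phi(L_\tau,M_\tau)}-v_j^T(M_\tau-(L_\tau+1)I)^{-1}v_j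 ,$$ take the first $j$ with $u_j>0$ and $\|x_j\|_2^2\le\delta u_j$, add $1/u_j$ to the $j$-th weight, and put $M_{\tau+1}=M_\tau+u_j^{-1}v_jv_j^T$. Finally multiply all weights by $(1-\sqrt{k/q})/q$. Running time is the worst-case number of steps, where an arithmetic operation, a square root, a comparison, a constant and a normal variable cost one step each, drawing an index from a distribution on $N$ points costs $N$ steps, and a spectral decomposition of a symmetric $s\times s$ matrix costs $s^3$ steps. Then the parameters $s,c_1,c_2$ and $r_1,r_2$ can be chosen as functions of $k$ and $\epsilon$ alone, with $c_1>k$ and $r_1>k$, such that, as $\epsilon\to0$, uniformly in $k$, $$c_2=\tfrac{2k}{\epsilon}(1+o(1)),\qquad c=\tfrac{2k}{\epsilon}(1+o(1)),\qquad r_2=\tfrac{2c}{\epsilon}(1+o(1)),\qquad r=\tfrac{2c}{\epsilon}(1+o(1)),$$ and such that for all $m,n,k,\epsilon,A$ as above the algorithm selects at most $c$ columns and at most $r$ rows (counted with repetition), its computed matrices are exactly $C^\dagger$ and $R^\dagger$, $$\mathbb E\,\|A-CUR\|_F=\mathbb E\,\|A-C(C^\dagger AR^\dagger)R\|_F\le(1+\epsilon)\,\|A-A_k\|_F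 ,$$ and the running time is at most $$K\left(mnk\,\epsilon^{-2/3}+(m+n)k^3\epsilon^{-2/3}+mk^2\epsilon^{-2}+nk^2\epsilon^{-4}\right)$$ with an absolute constant $K$. -/

import Mathlib

open scoped BigOperators Matrix ENNReal Topology
open MeasureTheory ProbabilityTheory

/-! ## Linear algebra -/

/-- The Frobenius norm. -/
noncomputable def frobNorm {m n : ℕ} (A : Matrix (Fin m) (Fin n) ℝ) : ℝ :=
  Real.sqrt (∑ i, ∑ j, A i j ^ 2)

/-- `A = U diag(σ) Vᵀ` is a (compact) singular value decomposition of `A`. -/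
structure IsSVD {m n ρ : ℕ} (A : Matrix (Fin m) (Fin n) ℝ) (U : Matrix (Fin m) (Fin ρ) ℝ)
    (σ : Fin ρ → ℝ) (V : Matrix (Fin n) (Fin ρ) ℝ) : Prop where
  orth_left : Uᵀ * U = 1
  orth_right : Vᵀ * V = 1
  pos : ∀ i, 0 < σ i
  anti : Antitone σ
  eq : A = U * Matrix.diagonal σ * Vᵀ

/-- The truncation of a singular value decomposition to its `k` largest singular values. -/
def svdTrunc {m n ρ : ℕ} (k : ℕ) (U : Matrix (Fin m) (Fin ρ) ℝ) (σ : Fin ρ → ℝ)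
    (V : Matrix (Fin n) (Fin ρ) ℝ) : Matrix (Fin m) (Fin n) ℝ :=
  U * Matrix.diagonal (fun i : Fin ρ => if (i : ℕ) < k then σ i else 0) * Vᵀ

/-- `X` is the Moore-Penrose inverse of `A` (the four Penrose equations). -/
structure IsMoorePenrose {m n : ℕ} (A : Matrix (Fin m) (Fin n) ℝ)
    (X : Matrix (Fin n) (Fin m) ℝ) : Prop where
  mul_mul_self : A * X * A = A
  mul_mul_inv : X * A * X = X
  symm_left : (A * X)ᵀ = A * X
  symm_right : (X * A)ᵀ = X * A

/-- `M = W diag(lam) Wᵀ` with `W` orthogonal and `lam` in decreasing order. -/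
structure IsSpectral {s : ℕ} (M : Matrix (Fin s) (Fin s) ℝ)
    (lam : Fin s → ℝ) (W : Matrix (Fin s) (Fin s) ℝ) : Prop where
  anti : Antitone lam
  orth : Wᵀ * W = 1
  eq : M = W * Matrix.diagonal lam * Wᵀ

/-- Every symmetric matrix has a spectral decomposition. -/
theorem exists_isSpectral {s : ℕ} {M : Matrix (Fin s) (Fin s) ℝ} (hM : M.IsSymm) :
    ∃ p : (Fin s → ℝ) × Matrix (Fin s) (Fin s) ℝ, IsSpectral M p.1 p.2 := by
  have hH : M.IsHermitian := by
    rw [Matrix.IsHermitian, Matrix.conjTranspose_eq_transpose_of_trivial]; exact hM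
  let e := Tuple.sort (fun i => - hH.eigenvalues i)
  let W : Matrix (Fin s) (Fin s) ℝ := hH.eigenvectorUnitary
  have hW : Wᵀ * W = 1 := by
    have := (Matrix.mem_unitaryGroup_iff' (A := W)).1 hH.eigenvectorUnitary.2
    rwa [Matrix.star_eq_conjTranspose, Matrix.conjTranspose_eq_transpose_of_trivial] at this
  have hMW : M = W * Matrix.diagonal hH.eigenvalues * Wᵀ := by
    have := hH.spectral_theorem
    rw [Unitary.conjStarAlgAut_apply] at this
    rw [← Matrix.conjTranspose_eq_transpose_of_trivial, ← Matrix.star_eq_conjTranspose]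
    exact this
  refine ⟨(hH.eigenvalues ∘ e, W.submatrix id e), ?_, ?_, ?_⟩
  · intro i j hij
    have := Tuple.monotone_sort (fun i => - hH.eigenvalues i) hij
    simpa using this
  · show (W.submatrix id e)ᵀ * (W.submatrix id e) = 1
    have h : (W.submatrix id e)ᵀ * (W.submatrix id e) = (Wᵀ * W).submatrix e e := by
      ext i j
      simp [Matrix.mul_apply]
    rw [h, hW, Matrix.submatrix_one_equiv]
  · show M = W.submatrix id e * Matrix.diagonal (hH.eigenvalues ∘ e) * (W.submatrix id e)ᵀ
    conv_lhs => rw [hMW]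
    ext i j
    rw [Matrix.mul_apply, Matrix.mul_apply]
    simp only [Matrix.mul_diagonal, Matrix.transpose_apply, Matrix.submatrix_apply, id, Function.comp]
    exact (Equiv.sum_comp e (fun x => W i x * hH.eigenvalues x * W j x)).symm

open scoped Classical in
/-- A spectral decomposition of `M`, if there is one (that is, if `M` is symmetric). -/
noncomputable def spectralDecomp {s : ℕ} (M : Matrix (Fin s) (Fin s) ℝ) :
    (Fin s → ℝ) × Matrix (Fin s) (Fin s) ℝ :=
  if h : ∃ p : (Fin s → ℝ) × Matrix (Fin s) (Fin s) ℝ, IsSpectral M p.1 p.2 then h.choose else 0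

/-! ## The computation model

Randomised programs over a type `R` of scalars. The scalars are abstract: a program that is
written for an arbitrary `R` can create, combine and compare scalars only through the
instructions below, and every instruction is charged by `Prog.steps`. -/

/-- The four arithmetic operations. -/
inductive ArithOp : Type
  | add
  | sub
  | mul
  | div

/-- The value of an arithmetic operation. -/
noncomputable def ArithOp.val : ArithOp → ℝ → ℝ → ℝ
  | .add, x, y => x + y
  | .sub, x, y => x - y
  | .mul, x, y => x * y
  | .div, x, y => x / y

/-- Randomised programs with scalars in `R` and results in `α`. -/
inductive Prog (R : Type) (α : Type) : Type
  /-- stop with a result -/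
  | ret (a : α) : Prog R α
  /-- load a natural number -/
  | nat (a : ℕ) (next : R → Prog R α) : Prog R α
  /-- an arithmetic operation -/
  | arith (o : ArithOp) (x y : R) (next : R → Prog R α) : Prog R α
  /-- a square root -/
  | sqrt (x : R) (next : R → Prog R α) : Prog R α
  /-- branch on whether `x < y` -/
  | lt (x y : R) (next : Bool → Prog R α) : Prog R α
  /-- draw a matrix of independent standard normal variables -/
  | gauss (n s : ℕ) (next : Matrix (Fin n) (Fin s) R → Prog R α) : Prog R α
  /-- draw an index with probability proportional to its weight -/
  | draw (N : ℕ) (w : Fin N → R) (next : Fin N → Prog R α) : Prog R α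
  /-- spectral decomposition (eigenvalues in decreasing order, eigenvectors as columns) of a
  symmetric matrix -/
  | eig (s : ℕ) (M : Matrix (Fin s) (Fin s) R)
      (next : (Fin s → R) → Matrix (Fin s) (Fin s) R → Prog R α) : Prog R α

namespace Prog

/-- Sequential composition. -/
def bind {R α β : Type} : Prog R α → (α → Prog R β) → Prog R β
  | ret a, f => f a
  | nat a next, f => nat a fun x => bind (next x) f
  | arith o x y next, f => arith o x y fun z => bind (next z) f
  | sqrt x next, f => sqrt x fun z => bind (next z) f
  | lt x y next, f => lt x y fun b => bind (next b) f
  | gauss n s next, f => gauss n s fun G => bind (next G) f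
  | draw N w next, f => draw N w fun i => bind (next i) f
  | eig s M next, f => eig s M fun lam W => bind (next lam W) f

instance (R : Type) : Monad (Prog R) where
  pure := ret
  bind := bind

/-! ### Semantics over the real numbers -/

/-- The law of an `n × s` matrix of independent standard normal variables. -/
noncomputable def gaussMeasure (n s : ℕ) : Measure (Fin n → Fin s → ℝ) :=
  Measure.pi fun _ => Measure.pi fun _ => gaussianReal 0 1

open scoped Classical in
/-- The probability of index `i` when drawing proportionally to the weights `w`; if `w` is not a
nonzero vector of nonnegative weights, the draw is uniform. -/
noncomputable def drawProb {N : ℕ} (w : Fin N → ℝ) (i : Fin N) : ℝ≥0∞ :=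
  if (∀ j, 0 ≤ w j) ∧ 0 < ∑ j, w j then ENNReal.ofReal (w i / ∑ j, w j) else (N : ℝ≥0∞)⁻¹

/-- The upper Lebesgue integral: the least integral of a measurable majorant. It agrees with the
Lebesgue integral on measurable functions, and is never smaller than it. -/
noncomputable def upperIntegral {Ω : Type} [MeasurableSpace Ω] (μ : Measure Ω) (f : Ω → ℝ≥0∞) :
    ℝ≥0∞ :=
  ⨅ (g : Ω → ℝ≥0∞) (_ : Measurable g) (_ : ∀ ω, f ω ≤ g ω), ∫⁻ ω, g ω ∂μ

open scoped Classical in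
/-- The expectation of `f` at the result of a program. -/
noncomputable def expect {α : Type} (f : α → ℝ≥0∞) : Prog ℝ α → ℝ≥0∞
  | ret a => f a
  | nat a next => expect f (next (a : ℝ))
  | arith o x y next => expect f (next (o.val x y))
  | sqrt x next => expect f (next (Real.sqrt x))
  | lt x y next => expect f (next (decide (x < y)))
  | gauss n s next => upperIntegral (gaussMeasure n s) fun G => expect f (next G)
  | draw _ w next => ∑ i, drawProb w i * expect f (next i)
  | eig _ M next => expect f (next (spectralDecomp M).1 (spectralDecomp M).2)

open scoped Classical in
/-- `P` holds at the result of a program whatever the outcomes of the random draws. -/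
def Always {α : Type} (P : α → Prop) : Prog ℝ α → Prop
  | ret a => P a
  | nat a next => Always P (next (a : ℝ))
  | arith o x y next => Always P (next (o.val x y))
  | sqrt x next => Always P (next (Real.sqrt x))
  | lt x y next => Always P (next (decide (x < y)))
  | gauss _ _ next => ∀ G, Always P (next G)
  | draw _ _ next => ∀ i, Always P (next i)
  | eig _ M next => Always P (next (spectralDecomp M).1 (spectralDecomp M).2)

open scoped Classical in
/-- The running time of a program, in the worst case over the random draws: a scalar operation,
comparison, constant or normal variable costs one step, drawing one of `N` indices costs `N` steps
and the spectral decomposition of an `s × s` matrix costs `s ^ 3` steps. -/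
noncomputable def steps {α : Type} : Prog ℝ α → ℕ∞
  | ret _ => 0
  | nat a next => 1 + steps (next (a : ℝ))
  | arith o x y next => 1 + steps (next (o.val x y))
  | sqrt x next => 1 + steps (next (Real.sqrt x))
  | lt x y next => 1 + steps (next (decide (x < y)))
  | gauss n s next => ((n * s : ℕ) : ℕ∞) + ⨆ G, steps (next G)
  | draw N _ next => (N : ℕ∞) + ⨆ i, steps (next i)
  | eig s M next => ((s ^ 3 : ℕ) : ℕ∞) + steps (next (spectralDecomp M).1 (spectralDecomp M).2)

end Prog

/-! ## Programs for basic linear algebra -/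

section Programs

variable {R : Type}

/-- Load a natural number. -/
def natP (a : ℕ) : Prog R R := .nat a .ret

/-- Addition. -/
def addP (x y : R) : Prog R R := .arith .add x y .ret

/-- Subtraction. -/
def subP (x y : R) : Prog R R := .arith .sub x y .ret

/-- Multiplication. -/
def mulP (x y : R) : Prog R R := .arith .mul x y .ret

/-- Division. -/
def divP (x y : R) : Prog R R := .arith .div x y .ret

/-- Square root. -/
def sqrtP (x : R) : Prog R R := .sqrt x .ret

/-- Comparison. -/
def ltP (x y : R) : Prog R Bool := .lt x y .ret

/-- A matrix of independent standard normal variables. -/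
def gaussP (n s : ℕ) : Prog R (Matrix (Fin n) (Fin s) R) := .gauss n s .ret

/-- A random index, drawn proportionally to the weights `w`. -/
def drawP {N : ℕ} (w : Fin N → R) : Prog R (Fin N) := .draw N w .ret

/-- A spectral decomposition. -/
def eigP {s : ℕ} (M : Matrix (Fin s) (Fin s) R) :
    Prog R ((Fin s → R) × Matrix (Fin s) (Fin s) R) :=
  .eig s M fun lam W => .ret (lam, W)

/-- Compute the entries of a vector one after the other. -/
def tabulateP {α : Type} : (n : ℕ) → (Fin n → Prog R α) → Prog R (Fin n → α)
  | 0, _ => pure Fin.elim0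
  | n + 1, f => do
      let a ← f 0
      let v ← tabulateP n fun i => f i.succ
      pure (Fin.cons (α := fun _ => α) a v)

/-- Compute the entries of a matrix one after the other. -/
def tabulateMatP {m n : ℕ} (f : Fin m → Fin n → Prog R R) : Prog R (Matrix (Fin m) (Fin n) R) :=
  tabulateP m fun i => tabulateP n fun j => f i j

/-- The sum of the entries of a vector. -/
def sumP : (n : ℕ) → (Fin n → R) → Prog R R
  | 0, _ => natP 0
  | n + 1, x => do
      let a ← sumP n fun i => x i.succ
      addP (x 0) a

/-- The inner product of two vectors. -/
def dotP {n : ℕ} (x y : Fin n → R) : Prog R R := do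
  let z ← tabulateP n fun i => mulP (x i) (y i)
  sumP n z

/-- The product of two matrices. -/
def matMulP {m l n : ℕ} (A : Matrix (Fin m) (Fin l) R) (B : Matrix (Fin l) (Fin n) R) :
    Prog R (Matrix (Fin m) (Fin n) R) :=
  tabulateMatP fun i j => dotP (A i) fun t => B t j

/-- The difference of two matrices. -/
def matSubP {m n : ℕ} (A B : Matrix (Fin m) (Fin n) R) : Prog R (Matrix (Fin m) (Fin n) R) :=
  tabulateMatP fun i j => subP (A i j) (B i j)

/-- The squared Euclidean norms of the columns of a matrix. -/
def colSqNormsP {m n : ℕ} (A : Matrix (Fin m) (Fin n) R) : Prog R (Fin n → R) :=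
  tabulateP n fun j => dotP (fun i => A i j) fun i => A i j

/-- The matrix `W diag(d) Wᵀ`. -/
def conjDiagP {s : ℕ} (W : Matrix (Fin s) (Fin s) R) (d : Fin s → R) :
    Prog R (Matrix (Fin s) (Fin s) R) := do
  let T ← tabulateMatP fun i j => mulP (W i j) (d j)
  matMulP T Wᵀ

/-- Subtract from `w` its components along the unit vectors in a list. -/
def residualP {n : ℕ} : List (Fin n → R) → (Fin n → R) → Prog R (Fin n → R)
  | [], w => pure w
  | q :: qs, w => do
      let a ← dotP q w
      let w' ← tabulateP n fun i => do
        let b ← mulP a (q i)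
        subP (w i) b
      residualP qs w'

/-- Gram-Schmidt orthonormalisation: extend the orthonormal list `qs` by the normalised nonzero
residuals of the given vectors, in order. -/
def gramSchmidtP {n : ℕ} (qs : List (Fin n → R)) : List (Fin n → R) → Prog R (List (Fin n → R))
  | [] => pure qs
  | v :: vs => do
      let w ← residualP qs v
      let a ← dotP w w
      let zero ← natP 0
      if ← ltP zero a then
        let b ← sqrtP a
        let q ← tabulateP n fun i => divP (w i) b
        gramSchmidtP (qs ++ [q]) vs
      else
        gramSchmidtP qs vs

/-- The columns of a matrix. -/
def columns {m n : ℕ} (A : Matrix (Fin m) (Fin n) R) : List (Fin m → R) :=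
  List.ofFn fun j i => A i j

/-- An orthonormal basis with `k` vectors, as the columns of a matrix, obtained from the given
vectors and, where these do not suffice, the first `k` standard unit vectors (for `k ≤ n`). -/
def orthBasisP {n : ℕ} (k : ℕ) (vs : List (Fin n → R)) : Prog R (Matrix (Fin n) (Fin k) R) := do
  let zero ← natP 0
  let one ← natP 1
  let units : List (Fin n → R) :=
    (List.range k).map fun i (j : Fin n) => if (j : ℕ) = i then one else zero
  let qs ← gramSchmidtP [] (vs ++ units)
  pure fun i j => qs.getD (j : ℕ) (fun _ => zero) i

/-- The Moore-Penrose inverse of a matrix with at most as many columns as rows: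
`(AᵀA)† Aᵀ`, where `(AᵀA)†` is computed from a spectral decomposition. -/
def pinvTallP {p q : ℕ} (A : Matrix (Fin p) (Fin q) R) : Prog R (Matrix (Fin q) (Fin p) R) := do
  let G ← matMulP Aᵀ A
  let (lam, W) ← eigP G
  let zero ← natP 0
  let one ← natP 1
  let d ← tabulateP q fun i => do
    if ← ltP zero (lam i) then divP one (lam i) else pure zero
  let H ← conjDiagP W d
  matMulP H Aᵀ

/-- The Moore-Penrose inverse of a matrix. -/
def pinvP {p q : ℕ} (A : Matrix (Fin p) (Fin q) R) : Prog R (Matrix (Fin q) (Fin p) R) :=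
  if q ≤ p then pinvTallP A else do
    let X ← pinvTallP Aᵀ
    pure Xᵀ

/-! ## The fast CUR algorithm -/

/-- Approximate truncated singular value decomposition of `A` with target rank `k`, via the random
projection of `A` onto the range of `A * G` for an `n × s` Gaussian matrix `G`: if `Z` consists of
the top `k` right singular vectors of the projection of `A` onto that range, the result is a
singular value decomposition `Ũ Σ̃ Ṽᵀ` of the matrix `A Z Zᵀ`, returned as `(Ũ, Ũ Σ̃, Ṽ)`. -/
def randSVDP {m n : ℕ} (A : Matrix (Fin m) (Fin n) R) (k s : ℕ) :
    Prog R (Matrix (Fin m) (Fin k) R × Matrix (Fin m) (Fin k) R × Matrix (Fin n) (Fin k) R) := do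
  let G ← gaussP n s
  let Y ← matMulP A G
  let qs ← gramSchmidtP [] (columns Y)
  let Q : Matrix (Fin m) (Fin qs.length) R := fun i j => qs.get j i
  let B ← matMulP Qᵀ A
  let BB ← matMulP B Bᵀ
  let (_, W) ← eigP BB
  let BW ← matMulP Bᵀ W
  let Z ← orthBasisP k ((columns BW).take k)
  let AZ ← matMulP A Z
  let H ← matMulP AZᵀ AZ
  let (_, W') ← eigP H
  let US ← matMulP AZ W'
  let V ← matMulP Z W'
  let U ← orthBasisP k (columns US)
  pure (U, US, V)

/-- One iteration of the dual set sparsification. Here `xn i` is the squared norm of `x i`, the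
rows of `V` are the vectors `v i`, `del` is the bound `δ_U`, `rk` is the square root of `r * k`,
and the state consists of the weights `s` and the matrix `M`. -/
def dualSetStepP {N k : ℕ} (xn : Fin N → R) (V : Matrix (Fin N) (Fin k) R) (del rk : R) (τ : ℕ)
    (state : (Fin N → R) × Matrix (Fin k) (Fin k) R) :
    Prog R ((Fin N → R) × Matrix (Fin k) (Fin k) R) := do
  let (s, M) := state
  let (lam, W) ← eigP M
  let zero ← natP 0
  let one ← natP 1
  let t₀ ← natP τ
  let L ← subP t₀ rk
  let L' ← addP L one
  let e ← tabulateP k fun i => do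
    let a ← subP (lam i) L
    divP one a
  let e' ← tabulateP k fun i => do
    let a ← subP (lam i) L'
    divP one a
  let esq ← tabulateP k fun i => mulP (e' i) (e' i)
  let phi ← sumP k e
  let phi' ← sumP k e'
  let gap ← subP phi' phi
  let M₁ ← conjDiagP W e'
  let M₂ ← conjDiagP W esq
  let u ← tabulateP N fun j => do
    let y₁ ← tabulateP k fun i => dotP (M₁ i) (V j)
    let y₂ ← tabulateP k fun i => dotP (M₂ i) (V j)
    let a₁ ← dotP (V j) y₁
    let a₂ ← dotP (V j) y₂
    let b ← divP a₂ gap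
    subP b a₁
  let good ← tabulateP N fun j => do
    let a ← mulP del (u j)
    let p ← ltP zero (u j)
    let q ← ltP a (xn j)
    pure (p && !q)
  match (List.finRange N).find? good with
  | none => pure (s, M)
  | some j => do
      let t ← divP one (u j)
      let sj ← addP (s j) t
      let M' ← tabulateMatP fun a b => do
        let x ← mulP (V j a) (V j b)
        let y ← mulP t x
        addP (M a b) y
      pure (Function.update s j sj, M')

/-- The iterations `τ, …, τ + r - 1` of the dual set sparsification. -/
def dualSetLoopP {N k : ℕ} (xn : Fin N → R) (V : Matrix (Fin N) (Fin k) R) (del rk : R) :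
    (r τ : ℕ) → (Fin N → R) × Matrix (Fin k) (Fin k) R →
      Prog R ((Fin N → R) × Matrix (Fin k) (Fin k) R)
  | 0, _, state => pure state
  | r + 1, τ, state => do
      let state' ← dualSetStepP xn V del rk τ state
      dualSetLoopP xn V del rk r (τ + 1) state'

/-- Deterministic dual set spectral-Frobenius sparsification of the columns of `X` and the rows
of `V`, with at most `r` nonzero weights. -/
def dualSetP {l N k : ℕ} (X : Matrix (Fin l) (Fin N) R) (V : Matrix (Fin N) (Fin k) R) (r : ℕ) :
    Prog R (Fin N → R) := do
  let zero ← natP 0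
  let one ← natP 1
  let kR ← natP k
  let rR ← natP r
  let xn ← colSqNormsP X
  let tot ← sumP N xn
  let ratio ← divP kR rR
  let root ← sqrtP ratio
  let c ← subP one root
  let del ← divP tot c
  let prod ← mulP rR kR
  let rk ← sqrtP prod
  let (s, _) ← dualSetLoopP xn V del rk r 0 (fun _ => zero, fun _ _ => zero)
  let scale ← divP c rR
  tabulateP N fun i => mulP scale (s i)

/-- Draw `c` independent indices, each proportionally to the weights `w`. -/
def drawListP {N : ℕ} (w : Fin N → R) : ℕ → Prog R (List (Fin N))
  | 0 => pure []
  | c + 1 => do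
      let i ← drawP w
      let is ← drawListP w c
      pure (i :: is)

/-- The matrix formed by the columns of `A` with the listed indices. -/
def selectCols {m n : ℕ} (A : Matrix (Fin m) (Fin n) R) (J : List (Fin n)) :
    Matrix (Fin m) (Fin J.length) R :=
  A.submatrix id J.get

/-- The matrix formed by the rows of `A` with the listed indices. -/
def selectRows {m n : ℕ} (A : Matrix (Fin m) (Fin n) R) (I : List (Fin m)) :
    Matrix (Fin I.length) (Fin n) R :=
  A.submatrix I.get id

/-- Column selection: at most `c₁` columns by dual set sparsification of the columns of `E` and the
rows of `V`, and then `c₂` columns by adaptive sampling, that is, with probabilities proportional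
to the squared norms of the columns of `A - C₁ C₁† A`. -/
def selectP {m n k : ℕ} (A E : Matrix (Fin m) (Fin n) R) (V : Matrix (Fin n) (Fin k) R)
    (c₁ c₂ : ℕ) : Prog R (List (Fin n)) := do
  let s ← dualSetP E V c₁
  let zero ← natP 0
  let pos ← tabulateP n fun j => ltP zero (s j)
  let J₁ := (List.finRange n).filter pos
  let C₁ := selectCols A J₁
  let X ← pinvP C₁
  let XA ← matMulP X A
  let P ← matMulP C₁ XA
  let D ← matSubP A P
  let w ← colSqNormsP D
  let J₂ ← drawListP w c₂
  pure (J₁ ++ J₂)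

/-- The numerical parameters of the fast CUR algorithm: the width of the Gaussian matrix and the
numbers of columns and rows that are selected by dual set sparsification (`c₁`, `r₁`) and by
adaptive sampling (`c₂`, `r₂`). -/
structure CURParams where
  sketch : ℕ
  c₁ : ℕ
  c₂ : ℕ
  r₁ : ℕ
  r₂ : ℕ

/-- The target number of columns. -/
def CURParams.c (par : CURParams) : ℕ := par.c₁ + par.c₂

/-- The target number of rows. -/
def CURParams.r (par : CURParams) : ℕ := par.r₁ + par.r₂

/-- The output of the fast CUR algorithm: the indices of the selected columns and rows, which
give `C` and `R`, and the matrices `C†` and `R†`, which give `U = C† A R†` in factored form. -/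
structure CUROutput (R : Type) (m n : ℕ) where
  cols : List (Fin n)
  rows : List (Fin m)
  Cdag : Matrix (Fin cols.length) (Fin m) R
  Rdag : Matrix (Fin n) (Fin rows.length) R

/-- The fast CUR algorithm. Row selection is column selection for the transposed matrices. -/
def fastCURP {m n : ℕ} (A : Matrix (Fin m) (Fin n) R) (k : ℕ) (par : CURParams) :
    Prog R (CUROutput R m n) := do
  let (U, US, V) ← randSVDP A k par.sketch
  let Ak ← matMulP US Vᵀ
  let E ← matSubP A Ak
  let J ← selectP A E V par.c₁ par.c₂
  let I ← selectP Aᵀ Eᵀ U par.r₁ par.r₂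
  let X ← pinvP (selectCols A J)
  let Y ← pinvP (selectRows A I)
  pure { cols := J, rows := I, Cdag := X, Rdag := Y }

end Programs

namespace CUROutput

variable {m n : ℕ}

/-- The matrix `C` of selected columns. -/
def C (out : CUROutput ℝ m n) (A : Matrix (Fin m) (Fin n) ℝ) :
    Matrix (Fin m) (Fin out.cols.length) ℝ :=
  selectCols A out.cols

/-- The matrix `R` of selected rows. -/
def R (out : CUROutput ℝ m n) (A : Matrix (Fin m) (Fin n) ℝ) :
    Matrix (Fin out.rows.length) (Fin n) ℝ :=
  selectRows A out.rows

/-- The matrix `U = C† A R†`. -/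
noncomputable def U (out : CUROutput ℝ m n) (A : Matrix (Fin m) (Fin n) ℝ) :
    Matrix (Fin out.cols.length) (Fin out.rows.length) ℝ :=
  out.Cdag * A * out.Rdag

end CUROutput

/-!
The squared error splits orthogonally. With `P = C C†` and `Q = R† R` the orthogonal projections to
the spans of the selected columns and rows, `C U R = P A Q` and
`‖A - P A Q‖² = ‖A - P A‖² + ‖P (A - A Q)‖²` (`frobSq_sub_mul_mul`). If `W` is the projection to the
top `k` right singular vectors of `A`, the first term is at most
`‖A - A_k‖² + ‖(A - P A) W‖²` (`frobSq_sub_colProj_le`). Both remaining terms are errors of selected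
columns (of `A`, or of `Aᵀ` for the rows) measured on the range of a projection of trace at most
`k`, respectively `c`, and this is what adaptive sampling makes small: drawing `c₂` columns with
probabilities proportional to the squared norms of a residual `D` leaves at most
`(trace / c₂) ‖D‖²` on average (`listAvg_adaptive`). So the expected squared error is at most
`‖A - A_k‖² + (k / c₂ + c / r₂) B`, where `B` bounds the residuals `D` (`Prog.expect_curTailP_le`).
With `c₂ ≈ 2 k / ε`, `r₂ ≈ 2 c / ε` and `B ≈ 2 ‖A - A_k‖²` this is about `(1 + 2 ε) ‖A - A_k‖²`,
and `1 + 2 ε ≤ (1 + ε) ²`.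

The residual `D` belongs to the columns selected by dual set sparsification. The barrier argument
of Batson, Spielman and Srivastava shows that the greedy choice never gets stuck
(`DualSetInv.exists_good`): after averaging over all indices, moving the barrier by one costs no more
potential than a rank one update can pay for (`barrier_sum_le`). The resulting weights give
`‖D‖² ≤ (1 + (1 - √(k / c₁))⁻²) ‖E‖²` up to lower order terms (`IsDualSet.frobSq_sub_le`), which is
close to `2 ‖E‖²` as soon as `c₁ / k` is large.

It remains to see that `E = A - A V Vᵀ` is nearly optimal in expectation. The approximate singular
value decomposition is at least as good as every matrix of rank at most `k` with columns in the
range of `A G` (`Prog.runs_sketchSVDP`). Let `V₁` consist of the top right singular vectors and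
`H = V₁ᵀ G`. A suitable competitor is `A G X V₁ᵀ`, where `X = Hᵀ (H Hᵀ + η)⁻¹` is a regularised right
inverse of `H`; then the excess over `‖A - A_k‖²` is `‖(A - A_k) G X‖²` up to a multiple of `η`
(`IsSketchSVD.frobSq_sub_le`). The regularisation makes all functions of `G` involved smooth and of
polynomial growth, so Gaussian integration by parts (`integral_entry_mul_gaussMeasure`) applies: it
gives `E ‖(A - A_k) G X‖² = ‖A - A_k‖² E ‖X‖²` (`integral_frobSq_mul_ridgeRight`) and
`E ‖X‖² ≤ k / (s - k - 1)` (`integral_trace_ridgeInv_le`), uniformly in `η`, which may therefore tend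
to zero. With `s = k + 1 + k θ²` the excess is a fraction `θ⁻²`; here `θ ≈ ε ^ (-1 / 3)`.

Running time and correctness of the computed matrices are obtained together from a program logic
(`Prog.Runs`) that tracks the number of steps and a postcondition; the program text is followed
instruction by instruction.
-/

/-! ### A logic for randomised programs -/

namespace Prog

variable {α β : Type}

/-- The program `p` takes at most `T` steps, and its result satisfies `Q`, whatever the outcomes
of its random draws. -/
structure Runs (p : Prog ℝ α) (T : ℕ) (Q : α → Prop) : Prop where
  steps_le : p.steps ≤ T
  always : p.Always Q

theorem Always.mono {P Q : α → Prop} (h : ∀ a, P a → Q a) :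
    ∀ {p : Prog ℝ α}, p.Always P → p.Always Q := by
  intro p
  induction p with
  | ret a => exact h a
  | nat a next ih => exact ih _
  | arith o x y next ih => exact ih _
  | sqrt x next ih => exact ih _
  | lt x y next ih => exact ih _
  | gauss n s next ih => exact fun hp G => ih G (hp G)
  | draw N w next ih => exact fun hp i => ih i (hp i)
  | eig s M next ih => exact ih _ _

theorem always_bind {P : β → Prop} {g : α → Prog ℝ β} (p : Prog ℝ α) :
    (p.bind g).Always P ↔ p.Always fun a => (g a).Always P := by
  induction p with
  | ret a => exact Iff.rfl
  | nat a next ih => exact ih _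
  | arith o x y next ih => exact ih _
  | sqrt x next ih => exact ih _
  | lt x y next ih => exact ih _
  | gauss n s next ih => exact forall_congr' fun G => ih G
  | draw N w next ih => exact forall_congr' fun i => ih i
  | eig s M next ih => exact ih _ _

theorem steps_bind_le {g : α → Prog ℝ β} {T : ℕ∞} (p : Prog ℝ α)
    (h : p.Always fun a => (g a).steps ≤ T) : (p.bind g).steps ≤ p.steps + T := by
  induction p with
  | ret a => exact (show (g a).steps ≤ T from h).trans_eq (zero_add T).symm
  | nat a next ih => simpa only [steps, bind, add_assoc] using add_le_add_right (ih _ h) 1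
  | arith o x y next ih => simpa only [steps, bind, add_assoc] using add_le_add_right (ih _ h) 1
  | sqrt x next ih => simpa only [steps, bind, add_assoc] using add_le_add_right (ih _ h) 1
  | lt x y next ih => simpa only [steps, bind, add_assoc] using add_le_add_right (ih _ h) 1
  | gauss n s next ih =>
    simp only [steps, bind, add_assoc]
    refine add_le_add_right (iSup_le fun G => (ih G (h G)).trans ?_) _
    exact add_le_add_left (le_iSup (fun G => (next G).steps) G) _
  | draw N w next ih =>
    simp only [steps, bind, add_assoc]
    refine add_le_add_right (iSup_le fun i => (ih i (h i)).trans ?_) _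
    exact add_le_add_left (le_iSup (fun i => (next i).steps) i) _
  | eig s M next ih => simpa only [steps, bind, add_assoc] using add_le_add_right (ih _ _ h) _

theorem Runs.mono {p : Prog ℝ α} {T T' : ℕ} {Q Q' : α → Prop} (h : p.Runs T Q) (hT : T ≤ T')
    (hQ : ∀ a, Q a → Q' a) : p.Runs T' Q' :=
  ⟨h.steps_le.trans (by exact_mod_cast hT), h.always.mono hQ⟩

theorem Runs.of_le {p : Prog ℝ α} {T T' : ℕ} {Q : α → Prop} (h : p.Runs T Q) (hT : T ≤ T') :
    p.Runs T' Q :=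
  h.mono hT fun _ => id

theorem Runs.bind {p : Prog ℝ α} {g : α → Prog ℝ β} {T T' : ℕ} {Q : α → Prop} {Q' : β → Prop}
    (h : p.Runs T Q) (hg : ∀ a, Q a → (g a).Runs T' Q') : (p >>= g).Runs (T + T') Q' := by
  refine ⟨?_, (always_bind p).2 (h.always.mono fun a ha => (hg a ha).always)⟩
  refine (steps_bind_le p (h.always.mono fun a ha => (hg a ha).steps_le)).trans ?_
  push_cast
  exact add_le_add_left h.steps_le _

theorem Runs.pure {a : α} {Q : α → Prop} (h : Q a) : (pure a : Prog ℝ α).Runs 0 Q :=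
  ⟨le_of_eq rfl, h⟩

theorem runs_natP (a : ℕ) : (natP a : Prog ℝ ℝ).Runs 1 (· = a) := ⟨by simp [natP, steps], rfl⟩

theorem runs_addP (x y : ℝ) : (addP x y).Runs 1 (· = x + y) := ⟨by simp [addP, steps], rfl⟩

theorem runs_subP (x y : ℝ) : (subP x y).Runs 1 (· = x - y) := ⟨by simp [subP, steps], rfl⟩

theorem runs_mulP (x y : ℝ) : (mulP x y).Runs 1 (· = x * y) := ⟨by simp [mulP, steps], rfl⟩

theorem runs_divP (x y : ℝ) : (divP x y).Runs 1 (· = x / y) := ⟨by simp [divP, steps], rfl⟩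

theorem runs_sqrtP (x : ℝ) : (sqrtP x).Runs 1 (· = √x) := ⟨by simp [sqrtP, steps], rfl⟩

theorem runs_ltP (x y : ℝ) : (ltP x y).Runs 1 fun b => b = true ↔ x < y :=
  ⟨by simp [ltP, steps], by simp [ltP, Always]⟩

theorem runs_gaussP (n s : ℕ) : (gaussP n s : Prog ℝ _).Runs (n * s) fun _ => True :=
  ⟨by simp [gaussP, steps], fun _ => trivial⟩

theorem runs_drawP {N : ℕ} (w : Fin N → ℝ) : (drawP w).Runs N fun _ => True :=
  ⟨by simp [drawP, steps], fun _ => trivial⟩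

theorem runs_eigP {s : ℕ} {M : Matrix (Fin s) (Fin s) ℝ} (hM : M.IsSymm) :
    (eigP M).Runs (s ^ 3) fun p => IsSpectral M p.1 p.2 := by
  refine ⟨by simp [eigP, steps], ?_⟩
  have h := exists_isSpectral hM
  simp only [eigP, Always, spectralDecomp, dif_pos h]
  exact h.choose_spec

theorem runs_tabulateP : ∀ {n : ℕ} {f : Fin n → Prog ℝ α} {T : ℕ} {Q : Fin n → α → Prop},
    (∀ i, (f i).Runs T (Q i)) → (tabulateP n f).Runs (n * T) fun v => ∀ i, Q i (v i)
  | 0, _, _, _, _ => by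
    rw [Nat.zero_mul]
    exact Runs.pure fun i => i.elim0
  | n + 1, f, T, Q, h => by
    have := (h 0).bind fun a ha => (runs_tabulateP fun i => h i.succ).bind fun v hv =>
      Runs.pure (a := (Fin.cons (α := fun _ => α) a v : Fin (n + 1) → α))
        (Q := fun v => ∀ i, Q i (v i)) (Fin.cases (by simpa using ha) (by simpa using hv))
    exact this.of_le (by rw [Nat.add_mul]; omega)

theorem runs_tabulateP_eq {n : ℕ} {f : Fin n → Prog ℝ α} {T : ℕ} {g : Fin n → α}
    (h : ∀ i, (f i).Runs T (· = g i)) : (tabulateP n f).Runs (n * T) (· = g) :=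
  (runs_tabulateP h).mono le_rfl fun _ => funext

theorem runs_tabulateMatP {m n : ℕ} {f : Fin m → Fin n → Prog ℝ ℝ} {T : ℕ}
    {B : Matrix (Fin m) (Fin n) ℝ} (h : ∀ i j, (f i j).Runs T (· = B i j)) :
    (tabulateMatP f).Runs (m * (n * T)) (· = B) :=
  runs_tabulateP_eq (g := B) fun i => runs_tabulateP_eq (h i)

theorem runs_sumP : ∀ {n : ℕ} (x : Fin n → ℝ), (sumP n x).Runs (n + 1) (· = ∑ i, x i)
  | 0, x => (runs_natP 0).mono le_rfl fun a h => by simpa using h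
  | n + 1, x => (runs_sumP fun i => x i.succ).bind fun a ha => by
      rw [Fin.sum_univ_succ, ← ha]
      exact runs_addP _ _

theorem runs_dotP {n : ℕ} (x y : Fin n → ℝ) : (dotP x y).Runs (2 * n + 1) (· = x ⬝ᵥ y) := by
  refine ((runs_tabulateP_eq fun i => runs_mulP (x i) (y i)).bind fun z hz => ?_).of_le
    (by omega : n * 1 + (n + 1) ≤ 2 * n + 1)
  subst hz
  exact runs_sumP _

theorem runs_matMulP {m l n : ℕ} (A : Matrix (Fin m) (Fin l) ℝ) (B : Matrix (Fin l) (Fin n) ℝ) :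
    (matMulP A B).Runs (m * (n * (2 * l + 1))) (· = A * B) :=
  runs_tabulateMatP fun _ _ => runs_dotP _ _

theorem runs_matSubP {m n : ℕ} (A B : Matrix (Fin m) (Fin n) ℝ) :
    (matSubP A B).Runs (m * n) (· = A - B) := by
  have h := runs_tabulateMatP (B := A - B) (T := 1) fun i j => runs_subP (A i j) (B i j)
  rwa [mul_one] at h

theorem runs_colSqNormsP {m n : ℕ} (A : Matrix (Fin m) (Fin n) ℝ) :
    (colSqNormsP A).Runs (n * (2 * m + 1)) (· = fun j => ∑ i, A i j ^ 2) :=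
  runs_tabulateP_eq fun j => by
    simpa only [dotProduct, ← sq] using runs_dotP (fun i => A i j) fun i => A i j

theorem runs_conjDiagP {s : ℕ} (W : Matrix (Fin s) (Fin s) ℝ) (d : Fin s → ℝ) :
    (conjDiagP W d).Runs (s * s + s * (s * (2 * s + 1))) (· = W * Matrix.diagonal d * Wᵀ) := by
  have h := runs_tabulateMatP (B := W * Matrix.diagonal d) (T := 1)
    fun i j => by simpa only [Matrix.mul_diagonal] using runs_mulP (W i j) (d j)
  rw [mul_one] at h
  exact h.bind fun T hT => hT ▸ runs_matMulP _ _

/-! ### Expectations -/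

theorem expect_bind (f : β → ℝ≥0∞) (g : α → Prog ℝ β) (p : Prog ℝ α) :
    (p.bind g).expect f = p.expect fun a => (g a).expect f := by
  induction p with
  | ret a => rfl
  | nat a next ih => exact ih _
  | arith o x y next ih => exact ih _
  | sqrt x next ih => exact ih _
  | lt x y next ih => exact ih _
  | gauss n s next ih => exact congrArg _ (funext ih)
  | draw N w next ih => simp only [expect, bind, ih]
  | eig s M next ih => exact ih _ _

theorem upperIntegral_le {Ω : Type} [MeasurableSpace Ω] {μ : Measure Ω} {f g : Ω → ℝ≥0∞}
    (hg : Measurable g) (h : ∀ ω, f ω ≤ g ω) : upperIntegral μ f ≤ ∫⁻ ω, g ω ∂μ :=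
  iInf₂_le_of_le g hg (iInf_le _ h)

instance (n s : ℕ) : IsProbabilityMeasure (gaussMeasure n s) := by
  unfold gaussMeasure; infer_instance

theorem sum_drawProb_le {N : ℕ} (w : Fin N → ℝ) : ∑ i, drawProb w i ≤ 1 := by
  by_cases h : (∀ j, 0 ≤ w j) ∧ 0 < ∑ j, w j
  · simp only [drawProb, if_pos h]
    rw [← ENNReal.ofReal_sum_of_nonneg fun i _ => div_nonneg (h.1 i) h.2.le, ← Finset.sum_div,
      div_self h.2.ne', ENNReal.ofReal_one]
  · simp only [drawProb, if_neg h]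
    simp [ENNReal.mul_inv_le_one]

/-- A bound that holds for all outcomes holds in expectation. This needs only that all the laws
involved have mass at most one. -/
theorem expect_le_of_always {f : α → ℝ≥0∞} {B : ℝ≥0∞} :
    ∀ {p : Prog ℝ α}, p.Always (fun a => f a ≤ B) → p.expect f ≤ B := by
  intro p
  induction p with
  | ret a => exact id
  | nat a next ih => exact ih _
  | arith o x y next ih => exact ih _
  | sqrt x next ih => exact ih _
  | lt x y next ih => exact ih _
  | gauss n s next ih =>
    intro h
    refine (upperIntegral_le (μ := gaussMeasure n s) measurable_const fun G => ih G (h G)).trans ?_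
    simp
  | draw N w next ih =>
    intro h
    calc ∑ i, drawProb w i * expect f (next i) ≤ ∑ i, drawProb w i * B :=
          Finset.sum_le_sum fun i _ => mul_le_mul_right (ih i (h i)) _
      _ ≤ 1 * B := by rw [← Finset.sum_mul]; exact mul_le_mul_left (sum_drawProb_le w) _
      _ = B := one_mul B
  | eig s M next ih => exact ih _ _

theorem Runs.expect_bind_le {p : Prog ℝ α} {g : α → Prog ℝ β} {f : β → ℝ≥0∞} {B : ℝ≥0∞} {T : ℕ}
    {Q : α → Prop} (h : p.Runs T Q) (hg : ∀ a, Q a → (g a).expect f ≤ B) :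
    (p >>= g).expect f ≤ B :=
  (expect_bind f g p).le.trans (expect_le_of_always (h.always.mono hg))

end Prog

/-! ### The Frobenius norm and orthogonal projections -/

/-- The square of the Frobenius norm. -/
def frobSq {m n : ℕ} (A : Matrix (Fin m) (Fin n) ℝ) : ℝ := ∑ i, ∑ j, A i j ^ 2

section FrobSq

variable {l m n q : ℕ}

theorem frobSq_nonneg (A : Matrix (Fin m) (Fin n) ℝ) : 0 ≤ frobSq A :=
  Finset.sum_nonneg fun _ _ => Finset.sum_nonneg fun _ _ => sq_nonneg _

theorem frobNorm_nonneg (A : Matrix (Fin m) (Fin n) ℝ) : 0 ≤ frobNorm A := Real.sqrt_nonneg _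

theorem frobNorm_sq (A : Matrix (Fin m) (Fin n) ℝ) : frobNorm A ^ 2 = frobSq A :=
  Real.sq_sqrt (frobSq_nonneg A)

theorem frobSq_transpose (A : Matrix (Fin m) (Fin n) ℝ) : frobSq Aᵀ = frobSq A :=
  Finset.sum_comm

theorem frobSq_neg (A : Matrix (Fin m) (Fin n) ℝ) : frobSq (-A) = frobSq A := by
  simp [frobSq]

theorem frobSq_eq_trace (A : Matrix (Fin m) (Fin n) ℝ) : frobSq A = (A * Aᵀ).trace := by
  simp [frobSq, Matrix.trace, Matrix.mul_apply, sq]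

theorem frobSq_eq_trace' (A : Matrix (Fin m) (Fin n) ℝ) : frobSq A = (Aᵀ * A).trace := by
  rw [← frobSq_transpose, frobSq_eq_trace, Matrix.transpose_transpose]

theorem frobSq_add_of_left {A B : Matrix (Fin m) (Fin n) ℝ} (h : Aᵀ * B = 0) :
    frobSq (A + B) = frobSq A + frobSq B := by
  have h' : Bᵀ * A = 0 := by
    rw [← Matrix.transpose_transpose A, ← Matrix.transpose_mul, h, Matrix.transpose_zero]
  simp only [frobSq_eq_trace', Matrix.transpose_add, Matrix.add_mul, Matrix.mul_add, h, h',
    Matrix.trace_add, Matrix.trace_zero]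
  ring

theorem frobSq_add_of_right {A B : Matrix (Fin m) (Fin n) ℝ} (h : A * Bᵀ = 0) :
    frobSq (A + B) = frobSq A + frobSq B := by
  rw [← frobSq_transpose, Matrix.transpose_add, frobSq_add_of_left, frobSq_transpose,
    frobSq_transpose]
  rwa [Matrix.transpose_transpose]

theorem frobSq_orth_mul {Q : Matrix (Fin m) (Fin l) ℝ} (hQ : Qᵀ * Q = 1)
    (B : Matrix (Fin l) (Fin n) ℝ) : frobSq (Q * B) = frobSq B := by
  rw [frobSq_eq_trace', Matrix.transpose_mul, Matrix.mul_assoc, ← Matrix.mul_assoc Qᵀ, hQ,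
    Matrix.one_mul, frobSq_eq_trace']

theorem frobSq_mul_orth {Q : Matrix (Fin n) (Fin l) ℝ} (hQ : Qᵀ * Q = 1)
    (B : Matrix (Fin m) (Fin l) ℝ) : frobSq (B * Qᵀ) = frobSq B := by
  rw [← frobSq_transpose, Matrix.transpose_mul, Matrix.transpose_transpose, frobSq_orth_mul hQ,
    frobSq_transpose]

theorem frobSq_eq_sum_cols (A : Matrix (Fin m) (Fin n) ℝ) : frobSq A = ∑ j, ∑ i, A i j ^ 2 :=
  Finset.sum_comm

/-- A symmetric idempotent matrix, that is, the matrix of an orthogonal projection. -/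
structure IsOrthProj (P : Matrix (Fin n) (Fin n) ℝ) : Prop where
  symm : Pᵀ = P
  idem : P * P = P

namespace IsOrthProj

variable {P : Matrix (Fin m) (Fin m) ℝ}

theorem of_orth {Q : Matrix (Fin m) (Fin l) ℝ} (hQ : Qᵀ * Q = 1) : IsOrthProj (Q * Qᵀ) :=
  ⟨by simp, by rw [Matrix.mul_assoc, ← Matrix.mul_assoc Qᵀ, hQ, Matrix.one_mul]⟩

theorem transpose_mul_sub (hP : IsOrthProj P) (A : Matrix (Fin m) (Fin n) ℝ)
    (B : Matrix (Fin m) (Fin q) ℝ) : (P * B)ᵀ * (A - P * A) = 0 := by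
  rw [Matrix.transpose_mul, hP.symm, Matrix.mul_assoc, Matrix.mul_sub, ← Matrix.mul_assoc P,
    hP.idem, sub_self, Matrix.mul_zero]

theorem frobSq_eq (hP : IsOrthProj P) (A : Matrix (Fin m) (Fin n) ℝ) :
    frobSq A = frobSq (P * A) + frobSq (A - P * A) := by
  rw [← frobSq_add_of_left (hP.transpose_mul_sub A A), add_sub_cancel]

theorem frobSq_mul_le (hP : IsOrthProj P) (A : Matrix (Fin m) (Fin n) ℝ) :
    frobSq (P * A) ≤ frobSq A := by
  linarith [hP.frobSq_eq A, frobSq_nonneg (A - P * A)]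

theorem frobSq_mul_le' (hP : IsOrthProj P) (A : Matrix (Fin n) (Fin m) ℝ) :
    frobSq (A * P) ≤ frobSq A := by
  rw [← frobSq_transpose, Matrix.transpose_mul, hP.symm, ← frobSq_transpose A]
  exact hP.frobSq_mul_le _

/-- `P * A` is the best approximation of `A` by matrices with columns in the range of `P`. -/
theorem frobSq_sub_le (hP : IsOrthProj P) (A : Matrix (Fin m) (Fin n) ℝ)
    {T : Matrix (Fin m) (Fin n) ℝ} (hT : P * T = T) :
    frobSq (A - P * A) ≤ frobSq (A - T) := by
  have h : A - T = P * (A - T) + (A - P * A) := by rw [Matrix.mul_sub, hT]; abel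
  rw [h, frobSq_add_of_left (hP.transpose_mul_sub A _)]
  linarith [frobSq_nonneg (P * (A - T))]

theorem frobSq_self (hP : IsOrthProj P) : frobSq P = P.trace := by
  rw [frobSq_eq_trace, hP.symm, hP.idem]

theorem apply_self (hP : IsOrthProj P) (i : Fin m) : P i i = ∑ j, P i j ^ 2 := by
  conv_lhs => rw [← hP.idem]
  rw [Matrix.mul_apply]
  refine Finset.sum_congr rfl fun j _ => ?_
  rw [sq]
  congr 1
  exact congrFun (congrFun hP.symm i) j

theorem apply_self_le_one (hP : IsOrthProj P) (i : Fin m) : P i i ≤ 1 := by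
  have h1 : P i i ^ 2 ≤ P i i := by
    conv_rhs => rw [hP.apply_self i]
    exact Finset.single_le_sum (f := fun j => P i j ^ 2) (fun j _ => sq_nonneg _)
      (Finset.mem_univ i)
  nlinarith

theorem trace_le (hP : IsOrthProj P) : P.trace ≤ m := by
  simpa [Matrix.trace] using Finset.sum_le_sum fun i (_ : i ∈ Finset.univ) =>
    hP.apply_self_le_one i

theorem trace_nonneg (hP : IsOrthProj P) : 0 ≤ P.trace := hP.frobSq_self ▸ frobSq_nonneg P

end IsOrthProj

/-- `A * (Z * Zᵀ)` is the best approximation of `A` by matrices with rows in the span of the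
columns of `Z`. -/
theorem frobSq_sub_mul_transpose_le {Z : Matrix (Fin n) (Fin l) ℝ} (hZ : Zᵀ * Z = 1)
    (A : Matrix (Fin m) (Fin n) ℝ) (D : Matrix (Fin m) (Fin l) ℝ) :
    frobSq (A - A * (Z * Zᵀ)) ≤ frobSq (A - D * Zᵀ) := by
  have h := (IsOrthProj.of_orth hZ).frobSq_sub_le Aᵀ (T := (D * Zᵀ)ᵀ) (by
    rw [Matrix.transpose_mul, Matrix.transpose_transpose, Matrix.mul_assoc, ← Matrix.mul_assoc Zᵀ,
      hZ, Matrix.one_mul])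
  rw [← Matrix.transpose_sub, frobSq_transpose] at h
  refine le_trans (le_of_eq ?_) h
  rw [← frobSq_transpose]
  simp [Matrix.mul_assoc]

theorem frobSq_sub_mul_proj {Z : Matrix (Fin n) (Fin l) ℝ} (hZ : Zᵀ * Z = 1)
    (A : Matrix (Fin m) (Fin n) ℝ) :
    frobSq A = frobSq (A * Z) + frobSq (A - A * (Z * Zᵀ)) := by
  have h := (IsOrthProj.of_orth hZ).frobSq_eq Aᵀ
  rw [frobSq_transpose, Matrix.mul_assoc, frobSq_orth_mul hZ] at h
  rw [h, ← frobSq_transpose (A * Z), ← frobSq_transpose (A - A * (Z * Zᵀ))]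
  simp [Matrix.mul_assoc]

theorem trace_of_orth {Q : Matrix (Fin m) (Fin l) ℝ} (hQ : Qᵀ * Q = 1) :
    (Q * Qᵀ).trace = l := by
  rw [Matrix.trace_mul_comm, hQ]; simp

/-! ### Moore-Penrose inverses -/

namespace IsMoorePenrose

variable {A : Matrix (Fin m) (Fin n) ℝ} {X : Matrix (Fin n) (Fin m) ℝ}

theorem transpose (h : IsMoorePenrose A X) : IsMoorePenrose Aᵀ Xᵀ where
  mul_mul_self := by
    rw [Matrix.mul_assoc, ← Matrix.transpose_mul, ← Matrix.transpose_mul, h.mul_mul_self]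
  mul_mul_inv := by
    rw [Matrix.mul_assoc, ← Matrix.transpose_mul, ← Matrix.transpose_mul, h.mul_mul_inv]
  symm_left := by
    rw [Matrix.transpose_mul, Matrix.transpose_transpose, Matrix.transpose_transpose,
      ← h.symm_right, Matrix.transpose_mul]
  symm_right := by
    rw [Matrix.transpose_mul, Matrix.transpose_transpose, Matrix.transpose_transpose,
      ← h.symm_left, Matrix.transpose_mul]

theorem isOrthProj (h : IsMoorePenrose A X) : IsOrthProj (A * X) :=
  ⟨h.symm_left, by rw [← Matrix.mul_assoc, h.mul_mul_self]⟩

theorem isOrthProj' (h : IsMoorePenrose A X) : IsOrthProj (X * A) :=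
  ⟨h.symm_right, by rw [← Matrix.mul_assoc, h.mul_mul_inv]⟩

theorem trace_le (h : IsMoorePenrose A X) : (A * X).trace ≤ n := by
  rw [Matrix.trace_mul_comm]
  exact h.isOrthProj'.trace_le

end IsMoorePenrose

/-- The formula for the Moore-Penrose inverse of `A` in terms of a spectral decomposition of
`Aᵀ * A`. -/
theorem IsSpectral.isMoorePenrose {A : Matrix (Fin m) (Fin n) ℝ} {lam : Fin n → ℝ}
    {W : Matrix (Fin n) (Fin n) ℝ} (h : IsSpectral (Aᵀ * A) lam W) :
    IsMoorePenrose A (W * Matrix.diagonal (fun i => if 0 < lam i then 1 / lam i else 0) * Wᵀ * Aᵀ)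
    := by
  set d : Fin n → ℝ := fun i => if 0 < lam i then 1 / lam i else 0
  have hnn : ∀ i, 0 ≤ lam i := by
    intro i
    have h1 : Matrix.diagonal lam = (A * W)ᵀ * (A * W) := by
      rw [Matrix.transpose_mul, Matrix.mul_assoc, ← Matrix.mul_assoc Aᵀ, h.eq]
      simp only [Matrix.mul_assoc]
      rw [h.orth, Matrix.mul_one, ← Matrix.mul_assoc, h.orth, Matrix.one_mul]
    have h2 := congrFun (congrFun h1 i) i
    rw [Matrix.diagonal_apply_eq] at h2
    rw [h2, Matrix.mul_apply]
    exact Finset.sum_nonneg fun j _ => mul_self_nonneg _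
  have hconj : ∀ a b : Fin n → ℝ, (W * Matrix.diagonal a * Wᵀ) * (W * Matrix.diagonal b * Wᵀ) =
      W * Matrix.diagonal (fun i => a i * b i) * Wᵀ := by
    intro a b
    rw [← Matrix.diagonal_mul_diagonal]
    simp only [Matrix.mul_assoc]
    rw [← Matrix.mul_assoc Wᵀ W, h.orth, Matrix.one_mul]
  have hsym : ∀ a : Fin n → ℝ, (W * Matrix.diagonal a * Wᵀ)ᵀ = W * Matrix.diagonal a * Wᵀ := by
    intro a
    simp [Matrix.mul_assoc]
  have hdl : ∀ i, d i * lam i * d i = d i ∧ lam i * d i * lam i = lam i := by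
    intro i
    simp only [d]
    split_ifs with hi
    · have := hi.ne'
      constructor <;> field_simp
    · have : lam i = 0 := le_antisymm (not_lt.1 hi) (hnn i)
      simp [this]
  set H := W * Matrix.diagonal d * Wᵀ with hH
  have hHG : H * (Aᵀ * A) = W * Matrix.diagonal (fun i => d i * lam i) * Wᵀ := by
    rw [h.eq, hconj]
  have hGHG : Aᵀ * A * (H * (Aᵀ * A)) = Aᵀ * A := by
    rw [hHG, h.eq, hconj]
    simp only [← mul_assoc, (hdl _).2]
  have hHGH : H * (Aᵀ * A) * H = H := by
    rw [hHG, hH, hconj]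
    simp only [(hdl _).1]
  refine ⟨?_, ?_, ?_, ?_⟩
  · have h0 : Aᵀ * A * (H * (Aᵀ * A) - 1) = 0 := by
      rw [Matrix.mul_sub, hGHG, Matrix.mul_one, sub_self]
    rw [← Matrix.conjTranspose_eq_transpose_of_trivial,
      Matrix.conjTranspose_mul_self_mul_eq_zero, Matrix.mul_sub, Matrix.mul_one, sub_eq_zero] at h0
    simpa only [Matrix.mul_assoc, Matrix.conjTranspose_eq_transpose_of_trivial] using h0
  · calc H * Aᵀ * A * (H * Aᵀ) = (H * (Aᵀ * A) * H) * Aᵀ := by simp only [Matrix.mul_assoc]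
      _ = H * Aᵀ := by rw [hHGH]
  · rw [Matrix.transpose_mul, Matrix.transpose_mul, Matrix.transpose_transpose, hsym d,
      Matrix.mul_assoc]
  · rw [Matrix.mul_assoc, hHG, hsym]

theorem exists_isMoorePenrose (A : Matrix (Fin m) (Fin n) ℝ) : ∃ X, IsMoorePenrose A X :=
  let ⟨_, hp⟩ := exists_isSpectral (M := Aᵀ * A) (by simp [Matrix.IsSymm])
  ⟨_, hp.isMoorePenrose⟩

/-! ### Sums of largest eigenvalues -/

/-- A weighted sum with weights in `[0, 1]` of total at most `k` is at most the sum of the `k` largest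
values. -/
theorem sum_mul_le_sum_ite {lam p : Fin q → ℝ} {k : ℕ} (hl : Antitone lam) (h0 : ∀ i, 0 ≤ lam i)
    (hp0 : ∀ i, 0 ≤ p i) (hp1 : ∀ i, p i ≤ 1) (hk : ∑ i, p i ≤ k) :
    ∑ i, lam i * p i ≤ ∑ i : Fin q, if (i : ℕ) < k then lam i else 0 := by
  rcases le_or_gt q k with hqk | hkq
  · refine Finset.sum_le_sum fun i _ => ?_
    rw [if_pos (i.2.trans_le hqk)]
    exact mul_le_of_le_one_right (h0 i) (hp1 i)
  · set μ := lam ⟨k, hkq⟩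
    -- the threshold `μ` separates the largest `k` values from the others
    have hterm : ∀ i : Fin q, μ * ((if (i : ℕ) < k then 1 else 0) - p i) ≤
        (if (i : ℕ) < k then lam i else 0) - lam i * p i := by
      intro i
      split_ifs with hi
      · have : μ ≤ lam i := hl (show i ≤ ⟨k, hkq⟩ from hi.le)
        nlinarith [hp1 i]
      · have : lam i ≤ μ := hl (show ⟨k, hkq⟩ ≤ i from not_lt.1 hi)
        nlinarith [hp0 i]
    have hcount : ∑ i : Fin q, (if (i : ℕ) < k then (1 : ℝ) else 0) = k := by
      rw [Fin.sum_univ_eq_sum_range (fun i => if i < k then (1 : ℝ) else 0), ← Finset.sum_filter,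
        Finset.sum_const, nsmul_eq_mul, mul_one]
      have : (Finset.range q).filter (· < k) = Finset.range k := by
        ext i; simp only [Finset.mem_filter, Finset.mem_range]; omega
      rw [this, Finset.card_range]
    have := Finset.sum_le_sum fun i (_ : i ∈ Finset.univ) => hterm i
    rw [← Finset.mul_sum, Finset.sum_sub_distrib, Finset.sum_sub_distrib, hcount] at this
    have hμ : 0 ≤ μ * (k - ∑ i, p i) := mul_nonneg (h0 _) (by linarith)
    linarith

/-- Ky Fan's inequality: compressing a positive semidefinite matrix to a subspace of dimension at
most `k` leaves at most the sum of its `k` largest eigenvalues as trace. -/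
theorem IsOrthProj.trace_mul_le {R : Matrix (Fin m) (Fin m) ℝ} (hR : IsOrthProj R) {k : ℕ}
    (hk : R.trace ≤ k) {W : Matrix (Fin m) (Fin q) ℝ} (hW : Wᵀ * W = 1) {lam : Fin q → ℝ}
    (hl : Antitone lam) (h0 : ∀ i, 0 ≤ lam i) :
    (R * (W * Matrix.diagonal lam * Wᵀ)).trace ≤ ∑ i : Fin q, if (i : ℕ) < k then lam i else 0 := by
  have hcol : ∀ i, (Wᵀ * R * W) i i = ∑ j, (R * W) j i ^ 2 := by
    intro i
    have : Wᵀ * R * W = (R * W)ᵀ * (R * W) := by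
      rw [Matrix.transpose_mul, hR.symm, Matrix.mul_assoc, Matrix.mul_assoc, ← Matrix.mul_assoc R,
        hR.idem]
    rw [this, Matrix.mul_apply]
    simp [sq]
  have htr : (R * (W * Matrix.diagonal lam * Wᵀ)).trace = ∑ i, lam i * (Wᵀ * R * W) i i := by
    rw [Matrix.mul_assoc, ← Matrix.mul_assoc R, Matrix.trace_mul_comm, Matrix.mul_assoc,
      ← Matrix.mul_assoc Wᵀ]
    simp [Matrix.trace, Matrix.diagonal_mul]
  rw [htr]
  refine sum_mul_le_sum_ite hl h0 (fun i => ?_) (fun i => ?_) ?_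
  · rw [hcol]
    exact Finset.sum_nonneg fun _ _ => sq_nonneg _
  · set R' : Matrix (Fin m) (Fin m) ℝ := 1 - R with hR'
    have h1 : (Wᵀ * W) i i - (Wᵀ * R * W) i i = (Wᵀ * R' * W) i i := by
      rw [hR', Matrix.mul_sub, Matrix.sub_mul, Matrix.mul_one, Matrix.sub_apply]
    have h2 : Wᵀ * R' * W = (R' * W)ᵀ * (R' * W) := by
      have : R' * R' = R' := by
        rw [hR', Matrix.sub_mul, Matrix.mul_sub, Matrix.mul_sub, hR.idem]; simp
      rw [Matrix.transpose_mul, hR', Matrix.transpose_sub, hR.symm, Matrix.transpose_one,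
        ← hR', Matrix.mul_assoc, Matrix.mul_assoc, ← Matrix.mul_assoc R', this]
    have h3 : 0 ≤ (Wᵀ * R' * W) i i := by
      rw [h2, Matrix.mul_apply]
      exact Finset.sum_nonneg fun j _ => mul_self_nonneg _
    rw [hW, Matrix.one_apply_eq] at h1
    linarith
  · have h1 : frobSq (W * Wᵀ * R) = (Wᵀ * R * W).trace := by
      rw [Matrix.mul_assoc, frobSq_orth_mul hW, frobSq_eq_trace, Matrix.transpose_mul, hR.symm,
        Matrix.transpose_transpose, Matrix.mul_assoc, ← Matrix.mul_assoc R, hR.idem,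
        Matrix.mul_assoc]
    calc ∑ i, (Wᵀ * R * W) i i = frobSq (W * Wᵀ * R) := h1.symm
      _ ≤ frobSq R := (IsOrthProj.of_orth hW).frobSq_mul_le R
      _ ≤ k := by rwa [hR.frobSq_self]

/-! ### Best low-rank approximation -/

section SVD

variable {ρ k : ℕ} {A : Matrix (Fin m) (Fin n) ℝ} {U : Matrix (Fin m) (Fin ρ) ℝ} {σ : Fin ρ → ℝ}
  {V : Matrix (Fin n) (Fin ρ) ℝ}

theorem frobSq_diagonal (d : Fin q → ℝ) : frobSq (Matrix.diagonal d) = ∑ i, d i ^ 2 := by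
  refine Finset.sum_congr rfl fun i _ => ?_
  rw [Finset.sum_eq_single i]
  · simp
  · intro j _ hj
    simp [Matrix.diagonal_apply_ne' _ hj]
  · simp

theorem IsSVD.frobSq_sub_svdTrunc (h : IsSVD A U σ V) (k : ℕ) :
    frobSq (A - svdTrunc k U σ V) =
      frobSq A - ∑ i : Fin ρ, if (i : ℕ) < k then σ i ^ 2 else 0 := by
  have h1 : A - svdTrunc k U σ V =
      U * Matrix.diagonal (fun i : Fin ρ => if (i : ℕ) < k then 0 else σ i) * Vᵀ := by
    conv_lhs => rw [h.eq]
    rw [svdTrunc, ← Matrix.sub_mul, ← Matrix.mul_sub, Matrix.diagonal_sub]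
    congr 3
    funext i
    split_ifs <;> simp
  rw [h1, h.eq, frobSq_mul_orth h.orth_right, frobSq_orth_mul h.orth_left,
    frobSq_mul_orth h.orth_right, frobSq_orth_mul h.orth_left, frobSq_diagonal, frobSq_diagonal,
    ← Finset.sum_sub_distrib]
  refine Finset.sum_congr rfl fun i _ => ?_
  split_ifs <;> simp

/-- The Eckart-Young theorem, for projections of the columns to a subspace. -/
theorem IsSVD.frobSq_sub_svdTrunc_le (h : IsSVD A U σ V) {P : Matrix (Fin m) (Fin m) ℝ}
    (hP : IsOrthProj P) (hk : P.trace ≤ k) :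
    frobSq (A - svdTrunc k U σ V) ≤ frobSq (A - P * A) := by
  have h1 : frobSq (P * A) ≤ ∑ i : Fin ρ, if (i : ℕ) < k then σ i ^ 2 else 0 := by
    have hA : A * Aᵀ = U * Matrix.diagonal (fun i => σ i ^ 2) * Uᵀ := by
      have hd : Matrix.diagonal (fun i => σ i ^ 2) = Matrix.diagonal σ * Matrix.diagonal σ := by
        rw [Matrix.diagonal_mul_diagonal]; simp only [sq]
      rw [h.eq, hd]
      simp only [Matrix.transpose_mul, Matrix.transpose_transpose, Matrix.diagonal_transpose,
        Matrix.mul_assoc]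
      rw [← Matrix.mul_assoc Vᵀ, h.orth_right, Matrix.one_mul]
    rw [frobSq_eq_trace, Matrix.transpose_mul, hP.symm, Matrix.mul_assoc, Matrix.trace_mul_comm,
      ← Matrix.mul_assoc, Matrix.mul_assoc, hP.idem, Matrix.trace_mul_comm, hA]
    exact hP.trace_mul_le hk h.orth_left
      (fun i j hij => pow_le_pow_left₀ (h.pos j).le (h.anti hij) 2) fun i => sq_nonneg _
  rw [h.frobSq_sub_svdTrunc]
  linarith [hP.frobSq_eq A]

/-- The truncated matrix is a projection of `A` to at most `k` of its right singular vectors. -/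
theorem IsSVD.exists_svdTrunc_eq (h : IsSVD A U σ V) (k : ℕ) :
    ∃ (k' : ℕ) (V₁ : Matrix (Fin n) (Fin k') ℝ), k' ≤ k ∧ V₁ᵀ * V₁ = 1 ∧
      svdTrunc k U σ V = A * V₁ * V₁ᵀ := by
  have hle : min k ρ ≤ ρ := min_le_right _ _
  set V₁ : Matrix (Fin n) (Fin (min k ρ)) ℝ := V.submatrix id (Fin.castLE hle) with hV₁
  refine ⟨min k ρ, V₁, min_le_left _ _, ?_, ?_⟩
  · have : V₁ᵀ * V₁ = (Vᵀ * V).submatrix (Fin.castLE hle) (Fin.castLE hle) := by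
      ext i j; simp [hV₁, Matrix.mul_apply]
    rw [this, h.orth_right]
    exact Matrix.submatrix_one _ (Fin.castLE_injective hle)
  · have h1 : V₁ * V₁ᵀ = V * Matrix.diagonal (fun i : Fin ρ => if (i : ℕ) < k then (1 : ℝ) else 0) * Vᵀ
        := by
      ext i j
      rw [Matrix.mul_apply, Matrix.mul_apply]
      simp only [Matrix.mul_diagonal, hV₁, Matrix.submatrix_apply, id, Matrix.transpose_apply]
      have h2 : ∀ x : Fin ρ, V i x * (if (x : ℕ) < k then (1 : ℝ) else 0) * V j x =
          if (x : ℕ) < k then V i x * V j x else 0 := by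
        intro x; split_ifs <;> simp
      simp only [h2]
      rw [← Finset.sum_filter]
      refine Finset.sum_bij (fun x _ => Fin.castLE hle x) ?_ ?_ ?_ ?_
      · intro x _
        have := x.2
        simp only [Finset.mem_filter, Finset.mem_univ, true_and, Fin.val_castLE]
        omega
      · intro x _ y _ hxy
        exact Fin.castLE_injective hle hxy
      · intro y hy
        have hy' : (y : ℕ) < k := by simpa using hy
        exact ⟨⟨y, lt_min hy' y.2⟩, Finset.mem_univ _, rfl⟩
      · intro x _; rfl
    rw [Matrix.mul_assoc, h1, h.eq, svdTrunc]
    simp only [Matrix.mul_assoc]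
    rw [← Matrix.mul_assoc Vᵀ V, h.orth_right, Matrix.one_mul, ← Matrix.mul_assoc (Matrix.diagonal σ),
      Matrix.diagonal_mul_diagonal]
    congr 3
    funext i
    split_ifs <;> simp

end SVD

end FrobSq

/-! ### Computing Moore-Penrose inverses -/

namespace Prog

theorem runs_pinvTallP {p q : ℕ} (A : Matrix (Fin p) (Fin q) ℝ) (hqp : q ≤ p) :
    (pinvTallP A).Runs (13 * (p * q ^ 2) + 2) (IsMoorePenrose A) := by
  have hT : q * (q * (2 * p + 1)) + (q ^ 3 + (1 + (1 + (q * (1 + 1) +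
      ((q * q + q * (q * (2 * q + 1))) + q * (p * (2 * q + 1))))))) ≤ 13 * (p * q ^ 2) + 2 := by
    rcases Nat.eq_zero_or_pos q with rfl | hq
    · simp
    have h1 : q ^ 3 ≤ p * q ^ 2 := by rw [pow_succ']; exact Nat.mul_le_mul_right _ hqp
    have h2 : q ≤ q ^ 2 := by nlinarith
    have h3 : q ^ 2 ≤ p * q ^ 2 := Nat.le_mul_of_pos_left _ (hq.trans_le hqp)
    have h4 : p * q ≤ p * q ^ 2 := Nat.mul_le_mul_left _ h2
    nlinarith
  refine Runs.of_le ((runs_matMulP Aᵀ A).bind fun G hG => ?_) hT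
  subst hG
  refine (runs_eigP (by simp [Matrix.IsSymm])).bind ?_
  rintro ⟨lam, W⟩ hS
  refine (runs_natP 0).bind fun zero hz => (runs_natP 1).bind fun one ho => ?_
  refine (runs_tabulateP_eq (g := fun i => if 0 < lam i then 1 / lam i else 0) fun i =>
    (runs_ltP zero (lam i)).bind (T' := 1) fun b hb => ?_).bind fun d hd => ?_
  · rw [hz, Nat.cast_zero] at hb
    by_cases h : 0 < lam i
    · simp only [hb.2 h, if_true, if_pos h]
      have := runs_divP one (lam i)
      rwa [ho, Nat.cast_one] at this ⊢
    · have hb' : ¬ b = true := fun h' => h (hb.1 h')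
      rw [if_neg hb', if_neg h]
      exact (Runs.pure (by simp [hz])).of_le zero_le_one
  · subst hd
    refine (runs_conjDiagP W _).bind fun H hH => ?_
    subst hH
    exact (runs_matMulP _ _).mono le_rfl fun X hX => hX ▸ hS.isMoorePenrose

theorem runs_pinvP {p q : ℕ} (A : Matrix (Fin p) (Fin q) ℝ) :
    (pinvP A).Runs (13 * (p * q ^ 2) + 2) (IsMoorePenrose A) := by
  unfold pinvP
  split_ifs with h
  · exact runs_pinvTallP A h
  · have hpq : p ≤ q := (not_le.1 h).le
    refine ((runs_pinvTallP Aᵀ hpq).bind fun X hX => Runs.pure ?_).of_le ?_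
    · simpa using hX.transpose
    · have : q * p ^ 2 ≤ p * q ^ 2 := by
        calc q * p ^ 2 = (p * q) * p := by ring
          _ ≤ (p * q) * q := Nat.mul_le_mul_left _ hpq
          _ = p * q ^ 2 := by ring
      omega

/-- Since the smaller Gram matrix is decomposed, the cost is bounded in either shape. -/
theorem runs_pinvP' {p q : ℕ} (A : Matrix (Fin p) (Fin q) ℝ) :
    (pinvP A).Runs (13 * (q * p ^ 2) + 2) (IsMoorePenrose A) := by
  unfold pinvP
  split_ifs with h
  · refine (runs_pinvTallP A h).of_le ?_
    have : p * q ^ 2 ≤ q * p ^ 2 := by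
      calc p * q ^ 2 = (q * p) * q := by ring
        _ ≤ (q * p) * p := Nat.mul_le_mul_left _ h
        _ = q * p ^ 2 := by ring
    omega
  · refine ((runs_pinvTallP Aᵀ (not_le.1 h).le).bind fun X hX => Runs.pure ?_).of_le le_rfl
    simpa using hX.transpose

end Prog

/-! ### Gram-Schmidt orthonormalisation -/

/-- The vectors of the list are orthonormal. -/
def OrthonormalList {n : ℕ} (qs : List (Fin n → ℝ)) : Prop :=
  qs.Pairwise (fun x y => x ⬝ᵥ y = 0) ∧ ∀ x ∈ qs, x ⬝ᵥ x = 1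

/-- The span of the vectors of a list. -/
def listSpan {n : ℕ} (qs : List (Fin n → ℝ)) : Submodule ℝ (Fin n → ℝ) :=
  Submodule.span ℝ {x | x ∈ qs}

section Lists

variable {n : ℕ}

theorem listSpan_mono {l l' : List (Fin n → ℝ)} (h : ∀ x ∈ l, x ∈ l') :
    listSpan l ≤ listSpan l' :=
  Submodule.span_mono h

theorem OrthonormalList.of_sublist {l l' : List (Fin n → ℝ)} (h : OrthonormalList l')
    (hl : l.Sublist l') : OrthonormalList l :=
  ⟨h.1.sublist hl, fun x hx => h.2 x (hl.subset hx)⟩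

theorem OrthonormalList.append_singleton {l : List (Fin n → ℝ)} (h : OrthonormalList l)
    {q : Fin n → ℝ} (hq : q ⬝ᵥ q = 1) (hlq : ∀ x ∈ l, x ⬝ᵥ q = 0) : OrthonormalList (l ++ [q]) := by
  refine ⟨List.pairwise_append.2 ⟨h.1, List.pairwise_singleton _ _, fun x hx y hy => ?_⟩, ?_⟩
  · rw [List.mem_singleton.1 hy]; exact hlq x hx
  · intro x hx
    rcases List.mem_append.1 hx with hx | hx
    · exact h.2 x hx
    · rw [List.mem_singleton.1 hx]; exact hq

/-- The matrix with the vectors of a list as its columns. -/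
def listMat (qs : List (Fin n → ℝ)) : Matrix (Fin n) (Fin qs.length) ℝ := fun i j => qs.get j i

theorem OrthonormalList.transpose_mul_self {qs : List (Fin n → ℝ)} (h : OrthonormalList qs) :
    (listMat qs)ᵀ * listMat qs = 1 := by
  ext a b
  have hab : ((listMat qs)ᵀ * listMat qs) a b = qs.get a ⬝ᵥ qs.get b := rfl
  rw [hab]
  rcases lt_trichotomy a b with hlt | rfl | hlt
  · rw [Matrix.one_apply_ne hlt.ne]
    exact List.pairwise_iff_get.1 h.1 a b hlt
  · rw [Matrix.one_apply_eq]
    exact h.2 _ (List.get_mem _ _)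
  · rw [Matrix.one_apply_ne hlt.ne', dotProduct_comm]
    exact List.pairwise_iff_get.1 h.1 b a hlt

theorem OrthonormalList.mulVec_eq_self {qs : List (Fin n → ℝ)} (h : OrthonormalList qs)
    {x : Fin n → ℝ} (hx : x ∈ listSpan qs) : (listMat qs * (listMat qs)ᵀ) *ᵥ x = x := by
  induction hx using Submodule.span_induction with
  | mem x hx =>
    obtain ⟨j, rfl⟩ := List.get_of_mem hx
    have : qs.get j = listMat qs *ᵥ Pi.single j 1 := by
      rw [Matrix.mulVec_single_one]; rfl
    rw [this, Matrix.mulVec_mulVec, Matrix.mul_assoc, h.transpose_mul_self, Matrix.mul_one]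
  | zero => exact Matrix.mulVec_zero _
  | add x y _ _ hx hy => rw [Matrix.mulVec_add, hx, hy]
  | smul a x _ hx => rw [Matrix.mulVec_smul, hx]

/-- A list of orthonormal vectors whose span contains the first `k` standard unit vectors has
length at least `k`. -/
theorem OrthonormalList.le_length {qs : List (Fin n → ℝ)} (h : OrthonormalList qs) {k : ℕ}
    (hkn : k ≤ n) (hk : ∀ i : Fin n, (i : ℕ) < k → Pi.single i 1 ∈ listSpan qs) :
    k ≤ qs.length := by
  set P := listMat qs * (listMat qs)ᵀ
  have hP : IsOrthProj P := IsOrthProj.of_orth h.transpose_mul_self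
  have h1 : ∀ i : Fin n, (if (i : ℕ) < k then (1 : ℝ) else 0) ≤ P i i := by
    intro i
    split_ifs with hi
    · have := congrFun (h.mulVec_eq_self (hk i hi)) i
      rw [Matrix.mulVec_single_one, Pi.single_eq_same] at this
      exact this.ge
    · rw [hP.apply_self]
      exact Finset.sum_nonneg fun _ _ => sq_nonneg _
  have h2 : (k : ℝ) ≤ P.trace := by
    refine le_trans (le_of_eq ?_) (Finset.sum_le_sum fun i _ => h1 i)
    rw [Fin.sum_univ_eq_sum_range (fun i => if i < k then (1 : ℝ) else 0), ← Finset.sum_filter,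
      Finset.sum_const, nsmul_eq_mul, mul_one]
    have : (Finset.range n).filter (· < k) = Finset.range k := by
      ext i; simp only [Finset.mem_filter, Finset.mem_range]; omega
    rw [this, Finset.card_range]
  rw [trace_of_orth h.transpose_mul_self] at h2
  exact_mod_cast h2

end Lists

namespace Prog

variable {n : ℕ}

theorem runs_residualP : ∀ (qs : List (Fin n → ℝ)) (w : Fin n → ℝ), OrthonormalList qs →
    (residualP qs w).Runs (qs.length * (4 * n + 1))
      fun w' => (∀ q ∈ qs, q ⬝ᵥ w' = 0) ∧ w - w' ∈ listSpan qs
  | [], w, _ => (Runs.pure ⟨by simp, by simp⟩).of_le (Nat.zero_le _)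
  | q :: qs, w, h => by
    have hT : 2 * n + 1 + (n * (1 + 1) + qs.length * (4 * n + 1)) ≤
        (q :: qs).length * (4 * n + 1) := by
      rw [List.length_cons, Nat.add_mul]; omega
    refine Runs.of_le ((runs_dotP q w).bind fun a ha => (runs_tabulateP_eq
      (g := fun i => w i - a * q i) fun i => (runs_mulP a (q i)).bind fun b hb => ?_).bind
      fun w' hw' => ?_) hT
    · rw [← hb]; exact runs_subP _ _
    · have hq : q ⬝ᵥ q = 1 := h.2 q List.mem_cons_self
      have hqs : ∀ x ∈ qs, q ⬝ᵥ x = 0 := (List.pairwise_cons.1 h.1).1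
      have hw : w' = w - a • q := by rw [hw']; rfl
      have hqw : q ⬝ᵥ w' = 0 := by
        rw [hw, dotProduct_sub, dotProduct_smul, hq, ha]; simp
      refine (runs_residualP qs w' (h.of_sublist (List.sublist_cons_self _ _))).mono le_rfl ?_
      rintro v ⟨hv, hspan⟩
      have hle : listSpan qs ≤ listSpan (q :: qs) := listSpan_mono fun x => List.mem_cons_of_mem _
      refine ⟨fun x hx => ?_, ?_⟩
      · rcases List.mem_cons.1 hx with rfl | hx
        · have h0 : ∀ y ∈ listSpan qs, x ⬝ᵥ y = 0 := by
            intro y hy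
            induction hy using Submodule.span_induction with
            | mem y hy => exact hqs y hy
            | zero => exact dotProduct_zero _
            | add y z _ _ hy hz => rw [dotProduct_add, hy, hz, add_zero]
            | smul c y _ hy => rw [dotProduct_smul, hy, smul_zero]
          have := h0 _ hspan
          rwa [dotProduct_sub, hqw, zero_sub, neg_eq_zero] at this
        · exact hv x hx
      · have : w - v = a • q + (w' - v) := by rw [hw]; abel
        rw [this]
        exact add_mem (Submodule.smul_mem _ _ (Submodule.subset_span List.mem_cons_self))
          (hle hspan)

theorem runs_gramSchmidtP : ∀ (qs vs : List (Fin n → ℝ)), OrthonormalList qs →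
    (gramSchmidtP qs vs).Runs
      (vs.length * ((qs.length + vs.length) * (4 * n + 1) + 3 * n + 4)) fun rs =>
        OrthonormalList rs ∧ qs <+: rs ∧ rs.length ≤ qs.length + vs.length ∧
          ∀ j, ∀ v ∈ vs.take j, v ∈ listSpan (rs.take (qs.length + j))
  | qs, [], h => (Runs.pure ⟨h, List.prefix_rfl, by simp, by simp⟩).of_le (Nat.zero_le _)
  | qs, v :: vs, h => by
    set T' := vs.length * ((qs.length + 1 + vs.length) * (4 * n + 1) + 3 * n + 4) with hT'
    have hT : qs.length * (4 * n + 1) + (2 * n + 1 + (1 + (1 + (1 + (n * 1 + T'))))) ≤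
        (v :: vs).length * ((qs.length + (v :: vs).length) * (4 * n + 1) + 3 * n + 4) := by
      have : (qs.length + (v :: vs).length) = qs.length + 1 + vs.length := by
        rw [List.length_cons]; omega
      rw [this, List.length_cons, Nat.add_mul vs.length 1, ← hT']
      nlinarith
    -- both branches continue with a list whose span contains `v`
    have key : ∀ qs' : List (Fin n → ℝ), OrthonormalList qs' → qs <+: qs' →
        qs'.length ≤ qs.length + 1 → v ∈ listSpan qs' → (gramSchmidtP qs' vs).Runs T' fun rs =>
          OrthonormalList rs ∧ qs <+: rs ∧ rs.length ≤ qs.length + (v :: vs).length ∧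
            ∀ j, ∀ x ∈ (v :: vs).take j, x ∈ listSpan (rs.take (qs.length + j)) := by
      intro qs' ho hpre hlen hv
      refine (runs_gramSchmidtP qs' vs ho).mono ?_ ?_
      · rw [hT']; gcongr
      rintro rs ⟨h1, h2, h3, h4⟩
      refine ⟨h1, hpre.trans h2, by rw [List.length_cons]; omega, ?_⟩
      rintro (_ | j) x hx
      · simp at hx
      · rw [List.take_succ_cons] at hx
        rcases List.mem_cons.1 hx with rfl | hx
        · refine listSpan_mono (fun y hy => ?_) hv
          have h5 : qs' = rs.take qs'.length := List.prefix_iff_eq_take.1 h2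
          rw [h5] at hy
          exact List.take_subset_take_left _ (by omega) hy
        · exact listSpan_mono (fun y hy => List.take_subset_take_left _ (by omega) hy) (h4 j x hx)
    refine Runs.of_le ((runs_residualP qs v h).bind ?_) hT
    rintro w ⟨hw, hvw⟩
    refine (runs_dotP w w).bind fun a ha => (runs_natP 0).bind fun zero hz =>
      (runs_ltP zero a).bind fun b hb => ?_
    have ha0 : 0 ≤ a := by
      rw [ha]; exact Finset.sum_nonneg fun _ _ => mul_self_nonneg _
    rw [hz, Nat.cast_zero] at hb
    cases b with
    | true =>
      rw [if_pos rfl]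
      have ha' : 0 < a := hb.1 rfl
      refine (runs_sqrtP a).bind fun c hc => (runs_tabulateP_eq (g := fun i => w i / c)
        fun i => runs_divP _ _).bind fun q hq => ?_
      have hc0 : 0 < c := hc ▸ Real.sqrt_pos.2 ha'
      have hq' : q = c⁻¹ • w := by
        rw [hq]; funext i; simp [div_eq_inv_mul]
      refine key _ (h.append_singleton ?_ fun x hx => ?_) (List.prefix_append _ _) (by simp) ?_
      · rw [hq', smul_dotProduct, dotProduct_smul, ← ha, smul_eq_mul, smul_eq_mul,
          ← Real.mul_self_sqrt ha0, ← hc]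
        field_simp
      · rw [hq', dotProduct_smul, hw x hx, smul_zero]
      · have hv : v = (v - w) + c • q := by
          rw [hq', smul_smul, mul_inv_cancel₀ hc0.ne', one_smul]; abel
        rw [hv]
        exact add_mem (listSpan_mono (fun x hx => List.mem_append_left _ hx) hvw)
          (Submodule.smul_mem _ _ (Submodule.subset_span (by simp)))
    | false =>
      rw [if_neg Bool.false_ne_true]
      have ha' : a = 0 := le_antisymm (not_lt.1 fun h' => Bool.false_ne_true (hb.2 h')) ha0
      have hw0 : w = 0 := dotProduct_self_eq_zero.1 (ha ▸ ha')
      rw [hw0, sub_zero] at hvw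
      exact (key qs h List.prefix_rfl (Nat.le_succ _) hvw).of_le (by omega)

theorem runs_orthBasisP {k : ℕ} (hk : 0 < k) (hkn : k ≤ n) {vs : List (Fin n → ℝ)}
    (hvs : vs.length ≤ k) : (orthBasisP k vs).Runs (36 * (n * k ^ 2)) fun Z =>
      Zᵀ * Z = 1 ∧ ∀ v ∈ vs, (Z * Zᵀ) *ᵥ v = v := by
  have hT : 1 + (1 + ((k + k) * ((0 + (k + k)) * (4 * n + 1) + 3 * n + 4) + 0)) ≤
      36 * (n * k ^ 2) := by
    have h1 : k ^ 2 ≤ n * k ^ 2 := Nat.le_mul_of_pos_left _ (hk.trans_le hkn)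
    have h2 : k ≤ k ^ 2 := by nlinarith
    have h3 : n * k ≤ n * k ^ 2 := Nat.mul_le_mul_left _ h2
    nlinarith
  refine Runs.of_le ((runs_natP 0).bind fun zero hz => (runs_natP 1).bind fun one ho => ?_) hT
  set units : List (Fin n → ℝ) :=
    (List.range k).map fun i (j : Fin n) => if (j : ℕ) = i then one else zero with hunits
  have hlen : (vs ++ units).length ≤ k + k := by simp [hunits, hvs]
  refine ((runs_gramSchmidtP [] (vs ++ units) ⟨List.Pairwise.nil, by simp⟩).of_le ?_).bind ?_
  · rw [List.length_nil]; gcongr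
  rintro rs ⟨h1, -, -, h4⟩
  simp only [List.length_nil, zero_add] at h4
  have hk' : k ≤ rs.length := by
    refine h1.le_length hkn fun i hi => ?_
    refine listSpan_mono (List.take_subset _ _) (h4 (vs ++ units).length _ ?_)
    rw [List.take_length]
    refine List.mem_append_right _ (List.mem_map.2 ⟨i, List.mem_range.2 hi, ?_⟩)
    funext j
    rw [hz, ho, Pi.single_apply]
    simp [Fin.ext_iff]
  refine Runs.pure ?_
  set L := rs.take k with hL
  have hLo : OrthonormalList L := h1.of_sublist (List.take_sublist _ _)
  have hLl : L.length = k := by rw [hL, List.length_take, min_eq_left hk']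
  have hspan : ∀ v ∈ vs, v ∈ listSpan L := by
    intro v hv
    refine listSpan_mono (fun y hy => List.take_subset_take_left _ hvs hy) (h4 vs.length v ?_)
    simpa using hv
  have hget : ∀ (j : ℕ) (hj : j < L.length), rs.getD j (fun _ => zero) = L[j] := by
    intro j hj
    rw [List.getD_eq_getElem _ _ (by omega)]
    simp [hL]
  clear_value L
  subst hLl
  have hZ : (fun i j => rs.getD (j : ℕ) (fun _ => zero) i : Matrix (Fin n) (Fin L.length) ℝ) =
      listMat L := by
    funext i j
    rw [hget j j.2]; rfl
  rw [hZ]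
  exact ⟨hLo.transpose_mul_self, fun v hv => hLo.mulVec_eq_self (hspan v hv)⟩

end Prog

/-! ### The approximate singular value decomposition -/

section RandSVD

variable {m n : ℕ}

theorem frobSq_mul_orth_le {l : ℕ} {Z : Matrix (Fin n) (Fin l) ℝ} (hZ : Zᵀ * Z = 1)
    (A : Matrix (Fin m) (Fin n) ℝ) : frobSq (A * Z) ≤ frobSq A := by
  linarith [frobSq_sub_mul_proj hZ A, frobSq_nonneg (A - A * (Z * Zᵀ))]

/-- If the span of `k` orthonormal vectors contains the first `k` of the vectors `Bᵀ wᵢ`, where the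
`wᵢ` are the eigenvectors of `B * Bᵀ`, then no `k` orthonormal vectors capture more of `B`. -/
theorem IsSpectral.frobSq_mul_le {q k k' : ℕ} {B : Matrix (Fin q) (Fin n) ℝ} {lam : Fin q → ℝ}
    {W : Matrix (Fin q) (Fin q) ℝ} (h : IsSpectral (B * Bᵀ) lam W)
    {Z : Matrix (Fin n) (Fin k) ℝ} (hZ : Zᵀ * Z = 1)
    (hBZ : ∀ i : Fin q, (i : ℕ) < k → (Z * Zᵀ) *ᵥ (fun j => (Bᵀ * W) j i) = fun j => (Bᵀ * W) j i)
    {V : Matrix (Fin n) (Fin k') ℝ} (hV : Vᵀ * V = 1) (hk : k' ≤ k) :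
    frobSq (B * V) ≤ frobSq (B * Z) := by
  have hlam : ∀ i, lam i = ∑ j, (Bᵀ * W) j i ^ 2 := by
    intro i
    have h1 : Matrix.diagonal lam = (Bᵀ * W)ᵀ * (Bᵀ * W) := by
      rw [Matrix.transpose_mul, Matrix.transpose_transpose, Matrix.mul_assoc, ← Matrix.mul_assoc B,
        h.eq]
      simp only [Matrix.mul_assoc]
      rw [h.orth, Matrix.mul_one, ← Matrix.mul_assoc, h.orth, Matrix.one_mul]
    have h2 := congrFun (congrFun h1 i) i
    rw [Matrix.diagonal_apply_eq, Matrix.mul_apply] at h2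
    simpa only [Matrix.transpose_apply, ← sq] using h2
  have hW' : W * Wᵀ = 1 := mul_eq_one_comm.1 h.orth
  have hlo : ∑ i : Fin q, (if (i : ℕ) < k then lam i else 0) ≤ frobSq (B * Z) := by
    have h1 : frobSq (B * Z) = frobSq (Z * Zᵀ * (Bᵀ * W)) := by
      rw [Matrix.mul_assoc, frobSq_orth_mul hZ, ← Matrix.mul_assoc, ← frobSq_transpose,
        Matrix.transpose_mul]
      have := frobSq_mul_orth (Q := Wᵀ) (by rwa [Matrix.transpose_transpose]) (Zᵀ * Bᵀ)
      rw [Matrix.transpose_transpose] at this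
      rw [this]
    rw [h1, frobSq_eq_sum_cols]
    refine Finset.sum_le_sum fun i _ => ?_
    split_ifs with hi
    · rw [hlam]
      refine le_of_eq (Finset.sum_congr rfl fun j _ => ?_)
      exact congrArg (· ^ 2) (congrFun (hBZ i hi) j).symm
    · exact Finset.sum_nonneg fun _ _ => sq_nonneg _
  refine le_trans ?_ hlo
  -- compare with the projection to the column space of `B * V`
  obtain ⟨X, hX⟩ := exists_isMoorePenrose (B * V)
  set R := B * V * X with hR
  have hRp : IsOrthProj R := hX.isOrthProj
  have h2 : B * V = R * B * V := by rw [Matrix.mul_assoc R, hR, hX.mul_mul_self]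
  calc frobSq (B * V) = frobSq (R * B * V) := by rw [← h2]
    _ ≤ frobSq (R * B) := frobSq_mul_orth_le hV _
    _ = (R * (W * Matrix.diagonal lam * Wᵀ)).trace := by
      rw [frobSq_eq_trace, Matrix.transpose_mul, hRp.symm, Matrix.mul_assoc, Matrix.trace_mul_comm,
        ← Matrix.mul_assoc B, h.eq, Matrix.mul_assoc, hRp.idem, Matrix.trace_mul_comm]
    _ ≤ _ := hRp.trace_mul_le (hX.trace_le.trans (by exact_mod_cast hk)) h.orth h.anti fun i => by
      rw [hlam]
      exact Finset.sum_nonneg fun _ _ => sq_nonneg _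

/-- Projecting `A` first to a subspace that contains the range of `Y`, and then to the best
right subspace of dimension `k` for the result, is at least as good for `A` as every matrix of rank
at most `k` with columns in the range of `Y`. -/
theorem frobSq_sub_le_of_projection {q k k' s : ℕ} {A : Matrix (Fin m) (Fin n) ℝ}
    {Q : Matrix (Fin m) (Fin q) ℝ} (hQ : Qᵀ * Q = 1) {Y : Matrix (Fin m) (Fin s) ℝ}
    (hY : Q * Qᵀ * Y = Y) {Z : Matrix (Fin n) (Fin k) ℝ} (hZ : Zᵀ * Z = 1)
    {V : Matrix (Fin n) (Fin k') ℝ} (hV : Vᵀ * V = 1)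
    (hVZ : frobSq (Qᵀ * A * V) ≤ frobSq (Qᵀ * A * Z)) (X : Matrix (Fin s) (Fin k') ℝ) :
    frobSq (A - A * (Z * Zᵀ)) ≤ frobSq (A - Y * X * Vᵀ) := by
  set B := Qᵀ * A with hB
  have hsplit : ∀ C : Matrix (Fin q) (Fin n) ℝ,
      frobSq (A - Q * C) = frobSq (B - C) + frobSq (A - Q * B) := by
    intro C
    have h1 : A - Q * C = Q * (B - C) + (A - Q * B) := by rw [Matrix.mul_sub]; abel
    rw [h1, frobSq_add_of_left, frobSq_orth_mul hQ]
    rw [Matrix.transpose_mul, Matrix.mul_assoc, Matrix.mul_sub, ← Matrix.mul_assoc Qᵀ Q, hQ,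
      Matrix.one_mul, hB, sub_self, Matrix.mul_zero]
  calc frobSq (A - A * (Z * Zᵀ)) ≤ frobSq (A - Q * (B * Z) * Zᵀ) :=
        frobSq_sub_mul_transpose_le hZ A _
    _ = frobSq (B - B * (Z * Zᵀ)) + frobSq (A - Q * B) := by
      rw [← hsplit]; simp only [Matrix.mul_assoc]
    _ ≤ frobSq (B - B * (V * Vᵀ)) + frobSq (A - Q * B) := by
      linarith [frobSq_sub_mul_proj hZ B, frobSq_sub_mul_proj hV B]
    _ ≤ frobSq (B - Qᵀ * Y * X * Vᵀ) + frobSq (A - Q * B) := by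
      linarith [frobSq_sub_mul_transpose_le hV B (Qᵀ * Y * X)]
    _ = frobSq (A - Y * X * Vᵀ) := by
      rw [← hsplit]
      simp only [← Matrix.mul_assoc, hY]

/-- The approximate truncated singular value decomposition, for a given sketching matrix `G`. -/
def sketchSVDP {R : Type} (A : Matrix (Fin m) (Fin n) R) (k : ℕ) {s : ℕ}
    (G : Matrix (Fin n) (Fin s) R) :
    Prog R (Matrix (Fin m) (Fin k) R × Matrix (Fin m) (Fin k) R × Matrix (Fin n) (Fin k) R) := do
  let Y ← matMulP A G
  let qs ← gramSchmidtP [] (columns Y)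
  let Q : Matrix (Fin m) (Fin qs.length) R := fun i j => qs.get j i
  let B ← matMulP Qᵀ A
  let BB ← matMulP B Bᵀ
  let (_, W) ← eigP BB
  let BW ← matMulP Bᵀ W
  let Z ← orthBasisP k ((columns BW).take k)
  let AZ ← matMulP A Z
  let H ← matMulP AZᵀ AZ
  let (_, W') ← eigP H
  let US ← matMulP AZ W'
  let V ← matMulP Z W'
  let U ← orthBasisP k (columns US)
  pure (U, US, V)

/-- The properties of the factors `(U, US, V)` of the approximate singular value decomposition that
is computed from the sketch `A * G`. The last one is its optimality among the matrices of rank at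
most `k` with columns in the range of `A * G`. -/
structure IsSketchSVD {s k : ℕ} (A : Matrix (Fin m) (Fin n) ℝ) (G : Matrix (Fin n) (Fin s) ℝ)
    (U US : Matrix (Fin m) (Fin k) ℝ) (V : Matrix (Fin n) (Fin k) ℝ) : Prop where
  orth_left : Uᵀ * U = 1
  orth_right : Vᵀ * V = 1
  eq_mul : US = A * V
  mul_eq : U * Uᵀ * US = US
  frobSq_le : ∀ (k' : ℕ) (V₁ : Matrix (Fin n) (Fin k') ℝ) (X : Matrix (Fin s) (Fin k') ℝ),
    k' ≤ k → V₁ᵀ * V₁ = 1 → frobSq (A - A * (V * Vᵀ)) ≤ frobSq (A - A * G * X * V₁ᵀ)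

theorem mem_columns {A : Matrix (Fin m) (Fin n) ℝ} {v : Fin m → ℝ} :
    v ∈ columns A ↔ ∃ j, (fun i => A i j) = v := by
  simp [columns, List.mem_ofFn]

theorem mul_eq_of_columns {P : Matrix (Fin m) (Fin m) ℝ} {A : Matrix (Fin m) (Fin n) ℝ}
    (h : ∀ v ∈ columns A, P *ᵥ v = v) : P * A = A := by
  ext i j
  exact congrFun (h _ (mem_columns.2 ⟨j, rfl⟩)) i

theorem sketchSVD_steps_le {k s q : ℕ} (hk : 0 < k) (hkm : k ≤ m) (hkn : k ≤ n) (hks : k ≤ s)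
    (hq : q ≤ s) :
    m * (s * (2 * n + 1)) + (s * ((0 + s) * (4 * m + 1) + 3 * m + 4) + (q * (n * (2 * m + 1)) +
      (q * (q * (2 * n + 1)) + (q ^ 3 + (n * (q * (2 * q + 1)) + (36 * (n * k ^ 2) +
      (m * (k * (2 * n + 1)) + (k * (k * (2 * m + 1)) + (k ^ 3 + (m * (k * (2 * k + 1)) +
      (n * (k * (2 * k + 1)) + (36 * (m * k ^ 2) + 0)))))))))))) ≤
    60 * (m * s * n + m * s ^ 2 + n * s ^ 2 + s ^ 3) := by
  have hm : 0 < m := hk.trans_le hkm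
  have hn : 0 < n := hk.trans_le hkn
  have hs : 0 < s := hk.trans_le hks
  have e1 : m * (s * (2 * n + 1)) ≤ 3 * (m * s * n) := by
    calc m * (s * (2 * n + 1)) ≤ m * (s * (3 * n)) := by gcongr; omega
      _ = _ := by ring
  have e2 : s * ((0 + s) * (4 * m + 1) + 3 * m + 4) ≤ 12 * (m * s ^ 2) := by
    have h1 : m ≤ s * m := Nat.le_mul_of_pos_left _ hs
    have h2 : s ≤ s * m := Nat.le_mul_of_pos_right _ hm
    calc s * ((0 + s) * (4 * m + 1) + 3 * m + 4) ≤ s * (12 * (s * m)) := by gcongr; nlinarith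
      _ = _ := by ring
  have e3 : q * (n * (2 * m + 1)) ≤ 3 * (m * s * n) := by
    calc q * (n * (2 * m + 1)) ≤ s * (n * (3 * m)) := by gcongr; omega
      _ = _ := by ring
  have e4 : q * (q * (2 * n + 1)) ≤ 3 * (n * s ^ 2) := by
    calc q * (q * (2 * n + 1)) ≤ s * (s * (3 * n)) := by gcongr; omega
      _ = _ := by ring
  have e5 : q ^ 3 ≤ s ^ 3 := by gcongr
  have e6 : n * (q * (2 * q + 1)) ≤ 3 * (n * s ^ 2) := by
    calc n * (q * (2 * q + 1)) ≤ n * (s * (2 * s + s)) := by gcongr; omega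
      _ = _ := by ring
  have e7 : n * k ^ 2 ≤ n * s ^ 2 := by gcongr
  have e8 : m * (k * (2 * n + 1)) ≤ 3 * (m * s * n) := by
    calc m * (k * (2 * n + 1)) ≤ m * (s * (3 * n)) := by gcongr; omega
      _ = _ := by ring
  have e9 : k * (k * (2 * m + 1)) ≤ 3 * (m * s ^ 2) := by
    calc k * (k * (2 * m + 1)) ≤ s * (s * (3 * m)) := by gcongr; omega
      _ = _ := by ring
  have e10 : k ^ 3 ≤ s ^ 3 := by gcongr
  have e11 : m * (k * (2 * k + 1)) ≤ 3 * (m * s ^ 2) := by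
    calc m * (k * (2 * k + 1)) ≤ m * (s * (2 * s + s)) := by gcongr; omega
      _ = _ := by ring
  have e12 : n * (k * (2 * k + 1)) ≤ 3 * (n * s ^ 2) := by
    calc n * (k * (2 * k + 1)) ≤ n * (s * (2 * s + s)) := by gcongr; omega
      _ = _ := by ring
  have e13 : m * k ^ 2 ≤ m * s ^ 2 := by gcongr
  have := Nat.zero_le (m * s * n)
  have := Nat.zero_le (m * s ^ 2)
  have := Nat.zero_le (n * s ^ 2)
  have := Nat.zero_le (s ^ 3)
  linarith

theorem Prog.runs_sketchSVDP (A : Matrix (Fin m) (Fin n) ℝ) {k s : ℕ} (hk : 0 < k) (hkm : k ≤ m)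
    (hkn : k ≤ n) (hks : k ≤ s) (G : Matrix (Fin n) (Fin s) ℝ) :
    (sketchSVDP A k G).Runs (60 * (m * s * n + m * s ^ 2 + n * s ^ 2 + s ^ 3))
      fun p => IsSketchSVD A G p.1 p.2.1 p.2.2 := by
  refine Runs.of_le ((runs_matMulP A G).bind fun Y hY => ?_)
    (sketchSVD_steps_le hk hkm hkn hks le_rfl)
  have hYl : (columns Y).length = s := by simp [columns]
  have hgs := runs_gramSchmidtP [] (columns Y) ⟨List.Pairwise.nil, by simp⟩
  rw [hYl, List.length_nil] at hgs
  refine hgs.bind ?_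
  rintro qs ⟨hqo, -, hql, hqs⟩
  simp only [zero_add] at hql hqs
  have hQ : (listMat qs)ᵀ * listMat qs = 1 := hqo.transpose_mul_self
  have hQY : listMat qs * (listMat qs)ᵀ * Y = Y := mul_eq_of_columns fun v hv =>
    hqo.mulVec_eq_self <| listSpan_mono (List.take_subset _ _) <|
      hqs (columns Y).length v (by rwa [List.take_length])
  refine ((runs_matMulP (listMat qs)ᵀ A).of_le (T' := s * (n * (2 * m + 1))) (by gcongr)).bind
    fun B hB => ?_
  refine ((runs_matMulP B Bᵀ).of_le (T' := s * (s * (2 * n + 1))) (by gcongr)).bind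
    fun BB hBB => ?_
  subst hBB
  refine ((runs_eigP (by simp [Matrix.IsSymm])).of_le (T' := s ^ 3) (by gcongr)).bind ?_
  rintro ⟨lam, W⟩ hS
  refine ((runs_matMulP Bᵀ W).of_le (T' := n * (s * (2 * s + 1))) (by gcongr)).bind
    fun BW hBW => ?_
  refine (runs_orthBasisP hk hkn (List.length_take_le _ _)).bind ?_
  rintro Z ⟨hZ, hZB⟩
  refine (runs_matMulP A Z).bind fun AZ hAZ => (runs_matMulP AZᵀ AZ).bind fun H hH => ?_
  subst hH
  refine (runs_eigP (by simp [Matrix.IsSymm])).bind ?_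
  rintro ⟨lam', W'⟩ hS'
  refine (runs_matMulP AZ W').bind fun US hUS => (runs_matMulP Z W').bind fun V hV =>
    (runs_orthBasisP hk hkm (by simp [columns])).bind ?_
  rintro U ⟨hU, hUU⟩
  have hVV : V * Vᵀ = Z * Zᵀ := by
    rw [hV, Matrix.transpose_mul, Matrix.mul_assoc, ← Matrix.mul_assoc W',
      mul_eq_one_comm.1 hS'.orth, Matrix.one_mul]
  refine Runs.pure ⟨hU, ?_, ?_, mul_eq_of_columns hUU, fun k' V₁ X hk' hV₁ => ?_⟩
  · rw [hV, Matrix.transpose_mul, Matrix.mul_assoc, ← Matrix.mul_assoc Zᵀ, hZ, Matrix.one_mul,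
      hS'.orth]
  · rw [hUS, hV, hAZ, Matrix.mul_assoc]
  · rw [hVV, ← hY]
    refine frobSq_sub_le_of_projection hQ hQY hZ hV₁ ?_ X
    rw [← hB]
    refine hS.frobSq_mul_le hZ (fun i hi => hZB _ ?_) hV₁ hk'
    rw [← hBW]
    refine List.mem_take_iff_getElem.2 ⟨i, ?_, ?_⟩
    · simp [columns, hi]
    · simp [columns]

end RandSVD

/-! ### The lower barrier for dual set sparsification -/

section Barrier

variable {N k : ℕ}

theorem IsSpectral.conj_mul_conj {M W : Matrix (Fin k) (Fin k) ℝ} {lam : Fin k → ℝ}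
    (h : IsSpectral M lam W) (a b : Fin k → ℝ) :
    (W * Matrix.diagonal a * Wᵀ) * (W * Matrix.diagonal b * Wᵀ) =
      W * Matrix.diagonal (fun i => a i * b i) * Wᵀ := by
  rw [← Matrix.diagonal_mul_diagonal]
  simp only [Matrix.mul_assoc]
  rw [← Matrix.mul_assoc Wᵀ W, h.orth, Matrix.one_mul]

theorem IsSpectral.trace_conj {M W : Matrix (Fin k) (Fin k) ℝ} {lam : Fin k → ℝ}
    (h : IsSpectral M lam W) (a : Fin k → ℝ) :
    (W * Matrix.diagonal a * Wᵀ).trace = ∑ i, a i := by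
  rw [Matrix.trace_mul_comm, ← Matrix.mul_assoc, h.orth, Matrix.one_mul, Matrix.trace_diagonal]

theorem IsSpectral.dotProduct_conj {M W : Matrix (Fin k) (Fin k) ℝ} {lam : Fin k → ℝ}
    (_ : IsSpectral M lam W) (a : Fin k → ℝ) (x : Fin k → ℝ) :
    x ⬝ᵥ ((W * Matrix.diagonal a * Wᵀ) *ᵥ x) = ∑ i, a i * (Wᵀ *ᵥ x) i ^ 2 := by
  rw [← Matrix.mulVec_mulVec, ← Matrix.mulVec_mulVec, Matrix.dotProduct_mulVec,
    ← Matrix.mulVec_transpose]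
  refine Finset.sum_congr rfl fun i _ => ?_
  rw [Matrix.mulVec_diagonal]
  ring

theorem IsSpectral.sum_sq {M W : Matrix (Fin k) (Fin k) ℝ} {lam : Fin k → ℝ}
    (h : IsSpectral M lam W) (x : Fin k → ℝ) : ∑ i, (Wᵀ *ᵥ x) i ^ 2 = x ⬝ᵥ x := by
  have h1 := h.dotProduct_conj (fun _ => 1) x
  rw [show Matrix.diagonal (fun _ : Fin k => (1 : ℝ)) = 1 from Matrix.diagonal_one, Matrix.mul_one,
    mul_eq_one_comm.1 h.orth, Matrix.one_mulVec] at h1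
  simpa using h1.symm

theorem IsSpectral.sub_smul_one {M W : Matrix (Fin k) (Fin k) ℝ} {lam : Fin k → ℝ}
    (h : IsSpectral M lam W) (L : ℝ) :
    M - L • (1 : Matrix (Fin k) (Fin k) ℝ) = W * Matrix.diagonal (fun i => lam i - L) * Wᵀ := by
  have h1 : Matrix.diagonal (fun i => lam i - L) =
      Matrix.diagonal lam - L • (1 : Matrix (Fin k) (Fin k) ℝ) := by
    rw [← Matrix.diagonal_one, ← Matrix.diagonal_smul, Matrix.diagonal_sub]
    simp
  rw [h1, Matrix.mul_sub, Matrix.sub_mul, ← h.eq, Matrix.mul_smul, Matrix.mul_one,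
    Matrix.smul_mul, mul_eq_one_comm.1 h.orth]

theorem IsSpectral.resolvent_mul {M W : Matrix (Fin k) (Fin k) ℝ} {lam : Fin k → ℝ}
    (h : IsSpectral M lam W) {L : ℝ} (hL : ∀ i, lam i ≠ L) :
    (M - L • (1 : Matrix (Fin k) (Fin k) ℝ)) *
      (W * Matrix.diagonal (fun i => 1 / (lam i - L)) * Wᵀ) = 1 := by
  rw [h.sub_smul_one, h.conj_mul_conj]
  have : (fun i => (lam i - L) * (1 / (lam i - L))) = fun _ => 1 := by
    funext i
    exact mul_one_div_cancel (sub_ne_zero.2 (hL i))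
  rw [this, Matrix.diagonal_one, Matrix.mul_one, mul_eq_one_comm.1 h.orth]

/-- All eigenvalues of the symmetric matrix `M` exceed `L`. -/
def IsAbove (M : Matrix (Fin k) (Fin k) ℝ) (L : ℝ) : Prop :=
  ∀ x : Fin k → ℝ, x ≠ 0 → L * (x ⬝ᵥ x) < x ⬝ᵥ (M *ᵥ x)

theorem IsSpectral.isAbove_iff {M W : Matrix (Fin k) (Fin k) ℝ} {lam : Fin k → ℝ}
    (h : IsSpectral M lam W) {L : ℝ} : IsAbove M L ↔ ∀ i, L < lam i := by
  constructor
  · intro hM i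
    have h1 : Wᵀ *ᵥ (W *ᵥ Pi.single i 1) = Pi.single i 1 := by
      rw [Matrix.mulVec_mulVec, h.orth, Matrix.one_mulVec]
    have h2 := hM (W *ᵥ Pi.single i 1) (fun h0 => by
      rw [h0, Matrix.mulVec_zero] at h1
      simpa using congrFun h1 i)
    rw [← h.sum_sq, h1] at h2
    conv_rhs at h2 => rw [h.eq]
    rw [h.dotProduct_conj, h1] at h2
    simpa [Pi.single_apply] using h2
  · intro hl x hx
    conv_rhs => rw [h.eq]
    rw [h.dotProduct_conj, ← h.sum_sq, Finset.mul_sum]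
    have h0 : Wᵀ *ᵥ x ≠ 0 := by
      intro h0
      have h1 := h.sum_sq x
      rw [h0] at h1
      exact hx (dotProduct_self_eq_zero.1 (by simpa using h1.symm))
    obtain ⟨i, hi⟩ := Function.ne_iff.1 h0
    refine Finset.sum_lt_sum (fun j _ => mul_le_mul_of_nonneg_right (hl j).le (sq_nonneg _))
      ⟨i, Finset.mem_univ i, mul_lt_mul_of_pos_right (hl i) (sq_pos_of_ne_zero hi)⟩

/-- The potential decrease that makes room for moving the barrier by one. -/
theorem barrier_sum_le {d : Fin k → ℝ} (hd : ∀ i, 1 < d i) (h1 : ∑ i, 1 / d i ≤ 1) :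
    (∑ i, 1 / (d i - 1) - ∑ i, 1 / d i) * (1 + (∑ i, 1 / (d i - 1) - ∑ i, 1 / d i)) ≤
      ∑ i, 1 / (d i - 1) * (1 / (d i - 1)) := by
  set a : Fin k → ℝ := fun i => 1 / (d i - 1) with ha
  set b : Fin k → ℝ := fun i => 1 / d i with hb
  have hb0 : ∀ i, 0 ≤ b i := fun i => by have := hd i; simp only [hb]; positivity
  have hab : ∀ i, a i - b i = a i * b i := by
    intro i
    have h2 : d i - 1 ≠ 0 := by linarith [hd i]
    have h3 : d i ≠ 0 := by linarith [hd i]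
    simp only [ha, hb]
    field_simp
    ring
  have hgap : ∑ i, a i - ∑ i, b i = ∑ i, a i * b i := by
    rw [← Finset.sum_sub_distrib]; exact Finset.sum_congr rfl fun i _ => hab i
  have hsq : ∑ i, a i * a i = ∑ i, a i * b i + ∑ i, a i ^ 2 * b i := by
    rw [← Finset.sum_add_distrib]
    refine Finset.sum_congr rfl fun i _ => ?_
    linear_combination a i * hab i
  have hcs : (∑ i, a i * b i) ^ 2 ≤ (∑ i, a i ^ 2 * b i) * ∑ i, b i := by
    refine Finset.sum_sq_le_sum_mul_sum_of_sq_le_mul _ (fun i _ => mul_nonneg (sq_nonneg _) (hb0 i))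
      (fun i _ => hb0 i) fun i _ => le_of_eq (by ring)
  have h4 : 0 ≤ ∑ i, a i ^ 2 * b i :=
    Finset.sum_nonneg fun i _ => mul_nonneg (sq_nonneg _) (hb0 i)
  show (∑ i, a i - ∑ i, b i) * (1 + (∑ i, a i - ∑ i, b i)) ≤ ∑ i, a i * a i
  rw [hgap, hsq]
  nlinarith

theorem dotProduct_add_vecMulVec (M : Matrix (Fin k) (Fin k) ℝ) (t : ℝ) (v x : Fin k → ℝ) :
    x ⬝ᵥ ((M + t • Matrix.vecMulVec v v) *ᵥ x) = x ⬝ᵥ (M *ᵥ x) + t * (v ⬝ᵥ x) ^ 2 := by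
  rw [Matrix.add_mulVec, dotProduct_add, Matrix.smul_mulVec, Matrix.vecMulVec_mulVec,
    dotProduct_smul, dotProduct_smul, smul_eq_mul, MulOpposite.smul_eq_mul_unop,
    MulOpposite.unop_op, dotProduct_comm x v]
  ring

/-- By the Sherman-Morrison formula, a rank one update of the right size keeps the potential
unchanged when the barrier moves. -/
theorem IsSpectral.potential_update {M W M' W' : Matrix (Fin k) (Fin k) ℝ} {lam lam' : Fin k → ℝ}
    (h : IsSpectral M lam W) (h' : IsSpectral M' lam' W') {L t g : ℝ} {v : Fin k → ℝ}
    (hM' : M' = M + t • Matrix.vecMulVec v v) (hl : ∀ i, lam i ≠ L) (hl' : ∀ i, lam' i ≠ L)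
    {R₁ R₂ : Matrix (Fin k) (Fin k) ℝ}
    (hR₁ : R₁ = W * Matrix.diagonal (fun i => 1 / (lam i - L)) * Wᵀ) (hR₂ : R₂ = R₁ * R₁)
    (ht : t ≠ 0) (hg : g ≠ 0) (h0 : v ⬝ᵥ (R₂ *ᵥ v) / g ≠ 0)
    (htg : 1 / t = v ⬝ᵥ (R₂ *ᵥ v) / g - v ⬝ᵥ (R₁ *ᵥ v)) :
    ∑ i, 1 / (lam' i - L) = ∑ i, 1 / (lam i - L) - g := by
  set a₁ := v ⬝ᵥ (R₁ *ᵥ v)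
  set a₂ := v ⬝ᵥ (R₂ *ᵥ v) with ha₂
  have hsym : R₁ᵀ = R₁ := by rw [hR₁]; simp [Matrix.mul_assoc]
  have hNR : (M - L • (1 : Matrix (Fin k) (Fin k) ℝ)) * R₁ = 1 := hR₁ ▸ h.resolvent_mul hl
  have hvR : Matrix.vecMul v R₁ = R₁ *ᵥ v := by rw [← Matrix.mulVec_transpose, hsym]
  set c := g / a₂ with hc
  have ha₂0 : a₂ ≠ 0 := fun h0' => h0 (by rw [h0', zero_div])
  have hctc : t - c - t * (c * a₁) = 0 := by
    have : 1 / t + a₁ = 1 / c := by rw [htg, hc, one_div_div]; ring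
    have hc0 : c ≠ 0 := div_ne_zero hg ha₂0
    field_simp at this
    linear_combination -this
  have hinv : (M' - L • (1 : Matrix (Fin k) (Fin k) ℝ)) *
      (R₁ - c • Matrix.vecMulVec (R₁ *ᵥ v) (R₁ *ᵥ v)) = 1 := by
    have e1 : (M - L • (1 : Matrix (Fin k) (Fin k) ℝ)) *ᵥ (R₁ *ᵥ v) = v := by
      rw [Matrix.mulVec_mulVec, hNR, Matrix.one_mulVec]
    have e2 : M' - L • (1 : Matrix (Fin k) (Fin k) ℝ) =
        (M - L • (1 : Matrix (Fin k) (Fin k) ℝ)) + t • Matrix.vecMulVec v v := by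
      rw [hM']; abel
    rw [e2, Matrix.mul_sub, Matrix.add_mul, Matrix.mul_smul, Matrix.add_mul, hNR,
      Matrix.smul_mul, Matrix.smul_mul, Matrix.vecMulVec_mul, hvR, Matrix.mul_vecMulVec, e1,
      Matrix.vecMulVec_mul_vecMulVec]
    ext i j
    simp only [Matrix.sub_apply, Matrix.add_apply, Matrix.smul_apply, Matrix.vecMulVec_apply,
      smul_eq_mul, Pi.smul_apply]
    linear_combination (v i * (R₁ *ᵥ v) j) * hctc
  have huniq : W' * Matrix.diagonal (fun i => 1 / (lam' i - L)) * W'ᵀ =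
      R₁ - c • Matrix.vecMulVec (R₁ *ᵥ v) (R₁ *ᵥ v) := by
    have e1 := h'.resolvent_mul hl'
    calc _ = _ * ((M' - L • (1 : Matrix (Fin k) (Fin k) ℝ)) *
          (R₁ - c • Matrix.vecMulVec (R₁ *ᵥ v) (R₁ *ᵥ v))) := by rw [hinv, Matrix.mul_one]
      _ = _ := by rw [← Matrix.mul_assoc, mul_eq_one_comm.1 e1, Matrix.one_mul]
  rw [← h'.trace_conj, huniq, Matrix.trace_sub, Matrix.trace_smul, Matrix.trace_vecMulVec, hR₁,
    h.trace_conj, ← hR₁]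
  have e3 : (R₁ *ᵥ v) ⬝ᵥ (R₁ *ᵥ v) = a₂ := by
    rw [ha₂, hR₂, ← Matrix.mulVec_mulVec, Matrix.dotProduct_mulVec v, hvR]
  rw [e3, smul_eq_mul, hc, div_mul_cancel₀ _ ha₂0]

end Barrier

/-! ### Dual set sparsification -/

section DualSet

variable {N k : ℕ}

/-- The invariant of the dual set sparsification, for the barrier `L` after `τ` iterations: `xn` are
the squared norms of the first family of vectors, the rows of `V` are the second family, `del` is
the cost that is allowed for each iteration, and `φ` bounds the potential. -/
structure DualSetInv (xn : Fin N → ℝ) (V : Matrix (Fin N) (Fin k) ℝ) (del φ L : ℝ) (τ : ℕ)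
    (st : (Fin N → ℝ) × Matrix (Fin k) (Fin k) ℝ) : Prop where
  nonneg : ∀ j, 0 ≤ st.1 j
  card_le : (Finset.univ.filter fun j => 0 < st.1 j).card ≤ τ
  cost_le : ∑ j, st.1 j * xn j ≤ τ * del
  symm : st.2.IsSymm
  quad : ∀ y, y ⬝ᵥ (st.2 *ᵥ y) = ∑ j, st.1 j * (V j ⬝ᵥ y) ^ 2
  above : IsAbove st.2 L
  potential : ∀ lam W, IsSpectral st.2 lam W → ∑ i, 1 / (lam i - L) ≤ φ

theorem sum_update_add_mul (s f : Fin N → ℝ) (j : Fin N) (t : ℝ) :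
    ∑ i, Function.update s j (s j + t) i * f i = ∑ i, s i * f i + t * f j := by
  have h : ∀ i, Function.update s j (s j + t) i * f i = s i * f i + if i = j then t * f j else 0 := by
    intro i
    by_cases hij : i = j
    · subst hij; simp; ring
    · simp [hij]
  simp only [h, Finset.sum_add_distrib, Finset.sum_ite_eq', Finset.mem_univ, if_true]

/-- One iteration preserves the invariant, for an index whose gain `u` is positive and at least
its normalised cost. -/
theorem DualSetInv.update {xn : Fin N → ℝ} {V : Matrix (Fin N) (Fin k) ℝ} {del φ L : ℝ} {τ : ℕ}
    {s : Fin N → ℝ} {M W : Matrix (Fin k) (Fin k) ℝ} {lam : Fin k → ℝ}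
    (h : DualSetInv xn V del φ L τ (s, M)) (hφ : φ < 1) (hS : IsSpectral M lam W)
    {R₁ R₂ : Matrix (Fin k) (Fin k) ℝ} (hk : 0 < k)
    (hR₁ : R₁ = W * Matrix.diagonal (fun i => 1 / (lam i - (L + 1))) * Wᵀ) (hR₂ : R₂ = R₁ * R₁)
    {u : ℝ} {j : Fin N} (hu : u = V j ⬝ᵥ (R₂ *ᵥ V j) /
      (∑ i, 1 / (lam i - (L + 1)) - ∑ i, 1 / (lam i - L)) - V j ⬝ᵥ (R₁ *ᵥ V j))
    (hu0 : 0 < u) (hux : xn j ≤ del * u) :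
    DualSetInv xn V del φ (L + 1) (τ + 1)
      (Function.update s j (s j + 1 / u), M + (1 / u) • Matrix.vecMulVec (V j) (V j)) := by
  have hl : ∀ i, L < lam i := hS.isAbove_iff.1 h.above
  have hpot := h.potential lam W hS
  have hl' : ∀ i, L + 1 < lam i := by
    intro i
    have h1 : 1 / (lam i - L) ≤ ∑ i, 1 / (lam i - L) :=
      Finset.single_le_sum (f := fun i => 1 / (lam i - L))
        (fun i _ => by have := hl i; exact (one_div_pos.2 (by linarith)).le) (Finset.mem_univ i)
    have h2 : 1 / (lam i - L) < 1 := by linarith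
    rw [div_lt_one (by linarith [hl i])] at h2
    linarith
  have hu0' : 0 < 1 / u := one_div_pos.2 hu0
  have hab : IsAbove (M + (1 / u) • Matrix.vecMulVec (V j) (V j)) (L + 1) := by
    intro x hx
    have h1 := hS.isAbove_iff.2 hl' x hx
    rw [dotProduct_add_vecMulVec]
    have : 0 ≤ 1 / u * (V j ⬝ᵥ x) ^ 2 := by positivity
    linarith
  refine ⟨fun i => ?_, ?_, ?_, ?_, fun y => ?_, hab, fun lam' W' hS' => ?_⟩
  · by_cases hij : i = j
    · subst hij
      simpa using add_nonneg (h.nonneg i) (by simpa using hu0'.le)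
    · simpa [hij] using h.nonneg i
  · have hsub : (Finset.univ.filter fun i => 0 < Function.update s j (s j + 1 / u) i) ⊆
        insert j (Finset.univ.filter fun i => 0 < s i) := by
      intro i hi
      by_cases hij : i = j
      · exact hij ▸ Finset.mem_insert_self _ _
      · refine Finset.mem_insert_of_mem ?_
        simpa [hij] using hi
    exact (Finset.card_le_card hsub).trans ((Finset.card_insert_le _ _).trans
      (Nat.succ_le_succ h.card_le))
  · simp only
    rw [sum_update_add_mul]
    have h1 := h.cost_le
    have h2 : 1 / u * xn j ≤ del := by
      rw [one_div, inv_mul_le_iff₀ hu0]; linarith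
    push_cast
    simp only at h1
    linarith
  · refine Matrix.IsSymm.add h.symm (Matrix.IsSymm.smul ?_ _)
    ext a b
    simp [Matrix.vecMulVec_apply, mul_comm]
  · simp only
    rw [sum_update_add_mul, dotProduct_add_vecMulVec, ← h.quad y]
  · have hgap : 0 < ∑ i, 1 / (lam i - (L + 1)) - ∑ i, 1 / (lam i - L) := by
      rw [← Finset.sum_sub_distrib]
      refine Finset.sum_pos (fun i _ => ?_) ⟨⟨0, hk⟩, Finset.mem_univ _⟩
      have h1 := hl i
      have h2 := hl' i
      exact sub_pos.2 (one_div_lt_one_div_of_lt (by linarith) (by linarith))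
    have ha₁ : 0 ≤ V j ⬝ᵥ (R₁ *ᵥ V j) := by
      rw [hR₁, hS.dotProduct_conj]
      refine Finset.sum_nonneg fun i _ => mul_nonneg ?_ (sq_nonneg _)
      exact (one_div_pos.2 (by linarith [hl' i])).le
    have ha₂ : 0 < V j ⬝ᵥ (R₂ *ᵥ V j) / (∑ i, 1 / (lam i - (L + 1)) - ∑ i, 1 / (lam i - L)) := by
      linarith
    have hl'' := hS'.isAbove_iff.1 hab
    rw [hS.potential_update hS' rfl (fun i => (hl' i).ne') (fun i => (hl'' i).ne') hR₁ hR₂ hu0'.ne'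
      hgap.ne' ha₂.ne' (by rw [one_div_one_div]; exact hu)]
    simpa using hpot

/-- As long as the invariant holds, some index can be chosen. -/
theorem DualSetInv.exists_good {xn : Fin N → ℝ} {V : Matrix (Fin N) (Fin k) ℝ} {del φ L : ℝ}
    {τ : ℕ} {s : Fin N → ℝ} {M W : Matrix (Fin k) (Fin k) ℝ} {lam : Fin k → ℝ}
    (h : DualSetInv xn V del φ L τ (s, M)) (hφ : φ < 1) (hS : IsSpectral M lam W)
    {R₁ R₂ : Matrix (Fin k) (Fin k) ℝ} (hk : 0 < k) (hV : Vᵀ * V = 1)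
    (hR₁ : R₁ = W * Matrix.diagonal (fun i => 1 / (lam i - (L + 1))) * Wᵀ) (hR₂ : R₂ = R₁ * R₁)
    (hxn : ∀ j, 0 ≤ xn j) (hdel : ∑ j, xn j = del * (1 - φ))
    {u : Fin N → ℝ} (hu : ∀ j, u j = V j ⬝ᵥ (R₂ *ᵥ V j) /
      (∑ i, 1 / (lam i - (L + 1)) - ∑ i, 1 / (lam i - L)) - V j ⬝ᵥ (R₁ *ᵥ V j)) :
    ∃ j, 0 < u j ∧ xn j ≤ del * u j := by
  have hl : ∀ i, L < lam i := hS.isAbove_iff.1 h.above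
  have hpot := h.potential lam W hS
  set d : Fin k → ℝ := fun i => lam i - L with hd
  have hd1 : ∀ i, 1 < d i := by
    intro i
    have h1 : 1 / (lam i - L) ≤ ∑ i, 1 / (lam i - L) :=
      Finset.single_le_sum (f := fun i => 1 / (lam i - L))
        (fun i _ => by have := hl i; exact (one_div_pos.2 (by linarith)).le) (Finset.mem_univ i)
    have h2 : 1 / (lam i - L) < 1 := by linarith
    rwa [div_lt_one (by linarith [hl i])] at h2
  have hd' : ∀ i, lam i - (L + 1) = d i - 1 := fun i => by simp only [hd]; ring
  simp only [hd'] at hu hR₁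
  have hkey := barrier_sum_le hd1 (hpot.trans hφ.le)
  have hgap : 0 < ∑ i, 1 / (d i - 1) - ∑ i, 1 / d i := by
    rw [← Finset.sum_sub_distrib]
    refine Finset.sum_pos (fun i _ => ?_) ⟨⟨0, hk⟩, Finset.mem_univ _⟩
    have h1 := hd1 i
    exact sub_pos.2 (one_div_lt_one_div_of_lt (by linarith) (by linarith))
  have htr : ∀ R : Matrix (Fin k) (Fin k) ℝ, ∑ j, V j ⬝ᵥ (R *ᵥ V j) = R.trace := by
    intro R
    have h1 : ∑ j, V j ⬝ᵥ (R *ᵥ V j) = (V * R * Vᵀ).trace := by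
      refine Finset.sum_congr rfl fun j _ => ?_
      rw [Matrix.dotProduct_mulVec]
      rfl
    rw [h1, Matrix.trace_mul_comm, ← Matrix.mul_assoc, hV, Matrix.one_mul]
  have hsum : 1 - φ ≤ ∑ j, u j := by
    have h1 : ∑ j, u j = (∑ i, 1 / (d i - 1) * (1 / (d i - 1))) /
        (∑ i, 1 / (d i - 1) - ∑ i, 1 / d i) - ∑ i, 1 / (d i - 1) := by
      simp only [hu]
      rw [Finset.sum_sub_distrib, ← Finset.sum_div, htr, htr, hR₂, hR₁, hS.conj_mul_conj,
        hS.trace_conj, hS.trace_conj]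
    have h2 : 1 + (∑ i, 1 / (d i - 1) - ∑ i, 1 / d i) ≤
        (∑ i, 1 / (d i - 1) * (1 / (d i - 1))) / (∑ i, 1 / (d i - 1) - ∑ i, 1 / d i) := by
      rw [le_div_iff₀ hgap]; linarith
    have h3 : ∑ i, 1 / d i ≤ φ := hpot
    linarith
  have hdel0 : 0 ≤ del := by
    have : 0 ≤ del * (1 - φ) := hdel ▸ Finset.sum_nonneg fun j _ => hxn j
    nlinarith
  by_contra! hcon
  -- no index qualifies: then costs and gains balance exactly, and no gain is positive
  have hle : ∀ j, del * u j ≤ xn j := by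
    intro j
    rcases le_or_gt (u j) 0 with hj | hj
    · exact (mul_nonpos_of_nonneg_of_nonpos hdel0 hj).trans (hxn j)
    · exact (hcon j hj).le
  have hsum_le : ∑ j, xn j ≤ ∑ j, del * u j := by
    rw [← Finset.mul_sum, hdel]
    exact mul_le_mul_of_nonneg_left hsum hdel0
  have heq : ∀ j, del * u j = xn j := fun j =>
    (Finset.sum_eq_sum_iff_of_le fun j _ => hle j).1
      (le_antisymm (Finset.sum_le_sum fun j _ => hle j) hsum_le) j (Finset.mem_univ j)
  have hnonpos : ∑ j, u j ≤ 0 := Finset.sum_nonpos fun j _ => by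
    by_contra! hj
    exact (hcon j hj).ne (heq j)
  linarith

end DualSet

namespace Prog

variable {N k l : ℕ}

theorem dualSetStep_steps_le {N k : ℕ} (hk : 0 < k) (hkN : k ≤ N) :
    k ^ 3 + (1 + (1 + (1 + (1 + (1 + (k * (1 + 1) + (k * (1 + 1) + (k * 1 + ((k + 1) + ((k + 1) +
      (1 + ((k * k + k * (k * (2 * k + 1))) + ((k * k + k * (k * (2 * k + 1))) +
      (N * (k * (2 * k + 1) + (k * (2 * k + 1) + ((2 * k + 1) + ((2 * k + 1) + (1 + 1))))) +
      (N * (1 + (1 + (1 + 0))) + (1 + (1 + (k * (k * (1 + (1 + 1))) + 0)))))))))))))))))) ≤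
    46 * (N * k ^ 2) := by
  have h1 : k ^ 3 ≤ N * k ^ 2 := by rw [pow_succ']; exact Nat.mul_le_mul_right _ hkN
  have h2 : k ^ 2 ≤ N * k ^ 2 := Nat.le_mul_of_pos_left _ (hk.trans_le hkN)
  have h3 : k ≤ k ^ 2 := by nlinarith
  have h4 : N * k ≤ N * k ^ 2 := Nat.mul_le_mul_left _ h3
  have h5 : N ≤ N * k := Nat.le_mul_of_pos_right _ hk
  nlinarith

theorem runs_dualSetStepP {xn : Fin N → ℝ} {V : Matrix (Fin N) (Fin k) ℝ} {del φ rk L : ℝ} {τ : ℕ}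
    {st : (Fin N → ℝ) × Matrix (Fin k) (Fin k) ℝ} (h : DualSetInv xn V del φ L τ st)
    (hL : L = τ - rk) (hφ : φ < 1) (hk : 0 < k) (hkN : k ≤ N) (hV : Vᵀ * V = 1)
    (hxn : ∀ j, 0 ≤ xn j) (hdel : ∑ j, xn j = del * (1 - φ)) :
    (dualSetStepP xn V del rk τ st).Runs (46 * (N * k ^ 2))
      (DualSetInv xn V del φ (L + 1) (τ + 1)) := by
  obtain ⟨s, M⟩ := st
  refine Runs.of_le ?_ (dualSetStep_steps_le hk hkN)
  refine (runs_eigP h.symm).bind ?_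
  rintro ⟨lam, W⟩ hS
  refine (runs_natP 0).bind fun zero hz => (runs_natP 1).bind fun one ho =>
    (runs_natP τ).bind fun t₀ ht₀ => (runs_subP t₀ rk).bind fun L₀ hL₀ =>
    (runs_addP L₀ one).bind fun L₁ hL₁ => ?_
  rw [ht₀, ← hL] at hL₀
  rw [hL₀, ho, Nat.cast_one] at hL₁
  subst hL₀ hL₁
  rw [Nat.cast_zero] at hz
  rw [Nat.cast_one] at ho
  subst hz ho
  refine (runs_tabulateP_eq (g := fun i => 1 / (lam i - L₀)) fun i =>
    (runs_subP (lam i) L₀).bind fun a ha => ha ▸ runs_divP _ _).bind fun e he => ?_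
  refine (runs_tabulateP_eq (g := fun i => 1 / (lam i - (L₀ + 1))) fun i =>
    (runs_subP (lam i) (L₀ + 1)).bind fun a ha => ha ▸ runs_divP _ _).bind fun e' he' => ?_
  refine (runs_tabulateP_eq fun i => runs_mulP (e' i) (e' i)).bind fun esq hesq => ?_
  refine (runs_sumP e).bind fun phi hphi => (runs_sumP e').bind fun phi' hphi' =>
    (runs_subP phi' phi).bind fun gap hgap => (runs_conjDiagP W e').bind fun M₁ hM₁ =>
    (runs_conjDiagP W esq).bind fun M₂ hM₂ => ?_
  have hM₂' : M₂ = M₁ * M₁ := by rw [hM₁, hM₂, hS.conj_mul_conj, hesq]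
  refine (runs_tabulateP_eq (g := fun j => V j ⬝ᵥ (M₂ *ᵥ V j) / gap - V j ⬝ᵥ (M₁ *ᵥ V j)) fun j =>
    (runs_tabulateP_eq fun i => runs_dotP (M₁ i) (V j)).bind fun y₁ hy₁ =>
    (runs_tabulateP_eq fun i => runs_dotP (M₂ i) (V j)).bind fun y₂ hy₂ =>
    (runs_dotP (V j) y₁).bind fun a₁ ha₁ => (runs_dotP (V j) y₂).bind fun a₂ ha₂ =>
    (runs_divP a₂ gap).bind fun b hb => ?_).bind fun u hu => ?_
  · have := runs_subP b a₁
    rw [hb, ha₂, ha₁, hy₁, hy₂] at this ⊢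
    exact this
  refine (runs_tabulateP (Q := fun j b => b = true ↔ 0 < u j ∧ xn j ≤ del * u j) fun j =>
    (runs_mulP del (u j)).bind fun a ha => (runs_ltP 0 (u j)).bind fun p hp =>
    (runs_ltP a (xn j)).bind fun q hq => Runs.pure ?_).bind fun good hgood => ?_
  · rw [Bool.and_eq_true, hp, Bool.not_eq_true', ← Bool.not_eq_true, hq, not_lt, ha]
  have hgap' : gap = ∑ i, 1 / (lam i - (L₀ + 1)) - ∑ i, 1 / (lam i - L₀) := by
    rw [hgap, hphi, hphi', he, he']
  rw [hgap'] at hu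
  rw [he'] at hM₁
  have hex := h.exists_good hφ hS hk hV hM₁ hM₂' hxn hdel fun j => congrFun hu j
  cases hfind : (List.finRange N).find? good with
  | none =>
    exfalso
    obtain ⟨j, hj⟩ := hex
    exact List.find?_eq_none.1 hfind j (List.mem_finRange j) ((hgood j).2 hj)
  | some j =>
    have hj := (hgood j).1 (List.find?_some hfind)
    refine (runs_divP 1 (u j)).bind fun t ht => (runs_addP (s j) t).bind fun sj hsj =>
      (runs_tabulateMatP (B := M + t • Matrix.vecMulVec (V j) (V j)) fun a b =>
        (runs_mulP (V j a) (V j b)).bind fun x hx => (runs_mulP t x).bind fun y hy => ?_).bind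
      fun M' hM' => Runs.pure ?_
    · have := runs_addP (M a b) y
      rwa [hy, hx] at this ⊢
    · rw [hM', hsj, ht]
      exact h.update hφ hS hk hM₁ hM₂' (congrFun hu j) hj.1 hj.2

theorem runs_dualSetLoopP {xn : Fin N → ℝ} {V : Matrix (Fin N) (Fin k) ℝ} {del φ rk : ℝ}
    (hφ : φ < 1) (hk : 0 < k) (hkN : k ≤ N) (hV : Vᵀ * V = 1) (hxn : ∀ j, 0 ≤ xn j)
    (hdel : ∑ j, xn j = del * (1 - φ)) :
    ∀ (r τ : ℕ) (st : (Fin N → ℝ) × Matrix (Fin k) (Fin k) ℝ),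
      DualSetInv xn V del φ (τ - rk) τ st → (dualSetLoopP xn V del rk r τ st).Runs
        (r * (46 * (N * k ^ 2))) (DualSetInv xn V del φ ((τ + r : ℕ) - rk) (τ + r))
  | 0, τ, st, h => (Runs.pure h).of_le (Nat.zero_le _)
  | r + 1, τ, st, h => by
    have hs := runs_dualSetStepP h rfl hφ hk hkN hV hxn hdel
    rw [Nat.add_mul, one_mul, Nat.add_comm (r * _)]
    refine hs.bind fun st' h' => ?_
    have e : (τ : ℝ) - rk + 1 = ((τ + 1 : ℕ) : ℝ) - rk := by push_cast; ring
    rw [e] at h'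
    have := runs_dualSetLoopP hφ hk hkN hV hxn hdel r (τ + 1) st' h'
    rwa [Nat.add_right_comm] at this

end Prog

/-- Weights with the guarantees of dual set sparsification: few of them are positive, the weighted
rows of `V` have all squared singular values at least `(1 - √(k / r)) ^ 2`, and the weighted columns
of `X` have at most the squared Frobenius norm of `X`. -/
structure IsDualSet {l N k : ℕ} (X : Matrix (Fin l) (Fin N) ℝ) (V : Matrix (Fin N) (Fin k) ℝ)
    (r : ℕ) (w : Fin N → ℝ) : Prop where
  nonneg : ∀ j, 0 ≤ w j
  card_le : (Finset.univ.filter fun j => 0 < w j).card ≤ r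
  le_quad : ∀ y, (1 - √((k : ℝ) / r)) ^ 2 * (y ⬝ᵥ y) ≤ ∑ j, w j * (V j ⬝ᵥ y) ^ 2
  cost_le : ∑ j, w j * ∑ i, X i j ^ 2 ≤ frobSq X

theorem sqrt_div_lt_one {k r : ℕ} (hkr : k < r) : √((k : ℝ) / r) < 1 := by
  have hr : (0 : ℝ) < r := by exact_mod_cast (Nat.zero_le k).trans_lt hkr
  rw [← Real.sqrt_one]
  refine Real.sqrt_lt_sqrt (by positivity) ?_
  rw [div_lt_one hr]
  exact_mod_cast hkr

theorem Prog.runs_dualSetP {l N k r : ℕ} (X : Matrix (Fin l) (Fin N) ℝ)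
    {V : Matrix (Fin N) (Fin k) ℝ} (hk : 0 < k) (hkN : k ≤ N) (hV : Vᵀ * V = 1) (hkr : k < r) :
    (dualSetP X V r).Runs (60 * (r * (N * k ^ 2)) + 3 * (N * l)) (IsDualSet X V r) := by
  have hT : 1 + (1 + (1 + (1 + (N * (2 * l + 1) + ((N + 1) + (1 + (1 + (1 + (1 + (1 + (1 +
      (r * (46 * (N * k ^ 2)) + (1 + N * 1))))))))))))) ≤ 60 * (r * (N * k ^ 2)) + 3 * (N * l) := by
    have h1 : N ≤ N * k ^ 2 := Nat.le_mul_of_pos_right _ (by positivity)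
    have h2 : 2 * (N * k ^ 2) ≤ r * (N * k ^ 2) := Nat.mul_le_mul_right _ (by omega)
    have h3 : 1 ≤ N := hk.trans_le hkN
    nlinarith
  have hr : (0 : ℝ) < r := by exact_mod_cast hk.trans hkr
  have hk' : (0 : ℝ) < k := by exact_mod_cast hk
  set φ := √((k : ℝ) / r) with hφ
  have hφ1 : φ < 1 := sqrt_div_lt_one hkr
  set xn : Fin N → ℝ := fun j => ∑ i, X i j ^ 2 with hxn
  have hxn0 : ∀ j, 0 ≤ xn j := fun j => Finset.sum_nonneg fun _ _ => sq_nonneg _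
  have htot : ∑ j, xn j = frobSq X := (frobSq_eq_sum_cols X).symm
  set rk := √((r : ℝ) * k) with hrk
  have hrk0 : 0 < rk := Real.sqrt_pos.2 (by positivity)
  have hrkφ : rk = r * φ := by
    rw [hrk, hφ, ← Real.sqrt_sq hr.le, ← Real.sqrt_mul (sq_nonneg _), Real.sqrt_sq hr.le]
    congr 1
    field_simp
  refine Runs.of_le ?_ hT
  refine (runs_natP 0).bind fun zero hz => (runs_natP 1).bind fun one ho =>
    (runs_natP k).bind fun kR hkR => (runs_natP r).bind fun rR hrR =>
    (runs_colSqNormsP X).bind fun xn' hxn' => (runs_sumP xn').bind fun tot ht =>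
    (runs_divP kR rR).bind fun ratio hra => (runs_sqrtP ratio).bind fun root hroot =>
    (runs_subP one root).bind fun c hc => (runs_divP tot c).bind fun del hdel =>
    (runs_mulP rR kR).bind fun prod hprod => (runs_sqrtP prod).bind fun rk' hrk' => ?_
  rw [Nat.cast_zero] at hz
  rw [Nat.cast_one] at ho
  subst hz ho hkR hrR hra hprod hroot hrk' hxn'
  have hc0 : 0 < c := by rw [hc]; linarith
  have hdel' : ∑ j, xn j = del * (1 - φ) := by
    rw [← hc, hdel, div_mul_cancel₀ _ hc0.ne', ht]
  have hinit : DualSetInv xn V del φ ((0 : ℕ) - rk) 0 (fun _ => 0, fun _ _ => 0) := by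
    have hz : (fun _ _ => 0) = (0 : Matrix (Fin k) (Fin k) ℝ) := rfl
    rw [hz]
    refine ⟨fun _ => le_rfl, by simp, by simp, Matrix.transpose_zero, fun y => by simp, ?_, ?_⟩
    · intro x hx
      have h1 : 0 < x ⬝ᵥ x := lt_of_le_of_ne
        (Finset.sum_nonneg fun _ _ => mul_self_nonneg _)
        fun h0 => hx (dotProduct_self_eq_zero.1 h0.symm)
      simp only [Matrix.zero_mulVec, dotProduct_zero, Nat.cast_zero, zero_sub]
      nlinarith
    · intro lam W hS
      have h1 : Matrix.diagonal lam = 0 := by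
        have h2 : Wᵀ * (W * Matrix.diagonal lam * Wᵀ) * W = Matrix.diagonal lam := by
          simp only [Matrix.mul_assoc]
          rw [hS.orth, Matrix.mul_one, ← Matrix.mul_assoc, hS.orth, Matrix.one_mul]
        rw [← h2, ← hS.eq]
        simp
      have h3 : ∀ i, lam i = 0 := fun i => by
        simpa using congrFun (congrFun h1 i) i
      simp only [h3, Nat.cast_zero, zero_sub, neg_neg, Finset.sum_const, Finset.card_univ,
        Fintype.card_fin, nsmul_eq_mul]
      refine le_of_eq ?_
      rw [mul_one_div, div_eq_iff hrk0.ne', hrkφ]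
      have : φ * φ = k / r := Real.mul_self_sqrt (by positivity)
      calc (k : ℝ) = r * (k / r) := by field_simp
        _ = _ := by rw [← this]; ring
  refine (runs_dualSetLoopP hφ1 hk hkN hV hxn0 hdel' r 0 _ hinit).bind ?_
  rintro ⟨s, M⟩ hinv
  simp only [zero_add] at hinv
  refine (runs_divP c r).bind fun scale hscale => (runs_tabulateP_eq fun i =>
    runs_mulP scale (s i)).mono le_rfl ?_
  rintro w rfl
  have hscale0 : 0 < scale := hscale ▸ div_pos hc0 hr
  refine ⟨fun j => mul_nonneg hscale0.le (hinv.nonneg j), ?_, fun y => ?_, ?_⟩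
  · refine le_trans (le_of_eq ?_) hinv.card_le
    simp only [mul_pos_iff_of_pos_left hscale0]
  · have h1 : ∑ j, scale * s j * (V j ⬝ᵥ y) ^ 2 = scale * (y ⬝ᵥ (M *ᵥ y)) := by
      rw [hinv.quad y, Finset.mul_sum]
      exact Finset.sum_congr rfl fun j _ => by ring
    have h2 : (r - rk) * (y ⬝ᵥ y) ≤ y ⬝ᵥ (M *ᵥ y) := by
      by_cases hy : y = 0
      · simp [hy]
      · exact (hinv.above y hy).le
    rw [h1]
    calc (1 - φ) ^ 2 * (y ⬝ᵥ y) = scale * ((r - rk) * (y ⬝ᵥ y)) := by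
          rw [hscale, hrkφ, hc, ← hφ]; field_simp
      _ ≤ _ := mul_le_mul_of_nonneg_left h2 hscale0.le
  · calc ∑ j, scale * s j * ∑ i, X i j ^ 2 = scale * ∑ j, s j * xn j := by
          rw [Finset.mul_sum]
          exact Finset.sum_congr rfl fun j _ => by rw [mul_assoc]
      _ ≤ scale * (r * del) := mul_le_mul_of_nonneg_left hinv.cost_le hscale0.le
      _ = frobSq X := by
        rw [hscale, hdel, ← htot, ht]
        field_simp
        rfl

/-! ### Columns selected by dual set sparsification -/

section Columns

variable {m n k : ℕ}

/-- The projection `P` fixes the columns of `A` with indices in `J`. -/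
def FixesCols (P : Matrix (Fin m) (Fin m) ℝ) (A : Matrix (Fin m) (Fin n) ℝ) (J : List (Fin n)) :
    Prop :=
  ∀ j ∈ J, ∀ i, (P * A) i j = A i j

theorem IsMoorePenrose.fixesCols {A : Matrix (Fin m) (Fin n) ℝ} {J : List (Fin n)}
    {X : Matrix (Fin J.length) (Fin m) ℝ} (h : IsMoorePenrose (selectCols A J) X) :
    FixesCols (selectCols A J * X) A J := by
  intro j hj i
  obtain ⟨a, rfl⟩ := List.get_of_mem hj
  exact congrFun (congrFun h.mul_mul_self i) a

theorem frobSq_sub_le_add {t : ℝ} (ht : 0 < t) (B F : Matrix (Fin m) (Fin n) ℝ) :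
    frobSq (B - F) ≤ (1 + 1 / t) * frobSq B + (1 + t) * frobSq F := by
  simp only [frobSq, Finset.mul_sum, ← Finset.sum_add_distrib]
  refine Finset.sum_le_sum fun i _ => Finset.sum_le_sum fun j _ => ?_
  rw [Matrix.sub_apply]
  set a := B i j
  set b := F i j
  have h1 : (1 + 1 / t) * a ^ 2 + (1 + t) * b ^ 2 - (a - b) ^ 2 = (a + t * b) ^ 2 / t := by
    field_simp; ring
  have h2 : 0 ≤ (a + t * b) ^ 2 / t := by positivity
  linarith

/-- If `A - E` has its rows in the span of the columns of `V`, then the columns of `A` to which dual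
set sparsification of `E` and `V` gives positive weight span a good approximation of `A`. -/
theorem IsDualSet.frobSq_sub_le {q : ℕ} {A E : Matrix (Fin m) (Fin n) ℝ}
    {V : Matrix (Fin n) (Fin k) ℝ} {w : Fin n → ℝ} (h : IsDualSet E V q w) (hkq : k < q)
    (hV : Vᵀ * V = 1) {T : Matrix (Fin m) (Fin k) ℝ} (hA : A = T * Vᵀ + E)
    {P : Matrix (Fin m) (Fin m) ℝ} (hP : IsOrthProj P)
    (hPA : ∀ j, 0 < w j → ∀ i, (P * A) i j = A i j) {t : ℝ} (ht : 0 < t) :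
    frobSq (A - P * A) ≤ frobSq E + (1 + 1 / t) * frobSq (E * V) +
      (1 + t) * (1 / (1 - √((k : ℝ) / q)) ^ 2 * frobSq E) := by
  set c := 1 - √((k : ℝ) / q) with hc
  have hc0 : 0 < c := sub_pos.2 (sqrt_div_lt_one hkq)
  set D := Matrix.diagonal w with hD
  set M := Vᵀ * D * V with hM
  have hVy : ∀ (y : Fin k → ℝ) j, (V *ᵥ y) j = V j ⬝ᵥ y := fun y j => rfl
  have hquad : ∀ y z : Fin k → ℝ, y ⬝ᵥ (M *ᵥ z) = ∑ j, w j * (V j ⬝ᵥ y) * (V j ⬝ᵥ z) := by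
    intro y z
    rw [hM, ← Matrix.mulVec_mulVec, ← Matrix.mulVec_mulVec, Matrix.dotProduct_mulVec,
      ← Matrix.mulVec_transpose, Matrix.transpose_transpose]
    refine Finset.sum_congr rfl fun j _ => ?_
    rw [hVy, Matrix.mulVec_diagonal, hVy]
    ring
  have hlow : ∀ y : Fin k → ℝ, c ^ 2 * (y ⬝ᵥ y) ≤ y ⬝ᵥ (M *ᵥ y) := by
    intro y
    rw [hquad]
    refine (h.le_quad y).trans (le_of_eq (Finset.sum_congr rfl fun j _ => by ring))
  have hunit : IsUnit M := by
    rw [← Matrix.mulVec_injective_iff_isUnit]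
    refine (injective_iff_map_eq_zero (Matrix.mulVecLin M)).2 fun y hy => ?_
    have h1 := hlow y
    rw [Matrix.mulVecLin_apply] at hy
    rw [hy, dotProduct_zero] at h1
    have h2 : 0 ≤ y ⬝ᵥ y := Finset.sum_nonneg fun _ _ => mul_self_nonneg _
    exact dotProduct_self_eq_zero.1 (le_antisymm (by
      by_contra! h3
      have : 0 < c ^ 2 * (y ⬝ᵥ y) := by positivity
      linarith) h2)
  have hMdet : IsUnit M.det := (Matrix.isUnit_iff_isUnit_det M).1 hunit
  set F := E * D * V * M⁻¹ with hF
  have hFM : F * M = E * D * V := by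
    rw [hF, Matrix.mul_assoc, Matrix.nonsing_inv_mul _ hMdet, Matrix.mul_one]
  have hMsymm : Mᵀ = M := by
    rw [hM, hD]; simp [Matrix.mul_assoc]
  -- the weighted columns have at most the norm of `E`, and dividing by `M` costs the factor `c⁻²`
  have hFle : frobSq F ≤ 1 / c ^ 2 * frobSq E := by
    rw [one_div, ← div_eq_inv_mul, le_div_iff₀ (by positivity)]
    refine le_trans ?_ h.cost_le
    have hrow : ∀ i, c ^ 2 * (F i ⬝ᵥ F i) ≤ ∑ j, w j * E i j ^ 2 := by
      intro i
      have h1 : F i ⬝ᵥ (M *ᵥ F i) = ∑ j, w j * E i j * (V j ⬝ᵥ F i) := by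
        have h2 : M *ᵥ F i = (E * D * V) i := by
          rw [← hFM, ← hMsymm, Matrix.mulVec_transpose, hMsymm]
          rfl
        rw [h2]
        have h3 : ∀ b, (E * D * V) i b = ∑ j, E i j * w j * V j b := fun b => by
          rw [Matrix.mul_apply]
          exact Finset.sum_congr rfl fun j _ => by rw [hD, Matrix.mul_diagonal]
        simp only [dotProduct, h3, Finset.mul_sum]
        rw [Finset.sum_comm]
        exact Finset.sum_congr rfl fun j _ => Finset.sum_congr rfl fun b _ => by ring
      have h2 : 0 ≤ ∑ j, w j * (E i j - V j ⬝ᵥ F i) ^ 2 :=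
        Finset.sum_nonneg fun j _ => mul_nonneg (h.nonneg j) (sq_nonneg _)
      have h3 : ∑ j, w j * (E i j - V j ⬝ᵥ F i) ^ 2 = ∑ j, w j * E i j ^ 2 -
          2 * ∑ j, w j * E i j * (V j ⬝ᵥ F i) + ∑ j, w j * (V j ⬝ᵥ F i) * (V j ⬝ᵥ F i) := by
        rw [Finset.mul_sum, ← Finset.sum_sub_distrib, ← Finset.sum_add_distrib]
        exact Finset.sum_congr rfl fun j _ => by ring
      rw [h3, ← h1, ← hquad] at h2
      linarith [hlow (F i)]
    calc frobSq F * c ^ 2 = ∑ i, c ^ 2 * (F i ⬝ᵥ F i) := by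
          rw [← Finset.mul_sum, mul_comm]
          simp only [frobSq, dotProduct, sq]
      _ ≤ ∑ i, ∑ j, w j * E i j ^ 2 := Finset.sum_le_sum fun i _ => hrow i
      _ = ∑ j, w j * ∑ i, E i j ^ 2 := by
        rw [Finset.sum_comm]
        exact Finset.sum_congr rfl fun j _ => (Finset.mul_sum _ _ _).symm
  have hPAD : P * (A * D) = A * D := by
    rw [← Matrix.mul_assoc]
    ext i j
    rw [hD, Matrix.mul_diagonal, Matrix.mul_diagonal]
    rcases (h.nonneg j).eq_or_lt with h0 | h0
    · rw [← h0, mul_zero, mul_zero]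
    · rw [hPA j h0 i]
  have hT : P * (A * D * (V * M⁻¹ * Vᵀ)) = A * D * (V * M⁻¹ * Vᵀ) := by
    rw [← Matrix.mul_assoc, hPAD]
  have hdiff : A - A * D * (V * M⁻¹ * Vᵀ) = (E - E * (V * Vᵀ)) + (E * V - F) * Vᵀ := by
    have h1 : A * D * (V * M⁻¹ * Vᵀ) = T * Vᵀ + F * Vᵀ := by
      rw [hA, Matrix.add_mul, Matrix.add_mul]
      congr 1
      · calc T * Vᵀ * D * (V * M⁻¹ * Vᵀ) = T * (M * M⁻¹) * Vᵀ := by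
              rw [hM]; simp only [Matrix.mul_assoc]
          _ = T * Vᵀ := by rw [Matrix.mul_nonsing_inv _ hMdet, Matrix.mul_one]
      · rw [hF]; simp only [Matrix.mul_assoc]
    rw [h1, hA, Matrix.sub_mul, Matrix.mul_assoc E V]
    abel
  calc frobSq (A - P * A) ≤ frobSq (A - A * D * (V * M⁻¹ * Vᵀ)) := hP.frobSq_sub_le A hT
    _ = frobSq (E - E * (V * Vᵀ)) + frobSq (E * V - F) := by
      rw [hdiff, frobSq_add_of_right, frobSq_mul_orth hV]
      rw [Matrix.transpose_mul, Matrix.transpose_transpose, ← Matrix.mul_assoc, Matrix.sub_mul,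
        Matrix.mul_assoc, Matrix.mul_assoc V, hV, Matrix.mul_one, sub_self, Matrix.zero_mul]
    _ ≤ frobSq E + ((1 + 1 / t) * frobSq (E * V) + (1 + t) * frobSq F) := by
      have := frobSq_sub_mul_proj hV E
      exact add_le_add (by linarith [frobSq_nonneg (E * V)]) (frobSq_sub_le_add ht _ _)
    _ ≤ _ := by
      have : (1 + t) * frobSq F ≤ (1 + t) * (1 / c ^ 2 * frobSq E) :=
        mul_le_mul_of_nonneg_left hFle (by linarith)
      linarith

end Columns

/-! ### Adaptive sampling -/

section Adaptive

variable {N : ℕ}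

/-- The average of `f` over lists of `c` independent indices with probabilities `p`. -/
def listAvg (p : Fin N → ℝ) : ℕ → (List (Fin N) → ℝ) → ℝ
  | 0, f => f []
  | c + 1, f => ∑ i, p i * listAvg p c fun l => f (i :: l)

theorem listAvg_mono {p : Fin N → ℝ} (hp : ∀ i, 0 ≤ p i) : ∀ (c : ℕ) {f g : List (Fin N) → ℝ},
    (∀ l, f l ≤ g l) → listAvg p c f ≤ listAvg p c g
  | 0, _, _, h => h []
  | c + 1, _, _, h => Finset.sum_le_sum fun i _ =>
      mul_le_mul_of_nonneg_left (listAvg_mono hp c fun l => h (i :: l)) (hp i)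

theorem listAvg_nonneg {p : Fin N → ℝ} (hp : ∀ i, 0 ≤ p i) : ∀ (c : ℕ) {f : List (Fin N) → ℝ},
    (∀ l, 0 ≤ f l) → 0 ≤ listAvg p c f
  | 0, _, h => h []
  | c + 1, _, h => Finset.sum_nonneg fun i _ =>
      mul_nonneg (hp i) (listAvg_nonneg hp c fun l => h (i :: l))

theorem listAvg_affine {p : Fin N → ℝ} (hp : ∑ i, p i = 1) (a b : ℝ) :
    ∀ (c : ℕ) (f : List (Fin N) → ℝ), listAvg p c (fun l => a * f l + b) = a * listAvg p c f + b
  | 0, _ => rfl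
  | c + 1, f => by
    simp only [listAvg, listAvg_affine hp a b c]
    calc ∑ i, p i * (a * listAvg p c (fun l => f (i :: l)) + b)
        = ∑ i, (a * (p i * listAvg p c fun l => f (i :: l)) + p i * b) :=
          Finset.sum_congr rfl fun i _ => by ring
      _ = _ := by rw [Finset.sum_add_distrib, ← Finset.mul_sum, ← Finset.sum_mul, hp, one_mul]

theorem listAvg_sum {ι : Type*} {p : Fin N → ℝ} (s : Finset ι) :
    ∀ (c : ℕ) (f : ι → List (Fin N) → ℝ),
      listAvg p c (fun l => ∑ a ∈ s, f a l) = ∑ a ∈ s, listAvg p c (f a)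
  | 0, _ => rfl
  | c + 1, f => by
    simp only [listAvg, listAvg_sum s c, Finset.mul_sum]
    exact Finset.sum_comm

/-- The second moment of a sum of independent identically distributed variables. -/
theorem listAvg_sq {p : Fin N → ℝ} (hp : ∑ i, p i = 1) (ξ : Fin N → ℝ) :
    ∀ (c : ℕ) (a : ℝ), listAvg p c (fun l => (a + (l.map ξ).sum) ^ 2) =
      (a + c * ∑ i, p i * ξ i) ^ 2 + c * (∑ i, p i * ξ i ^ 2 - (∑ i, p i * ξ i) ^ 2)
  | 0, a => by simp [listAvg]
  | c + 1, a => by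
    set μ := ∑ i, p i * ξ i with hμ
    set v := ∑ i, p i * ξ i ^ 2 with hv
    have h1 : ∀ i, listAvg p c (fun l => (a + ((i :: l).map ξ).sum) ^ 2) =
        (a + ξ i + c * μ) ^ 2 + c * (v - μ ^ 2) := by
      intro i
      rw [← listAvg_sq hp ξ c (a + ξ i)]
      simp only [List.map_cons, List.sum_cons, add_assoc]
    simp only [listAvg, h1]
    calc ∑ i, p i * ((a + ξ i + c * μ) ^ 2 + c * (v - μ ^ 2))
        = ∑ i, (p i * ((a + c * μ) ^ 2 + c * (v - μ ^ 2)) + 2 * (a + c * μ) * (p i * ξ i) +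
            p i * ξ i ^ 2) := Finset.sum_congr rfl fun i _ => by ring
      _ = _ := by
        rw [Finset.sum_add_distrib, Finset.sum_add_distrib, ← Finset.sum_mul, ← Finset.mul_sum, hp,
          ← hμ, ← hv]
        push_cast
        ring

theorem sum_toReal_drawProb (hN : 0 < N) (w : Fin N → ℝ) :
    ∑ i, (Prog.drawProb w i).toReal = 1 := by
  by_cases h : (∀ j, 0 ≤ w j) ∧ 0 < ∑ j, w j
  · simp only [Prog.drawProb, if_pos h]
    have h1 : ∀ i, (ENNReal.ofReal (w i / ∑ j, w j)).toReal = w i / ∑ j, w j := fun i =>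
      ENNReal.toReal_ofReal (div_nonneg (h.1 i) h.2.le)
    simp only [h1]
    rw [← Finset.sum_div, div_self h.2.ne']
  · simp only [Prog.drawProb, if_neg h]
    have : (N : ℝ) ≠ 0 := by exact_mod_cast hN.ne'
    simp [this]

theorem drawProb_ne_top (hN : 0 < N) (w : Fin N → ℝ) (i : Fin N) : Prog.drawProb w i ≠ ∞ := by
  unfold Prog.drawProb
  split_ifs
  · exact ENNReal.ofReal_ne_top
  · simpa using hN.ne'

theorem Prog.expect_drawListP (hN : 0 < N) (w : Fin N → ℝ) : ∀ (c : ℕ) {f : List (Fin N) → ℝ},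
    (∀ l, 0 ≤ f l) → (drawListP w c).expect (fun l => ENNReal.ofReal (f l)) =
      ENNReal.ofReal (listAvg (fun i => (drawProb w i).toReal) c f)
  | 0, _, _ => rfl
  | c + 1, f, hf => by
    have h1 : (drawListP w (c + 1)).expect (fun l => ENNReal.ofReal (f l)) =
        ∑ i, drawProb w i * (drawListP w c).expect fun l => ENNReal.ofReal (f (i :: l)) :=
      Finset.sum_congr rfl fun i _ => congrArg _
        (expect_bind _ (fun is => ret (i :: is)) (drawListP w c))
    rw [h1, listAvg, ENNReal.ofReal_sum_of_nonneg fun i _ => mul_nonneg ENNReal.toReal_nonneg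
      (listAvg_nonneg (fun _ => ENNReal.toReal_nonneg) c fun l => hf _)]
    refine Finset.sum_congr rfl fun i _ => ?_
    rw [expect_drawListP hN w c fun l => hf _, ENNReal.ofReal_mul ENNReal.toReal_nonneg,
      ENNReal.ofReal_toReal (drawProb_ne_top hN w i)]

theorem Prog.Always.expect_le {α : Type} {Q : α → Prop} {f g : α → ℝ≥0∞}
    (h : ∀ a, Q a → f a ≤ g a) : ∀ {p : Prog ℝ α}, p.Always Q → p.expect f ≤ p.expect g := by
  intro p
  induction p with
  | ret a => exact h a
  | nat a next ih => exact ih _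
  | arith o x y next ih => exact ih _
  | sqrt x next ih => exact ih _
  | lt x y next ih => exact ih _
  | gauss n s next ih =>
    exact fun hp => le_iInf₂ fun g' hg' => le_iInf fun hle =>
      upperIntegral_le hg' fun G => (ih G (hp G)).trans (hle G)
  | draw N w next ih =>
    exact fun hp => Finset.sum_le_sum fun i _ => mul_le_mul_right (ih i (hp i)) _
  | eig s M next ih => exact ih _ _

variable {m n : ℕ}

/-- Adaptive sampling: if `c` columns are drawn with probabilities proportional to the squared norms
of the columns of the residual of a projection `P₁`, then the error of the projection `Pr l` to
the columns that have been found, measured on the range of `P`, is small on average. -/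
theorem listAvg_adaptive {A : Matrix (Fin m) (Fin n) ℝ} {P₁ : Matrix (Fin m) (Fin m) ℝ}
    {Pr : List (Fin n) → Matrix (Fin m) (Fin m) ℝ} (hPr : ∀ l, IsOrthProj (Pr l))
    (hPr₁ : ∀ l, Pr l * P₁ = P₁) (hfix : ∀ l, FixesCols (Pr l) A l)
    {P : Matrix (Fin n) (Fin n) ℝ} (hP : IsOrthProj P) {c : ℕ} (hc : 0 < c) (hn : 0 < n)
    {w : Fin n → ℝ} (hw : w = fun j => ∑ i, (A - P₁ * A) i j ^ 2) :
    listAvg (fun i => (Prog.drawProb w i).toReal) c (fun l => frobSq ((A - Pr l * A) * P)) ≤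
      P.trace / c * frobSq (A - P₁ * A) := by
  set D := A - P₁ * A with hD
  set p : Fin n → ℝ := fun i => (Prog.drawProb w i).toReal with hp
  have hp0 : ∀ i, 0 ≤ p i := fun i => ENNReal.toReal_nonneg
  have hp1 : ∑ i, p i = 1 := sum_toReal_drawProb hn w
  have hw0 : ∀ j, 0 ≤ w j := fun j => hw ▸ Finset.sum_nonneg fun _ _ => sq_nonneg _
  have htot : ∑ j, w j = frobSq D := by rw [frobSq_eq_sum_cols, hw]
  have hc' : (0 : ℝ) < c := by exact_mod_cast hc
  have hcmp : ∀ (l : List (Fin n)) (T : Matrix (Fin m) (Fin n) ℝ), Pr l * T = T →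
      frobSq ((A - Pr l * A) * P) ≤ frobSq (A * P - T) := by
    intro l T hT
    rw [Matrix.sub_mul, Matrix.mul_assoc]
    exact (hPr l).frobSq_sub_le _ hT
  rcases (frobSq_nonneg D).eq_or_lt with h0 | h0
  · rw [← h0, mul_zero]
    have h1 : ∀ l, frobSq ((A - Pr l * A) * P) ≤ 0 * 0 + 0 := by
      intro l
      have h2 := hcmp l (P₁ * A * P) (by rw [← Matrix.mul_assoc, ← Matrix.mul_assoc, hPr₁])
      rw [← Matrix.sub_mul] at h2
      linarith [hP.frobSq_mul_le' D]
    refine (listAvg_mono hp0 c h1).trans ?_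
    rw [listAvg_affine hp1 0 0 c fun _ => 0]
    simp
  · have hpw : ∀ j, p j = w j / frobSq D := by
      intro j
      have h1 : (∀ j, 0 ≤ w j) ∧ 0 < ∑ j, w j := ⟨hw0, htot ▸ h0⟩
      simp only [hp, Prog.drawProb, if_pos h1]
      rw [ENNReal.toReal_ofReal (div_nonneg (hw0 j) h1.2.le), htot]
    have hD0 : ∀ j, p j = 0 → ∀ i, D i j = 0 := by
      intro j hj i
      rw [hpw, div_eq_zero_iff, or_iff_left h0.ne', hw] at hj
      have := (Finset.sum_eq_zero_iff_of_nonneg fun i _ => sq_nonneg (D i j)).1 hj i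
        (Finset.mem_univ i)
      exact pow_eq_zero_iff two_ne_zero |>.1 this
    -- the unbiased estimator of `D * P` from the drawn columns
    set ξ : Fin m → Fin n → Fin n → ℝ := fun a b j => -(1 / c * (1 / p j) * (D a j * P j b)) with hξ
    have hle : ∀ l, frobSq ((A - Pr l * A) * P) ≤
        ∑ a, ∑ b, ((D * P) a b + (l.map (ξ a b)).sum) ^ 2 := by
      intro l
      set S : Matrix (Fin m) (Fin n) ℝ := fun a b => -(l.map (ξ a b)).sum with hS
      have hPD : ∀ j ∈ l, ∀ a, (Pr l * D) a j = D a j := by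
        intro j hj a
        rw [hD, Matrix.mul_sub, ← Matrix.mul_assoc, hPr₁, Matrix.sub_apply, Matrix.sub_apply,
          hfix l j hj a]
      have hPS : Pr l * S = S := by
        have hSl : ∀ l' : List (Fin n), (∀ j ∈ l', ∀ a, (Pr l * D) a j = D a j) → ∀ a b,
            ∑ x, Pr l a x * -(l'.map (ξ x b)).sum = -(l'.map (ξ a b)).sum := by
          intro l'
          induction l' with
          | nil => simp
          | cons j l' ih =>
            intro hl' a b
            have h1 := ih (fun i hi => hl' i (List.mem_cons_of_mem _ hi)) a b
            have h2 : ∑ x, Pr l a x * -(ξ x b j) = -(ξ a b j) := by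
              have h3 := hl' j List.mem_cons_self a
              rw [Matrix.mul_apply] at h3
              simp only [hξ, neg_neg]
              rw [← h3, Finset.sum_mul, Finset.mul_sum]
              exact Finset.sum_congr rfl fun x _ => by ring
            simp only [List.map_cons, List.sum_cons, neg_add, mul_add, Finset.sum_add_distrib]
            rw [h1, h2]
        ext a b
        rw [Matrix.mul_apply]
        exact hSl l hPD a b
      refine (hcmp l (P₁ * A * P + S) ?_).trans (le_of_eq ?_)
      · rw [Matrix.mul_add, hPS, ← Matrix.mul_assoc, ← Matrix.mul_assoc, hPr₁]
      · refine Finset.sum_congr rfl fun a _ => Finset.sum_congr rfl fun b _ => ?_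
        congr 1
        rw [hD, Matrix.sub_mul, Matrix.sub_apply, Matrix.sub_apply, Matrix.add_apply]
        simp only [hS]
        ring
    have hmean : ∀ a b, (D * P) a b + c * ∑ j, p j * ξ a b j = 0 := by
      intro a b
      rw [Matrix.mul_apply, Finset.mul_sum, ← Finset.sum_add_distrib]
      refine Finset.sum_eq_zero fun j _ => ?_
      simp only [hξ]
      by_cases hj : p j = 0
      · rw [hD0 j hj a]; simp
      · field_simp; ring
    have hvar : ∀ a b j, c * (p j * ξ a b j ^ 2) ≤
        1 / c * (if p j = 0 then 0 else D a j ^ 2 / p j * P j b ^ 2) := by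
      intro a b j
      simp only [hξ]
      split_ifs with hj
      · simp [hj]
      · refine le_of_eq ?_
        field_simp
    refine (listAvg_mono hp0 c hle).trans ?_
    rw [listAvg_sum]
    simp only [listAvg_sum, listAvg_sq hp1, hmean]
    calc ∑ a, ∑ b, ((0 : ℝ) ^ 2 + c * (∑ j, p j * ξ a b j ^ 2 - (∑ j, p j * ξ a b j) ^ 2))
        ≤ ∑ a, ∑ b, ∑ j, 1 / c * (if p j = 0 then 0 else D a j ^ 2 / p j * P j b ^ 2) := by
          refine Finset.sum_le_sum fun a _ => Finset.sum_le_sum fun b _ => ?_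
          refine le_trans ?_ (Finset.sum_le_sum fun j _ => hvar a b j)
          rw [← Finset.mul_sum]
          nlinarith [sq_nonneg (∑ j, p j * ξ a b j)]
      _ = 1 / c * ∑ j, if p j = 0 then 0 else w j / p j * P j j := by
          rw [Finset.sum_congr rfl fun a _ => Finset.sum_comm, Finset.sum_comm, Finset.mul_sum]
          refine Finset.sum_congr rfl fun j _ => ?_
          split_ifs with hj
          · simp
          · rw [hP.apply_self j, hw]
            simp only [Finset.sum_div, Finset.mul_sum]
            rw [Finset.sum_comm]
            exact Finset.sum_congr rfl fun b _ => by rw [Finset.sum_mul, Finset.mul_sum]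
      _ ≤ 1 / c * ∑ j, frobSq D * P j j := by
          refine mul_le_mul_of_nonneg_left (Finset.sum_le_sum fun j _ => ?_) (by positivity)
          have hPj : 0 ≤ P j j := by
            rw [hP.apply_self]; exact Finset.sum_nonneg fun _ _ => sq_nonneg _
          split_ifs with hj
          · exact mul_nonneg h0.le hPj
          · refine mul_le_mul_of_nonneg_right (le_of_eq ?_) hPj
            have : w j = p j * frobSq D := by rw [hpw, div_mul_cancel₀ _ h0.ne']
            rw [this, mul_div_cancel_left₀ _ hj]
      _ = P.trace / c * frobSq D := by
          rw [← Finset.mul_sum, Matrix.trace]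
          simp only [Matrix.diag_apply]
          ring

end Adaptive

/-! ### Column selection -/

section Select

variable {m n k : ℕ}

theorem Prog.runs_drawListP {N : ℕ} (w : Fin N → ℝ) : ∀ c : ℕ,
    (drawListP w c).Runs (c * N) fun l => l.length = c
  | 0 => (Runs.pure (a := []) (Q := fun l => l.length = 0) rfl).of_le (Nat.zero_le _)
  | c + 1 => by
    refine Runs.of_le ((runs_drawP w).bind fun i _ => (runs_drawListP w c).bind fun l hl =>
      Runs.pure (a := i :: l) (Q := fun l => l.length = c + 1) ?_) ?_
    · rw [List.length_cons, hl]
    · rw [Nat.succ_mul]; omega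

theorem length_filter_finRange_le {f : Fin n → Bool} {w : Fin n → ℝ}
    (hf : ∀ j, f j = true ↔ 0 < w j) :
    ((List.finRange n).filter f).length ≤ (Finset.univ.filter fun j => 0 < w j).card := by
  rw [← List.toFinset_card_of_nodup ((List.nodup_finRange n).filter _)]
  refine Finset.card_le_card fun j hj => ?_
  simpa [hf] using hj

theorem select_steps_le {m n k c₁ c₂ q : ℕ} (hm : 0 < m) (hn : 0 < n) (hc : 0 < c₁) (hq : q ≤ c₁) :
    60 * (c₁ * (n * k ^ 2)) + 3 * (n * m) + (1 + (n * 1 + ((13 * (m * q ^ 2) + 2) +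
      (q * (n * (2 * m + 1)) + (m * (n * (2 * q + 1)) + (m * n + (n * (2 * m + 1) +
      (c₂ * n + 0)))))))) ≤
    60 * (c₁ * (n * k ^ 2)) + 13 * (m * c₁ ^ 2) + 20 * (m * n * c₁) + c₂ * n := by
  have h1 : m * q ^ 2 ≤ m * c₁ ^ 2 := by gcongr
  have h2 : n ≤ m * n := Nat.le_mul_of_pos_left _ hm
  have h3 : m * n ≤ m * n * c₁ := Nat.le_mul_of_pos_right _ hc
  have h4 : q * (m * n) ≤ m * n * c₁ := by rw [Nat.mul_comm]; gcongr
  have h5 : q * n ≤ m * n * c₁ := by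
    calc q * n ≤ c₁ * (m * n) := by gcongr
      _ = _ := Nat.mul_comm _ _
  nlinarith

theorem Prog.runs_selectP (A E : Matrix (Fin m) (Fin n) ℝ) {V : Matrix (Fin n) (Fin k) ℝ}
    {c₁ : ℕ} (c₂ : ℕ) (hm : 0 < m) (hk : 0 < k) (hkn : k ≤ n) (hV : Vᵀ * V = 1) (hkc : k < c₁) :
    (selectP A E V c₁ c₂).Runs
      (60 * (c₁ * (n * k ^ 2)) + 13 * (m * c₁ ^ 2) + 20 * (m * n * c₁) + c₂ * n)
      fun J => J.length ≤ c₁ + c₂ := by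
  refine Runs.of_le ((runs_dualSetP E hk hkn hV hkc).bind fun s hs => ?_)
    (select_steps_le (q := c₁) hm (hk.trans_le hkn) (hk.trans hkc) le_rfl)
  refine (runs_natP 0).bind fun zero hz => (runs_tabulateP fun j => runs_ltP zero (s j)).bind
    fun pos hpos => ?_
  rw [hz, Nat.cast_zero] at hpos
  have hlen := (length_filter_finRange_le hpos).trans hs.card_le
  refine ((runs_pinvP _).of_le ?_).bind fun X hX => ?_
  · gcongr
  refine ((runs_matMulP X A).of_le ?_).bind fun XA hXA => ?_
  · gcongr
  refine ((runs_matMulP _ XA).of_le ?_).bind fun P hP => ?_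
  · gcongr
  refine (runs_matSubP A P).bind fun D hD => (runs_colSqNormsP D).bind fun w hw =>
    (runs_drawListP w c₂).bind fun J₂ hJ₂ => Runs.pure ?_
  rw [List.length_append, hJ₂]
  exact Nat.add_le_add_right hlen _

/-- The error of the selected columns `J`, measured on the range of `P`, in expectation. Here `Bd`
bounds the error of the columns that are selected by dual set sparsification alone, and `Pr J` is
the projection to the span of the columns `J`. -/
theorem Prog.expect_selectP_le {A E : Matrix (Fin m) (Fin n) ℝ} {V : Matrix (Fin n) (Fin k) ℝ}
    {c₁ c₂ : ℕ} (hk : 0 < k) (hkn : k ≤ n) (hV : Vᵀ * V = 1) (hkc : k < c₁) (hc₂ : 0 < c₂)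
    {T : Matrix (Fin m) (Fin k) ℝ} (hA : A = T * Vᵀ + E) {t : ℝ} (ht : 0 < t) {Bd : ℝ}
    (hBd : frobSq E + (1 + 1 / t) * frobSq (E * V) +
      (1 + t) * (1 / (1 - √((k : ℝ) / c₁)) ^ 2 * frobSq E) ≤ Bd)
    {Pr : List (Fin n) → Matrix (Fin m) (Fin m) ℝ} (hPr : ∀ l, IsOrthProj (Pr l))
    (hfix : ∀ l, FixesCols (Pr l) A l) {P : Matrix (Fin n) (Fin n) ℝ} (hP : IsOrthProj P)
    {F : List (Fin n) → ℝ≥0∞} {a b : ℝ} (ha : 0 ≤ a) (hb : 0 ≤ b)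
    (hF : ∀ J, F J ≤ ENNReal.ofReal (a * frobSq ((A - Pr J * A) * P) + b)) :
    (selectP A E V c₁ c₂).expect F ≤ ENNReal.ofReal (a * (P.trace / c₂ * Bd) + b) := by
  refine (runs_dualSetP E hk hkn hV hkc).expect_bind_le fun s hs => ?_
  refine (runs_natP 0).expect_bind_le fun zero hz =>
    (runs_tabulateP fun j => runs_ltP zero (s j)).expect_bind_le fun pos hpos => ?_
  rw [hz, Nat.cast_zero] at hpos
  set J₁ := (List.finRange n).filter pos with hJ₁
  refine (runs_pinvP (selectCols A J₁)).expect_bind_le fun X hX =>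
    (runs_matMulP X A).expect_bind_le fun XA hXA =>
    (runs_matMulP (selectCols A J₁) XA).expect_bind_le fun P' hP' =>
    (runs_matSubP A P').expect_bind_le fun D hD => (runs_colSqNormsP D).expect_bind_le fun w hw => ?_
  have hn : 0 < n := hk.trans_le hkn
  set P₁ := selectCols A J₁ * X with hP₁
  have hDP : D = A - P₁ * A := by rw [hD, hP', hXA, hP₁, Matrix.mul_assoc]
  rw [hDP] at hw
  have hJ₁w : ∀ j, 0 < s j → j ∈ J₁ := fun j hj =>
    List.mem_filter.2 ⟨List.mem_finRange j, (hpos j).2 hj⟩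
  have hres : frobSq (A - P₁ * A) ≤ Bd :=
    (hs.frobSq_sub_le hkc hV hA hX.isOrthProj (fun j hj i => hX.fixesCols j (hJ₁w j hj) i)
      ht).trans hBd
  have hfix₁ : ∀ l, Pr (J₁ ++ l) * P₁ = P₁ := by
    intro l
    rw [hP₁, ← Matrix.mul_assoc]
    congr 1
    ext i j
    exact hfix (J₁ ++ l) (J₁.get j) (List.mem_append_left _ (List.get_mem _ _)) i
  have havg := listAvg_adaptive (Pr := fun l => Pr (J₁ ++ l)) (fun l => hPr _) hfix₁
    (fun l j hj => hfix _ j (List.mem_append_right _ hj)) hP hc₂ hn hw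
  have hnn : ∀ l, 0 ≤ a * frobSq ((A - Pr (J₁ ++ l) * A) * P) + b := fun l =>
    add_nonneg (mul_nonneg ha (frobSq_nonneg _)) hb
  refine (expect_bind F (fun J₂ => ret (J₁ ++ J₂)) (drawListP w c₂)).le.trans ?_
  refine ((runs_drawListP _ _).always.expect_le fun l _ => hF (J₁ ++ l)).trans ?_
  rw [expect_drawListP hn w c₂ hnn, listAvg_affine (sum_toReal_drawProb hn w)]
  refine ENNReal.ofReal_le_ofReal ?_
  have h1 : P.trace / c₂ * frobSq (A - P₁ * A) ≤ P.trace / c₂ * Bd :=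
    mul_le_mul_of_nonneg_left hres (div_nonneg hP.trace_nonneg (Nat.cast_nonneg _))
  have h2 := mul_le_mul_of_nonneg_left (havg.trans h1) ha
  linarith

end Select

/-! ### Gaussian integration by parts -/

section Stein

theorem integral_mul_gaussianReal {f f' : ℝ → ℝ} (hd : ∀ x, HasDerivAt f (f' x) x)
    (h₁ : Integrable f (gaussianReal 0 1)) (h₂ : Integrable (fun x => x * f x) (gaussianReal 0 1))
    (h₃ : Integrable f' (gaussianReal 0 1)) :
    ∫ x, x * f x ∂gaussianReal 0 1 = ∫ x, f' x ∂gaussianReal 0 1 := by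
  have hiff : ∀ g : ℝ → ℝ, Integrable g (gaussianReal 0 1) ↔
      Integrable fun x => gaussianPDFReal 0 1 x * g x := by
    intro g
    rw [gaussianReal_of_var_ne_zero 0 one_ne_zero, integrable_withDensity_iff_integrable_smul'
      (measurable_gaussianPDF 0 1) (Filter.Eventually.of_forall fun x => ENNReal.ofReal_lt_top)]
    simp only [gaussianPDF, ENNReal.toReal_ofReal (gaussianPDFReal_nonneg 0 1 _), smul_eq_mul]
  have hρ : ∀ x, HasDerivAt (gaussianPDFReal 0 1) (-(x * gaussianPDFReal 0 1 x)) x := by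
    intro x
    have h1 : HasDerivAt (fun x : ℝ => -(x - 0) ^ 2 / (2 * ((1 : NNReal) : ℝ))) (-x) x := by
      have := (((hasDerivAt_id x).sub_const 0).pow 2).neg.div_const (2 * ((1 : NNReal) : ℝ))
      refine HasDerivAt.congr_deriv this ?_
      simp
      ring
    refine HasDerivAt.congr_deriv
      (h1.exp.const_mul (√(2 * Real.pi * ((1 : NNReal) : ℝ)))⁻¹) ?_
    show _ = -(x * ((√(2 * Real.pi * ((1 : NNReal) : ℝ)))⁻¹ * _))
    ring
  have hparts := integral_mul_deriv_eq_deriv_mul_of_integrable (u := f) (v := gaussianPDFReal 0 1)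
    (fun x _ => hd x) (fun x _ => hρ x)
    (((hiff _).1 h₂).neg.congr (Filter.Eventually.of_forall fun x => by simp; ring))
    (((hiff _).1 h₃).congr (Filter.Eventually.of_forall fun x => by simp [mul_comm]))
    (((hiff _).1 h₁).congr (Filter.Eventually.of_forall fun x => by simp [mul_comm]))
  rw [integral_gaussianReal_eq_integral_smul one_ne_zero,
    integral_gaussianReal_eq_integral_smul one_ne_zero]
  have e1 : ∀ x, gaussianPDFReal 0 1 x • (x * f x) = -(f x * -(x * gaussianPDFReal 0 1 x)) :=
    fun x => by simp only [smul_eq_mul]; ring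
  have e2 : ∀ x, gaussianPDFReal 0 1 x • f' x = f' x * gaussianPDFReal 0 1 x :=
    fun x => by simp only [smul_eq_mul]; ring
  simp only [e1, e2]
  rw [integral_neg, hparts, neg_neg]

section Slices

variable {ι : Type*} [Fintype ι] [DecidableEq ι] {X : ι → Type*} [∀ i, MeasurableSpace (X i)]
  {μ : ∀ i, Measure (X i)} [∀ i, IsProbabilityMeasure (μ i)]

theorem measurePreserving_update (i : ι) :
    MeasurePreserving (fun q : (∀ i, X i) × X i => Function.update q.1 i q.2)
      ((Measure.pi μ).prod (μ i)) (Measure.pi μ) := by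
  have hm : Measurable fun q : (∀ i, X i) × X i => Function.update q.1 i q.2 := by
    refine measurable_pi_iff.2 fun j => ?_
    by_cases hj : j = i
    · subst hj
      simpa using measurable_snd
    · simpa [hj, Function.comp_def] using (measurable_pi_apply j).comp measurable_fst
  refine ⟨hm, (Measure.pi_eq fun s hs => ?_).symm⟩
  rw [Measure.map_apply hm (MeasurableSet.univ_pi hs)]
  have h1 : (fun q : (∀ i, X i) × X i => Function.update q.1 i q.2) ⁻¹' Set.univ.pi s =
      (Set.univ.pi (Function.update s i Set.univ)) ×ˢ s i := by
    ext ⟨x, t⟩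
    simp only [Set.mem_preimage, Set.mem_pi, Set.mem_univ, true_implies, Set.mem_prod]
    constructor
    · intro h
      refine ⟨fun j => ?_, by simpa using h i⟩
      by_cases hj : j = i
      · subst hj; simp
      · simpa [hj] using h j
    · rintro ⟨h, ht⟩ j
      by_cases hj : j = i
      · subst hj; simpa using ht
      · simpa [hj] using h j
  rw [h1, Measure.prod_prod, Measure.pi_pi, ← Finset.mul_prod_erase _ _ (Finset.mem_univ i),
    ← Finset.mul_prod_erase Finset.univ (fun j => μ j (s j)) (Finset.mem_univ i)]
  rw [Function.update_self, measure_univ, one_mul, mul_comm]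
  congr 1
  exact Finset.prod_congr rfl fun j hj => by rw [Function.update_of_ne (Finset.ne_of_mem_erase hj)]

/-- Two functions on a product space have the same integral if this holds on the lines in one
coordinate direction. -/
theorem integral_eq_of_slices (i : ι) {f g h : (∀ i, X i) → ℝ} (hf : Integrable f (Measure.pi μ))
    (hg : Integrable g (Measure.pi μ)) (hh : Integrable h (Measure.pi μ))
    (H : ∀ x, Integrable (fun t => f (Function.update x i t)) (μ i) →
      Integrable (fun t => g (Function.update x i t)) (μ i) →
      Integrable (fun t => h (Function.update x i t)) (μ i) →
      ∫ t, g (Function.update x i t) ∂μ i = ∫ t, h (Function.update x i t) ∂μ i) :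
    ∫ x, g x ∂Measure.pi μ = ∫ x, h x ∂Measure.pi μ := by
  have hmp := measurePreserving_update (μ := μ) i
  have hint : ∀ {f : (∀ i, X i) → ℝ}, Integrable f (Measure.pi μ) →
      Integrable (fun q : (∀ i, X i) × X i => f (Function.update q.1 i q.2))
        ((Measure.pi μ).prod (μ i)) := fun hf => (hmp.integrable_comp hf.1).2 hf
  have hsplit : ∀ {f : (∀ i, X i) → ℝ}, Integrable f (Measure.pi μ) → ∫ x, f x ∂Measure.pi μ =
      ∫ x, ∫ t, f (Function.update x i t) ∂μ i ∂Measure.pi μ := by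
    intro f hf
    rw [← integral_prod _ (hint hf)]
    conv_lhs => rw [← hmp.map_eq]
    rw [integral_map hmp.measurable.aemeasurable (by rw [hmp.map_eq]; exact hf.1)]
  rw [hsplit hg, hsplit hh]
  refine integral_congr_ae ?_
  filter_upwards [(hint hf).prod_right_ae, (hint hg).prod_right_ae, (hint hh).prod_right_ae]
    with x h1 h2 h3
  exact H x h1 h2 h3

end Slices

variable {n s : ℕ}

theorem add_smul_single_eq_update (G : Fin n → Fin s → ℝ) (p : Fin n) (i : Fin s) (a : ℝ) :
    G + a • (Pi.single p (Pi.single i 1) : Fin n → Fin s → ℝ) =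
      Function.update G p (Function.update (G p) i (G p i + a)) := by
  funext p' i'
  by_cases hp : p' = p
  · subst hp
    by_cases hi : i' = i
    · subst hi; simp
    · simp [hi]
  · simp [hp]

/-- Stein's identity for one entry of a Gaussian matrix. -/
theorem integral_entry_mul_gaussMeasure {φ φ' : (Fin n → Fin s → ℝ) → ℝ} (p : Fin n) (i : Fin s)
    (h₁ : Integrable φ (Prog.gaussMeasure n s))
    (h₂ : Integrable (fun G => G p i * φ G) (Prog.gaussMeasure n s))
    (h₃ : Integrable φ' (Prog.gaussMeasure n s))
    (hd : ∀ G, HasDerivAt (fun τ : ℝ => φ (G + τ • (Pi.single p (Pi.single i 1) : Fin n → Fin s → ℝ))) (φ' G) 0) :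
    ∫ G, G p i * φ G ∂Prog.gaussMeasure n s = ∫ G, φ' G ∂Prog.gaussMeasure n s := by
  refine integral_eq_of_slices p h₁ h₂ h₃ fun G k₁ k₂ k₃ => ?_
  refine integral_eq_of_slices i k₁ k₂ k₃ fun g l₁ l₂ l₃ => ?_
  simp only [Function.update_self] at l₂ ⊢
  refine integral_mul_gaussianReal (fun t => ?_) l₁ l₂ l₃
  have h := hd (Function.update G p (Function.update g i t))
  simp only [add_smul_single_eq_update, Function.update_idem, Function.update_self] at h
  have h' := HasDerivAt.comp t (h₂ := fun τ : ℝ =>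
    φ (Function.update G p (Function.update g i (t + τ)))) (h := fun x => x - t)
    (by simpa using h) ((hasDerivAt_id t).sub_const t)
  simpa [Function.comp_def] using h'

end Stein

/-! ### Regularised right inverses -/

section Ridge

variable {κ s : ℕ}

/-- The inverse of the regularised Gram matrix `H * Hᵀ + η`. -/
noncomputable def ridgeInv (η : ℝ) (H : Matrix (Fin κ) (Fin s) ℝ) : Matrix (Fin κ) (Fin κ) ℝ :=
  (H * Hᵀ + η • (1 : Matrix (Fin κ) (Fin κ) ℝ))⁻¹

/-- The regularised right inverse of `H`. -/
noncomputable def ridgeRight (η : ℝ) (H : Matrix (Fin κ) (Fin s) ℝ) : Matrix (Fin s) (Fin κ) ℝ :=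
  Hᵀ * ridgeInv η H

theorem isUnit_ridgeGram_det {η : ℝ} (hη : 0 < η) (H : Matrix (Fin κ) (Fin s) ℝ) :
    IsUnit (H * Hᵀ + η • (1 : Matrix (Fin κ) (Fin κ) ℝ)).det := by
  rw [← Matrix.isUnit_iff_isUnit_det, ← Matrix.mulVec_injective_iff_isUnit]
  refine (injective_iff_map_eq_zero (Matrix.mulVecLin _)).2 fun y hy => ?_
  rw [Matrix.mulVecLin_apply] at hy
  have h1 : y ⬝ᵥ ((H * Hᵀ + η • (1 : Matrix (Fin κ) (Fin κ) ℝ)) *ᵥ y) =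
      (Hᵀ *ᵥ y) ⬝ᵥ (Hᵀ *ᵥ y) + η * (y ⬝ᵥ y) := by
    rw [Matrix.add_mulVec, dotProduct_add, Matrix.smul_mulVec, Matrix.one_mulVec, dotProduct_smul,
      smul_eq_mul, ← Matrix.mulVec_mulVec, Matrix.dotProduct_mulVec, ← Matrix.mulVec_transpose]
  rw [hy, dotProduct_zero] at h1
  have h2 : 0 ≤ (Hᵀ *ᵥ y) ⬝ᵥ (Hᵀ *ᵥ y) := Finset.sum_nonneg fun _ _ => mul_self_nonneg _
  have h3 : 0 ≤ y ⬝ᵥ y := Finset.sum_nonneg fun _ _ => mul_self_nonneg _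
  exact dotProduct_self_eq_zero.1 (le_antisymm (by nlinarith) h3)

section Facts

variable {η : ℝ} (hη : 0 < η) (H : Matrix (Fin κ) (Fin s) ℝ)

theorem ridgeInv_transpose : (ridgeInv η H)ᵀ = ridgeInv η H := by
  rw [ridgeInv, Matrix.transpose_nonsing_inv]
  simp

theorem ridgeRight_transpose : (ridgeRight η H)ᵀ = ridgeInv η H * H := by
  rw [ridgeRight, Matrix.transpose_mul, ridgeInv_transpose, Matrix.transpose_transpose]

theorem mul_ridgeRight (hη : 0 < η) : H * ridgeRight η H = 1 - η • ridgeInv η H := by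
  have h := Matrix.mul_nonsing_inv _ (isUnit_ridgeGram_det hη H)
  rw [Matrix.add_mul, Matrix.smul_mul, Matrix.one_mul] at h
  rw [ridgeRight, ← Matrix.mul_assoc, ridgeInv, eq_sub_iff_add_eq, h]

theorem mul_ridgeRight_transpose (hη : 0 < η) :
    (H * ridgeRight η H)ᵀ = H * ridgeRight η H := by
  rw [mul_ridgeRight H hη, Matrix.transpose_sub, Matrix.transpose_smul, ridgeInv_transpose,
    Matrix.transpose_one]

theorem frobSq_ridgeRight (hη : 0 < η) :
    frobSq (ridgeRight η H) = (ridgeInv η H).trace - η * frobSq (ridgeInv η H) := by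
  have h : (ridgeRight η H)ᵀ * ridgeRight η H =
      ridgeInv η H - η • (ridgeInv η H * (ridgeInv η H)ᵀ) := by
    rw [ridgeRight_transpose, Matrix.mul_assoc, mul_ridgeRight H hη, Matrix.mul_sub, Matrix.mul_one,
      Matrix.mul_smul, ridgeInv_transpose]
  rw [frobSq_eq_trace', h, Matrix.trace_sub, Matrix.trace_smul, ← frobSq_eq_trace, smul_eq_mul]

theorem trace_mul_ridgeRight (hη : 0 < η) :
    (H * ridgeRight η H).trace = κ - η * (ridgeInv η H).trace := by
  rw [mul_ridgeRight H hη, Matrix.trace_sub, Matrix.trace_smul, Matrix.trace_one, Fintype.card_fin,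
    smul_eq_mul]

theorem trace_mul_ridgeRight_eq (hη : 0 < η) : (H * ridgeRight η H).trace =
    frobSq (H * ridgeRight η H) + η * frobSq (ridgeRight η H) := by
  have h1 : frobSq (H * ridgeRight η H) = (H * ridgeRight η H).trace -
      η * (ridgeInv η H * (H * ridgeRight η H)).trace := by
    rw [frobSq_eq_trace', mul_ridgeRight_transpose H hη]
    nth_rewrite 1 [mul_ridgeRight H hη]
    rw [Matrix.sub_mul, Matrix.one_mul, Matrix.trace_sub, Matrix.smul_mul, Matrix.trace_smul,
      smul_eq_mul]
  have h2 : frobSq (ridgeRight η H) = (ridgeInv η H * (H * ridgeRight η H)).trace := by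
    rw [frobSq_eq_trace', ridgeRight_transpose, Matrix.mul_assoc]
  rw [h1, h2]
  ring

theorem frobSq_ridgeInv_le (hη : 0 < η) : η * frobSq (ridgeInv η H) ≤ (ridgeInv η H).trace := by
  linarith [frobSq_ridgeRight H hη, frobSq_nonneg (ridgeRight η H)]

theorem trace_ridgeInv_nonneg (hη : 0 < η) : 0 ≤ (ridgeInv η H).trace :=
  (mul_nonneg hη.le (frobSq_nonneg _)).trans (frobSq_ridgeInv_le H hη)

theorem trace_ridgeInv_le (hη : 0 < η) : (ridgeInv η H).trace ≤ κ / η := by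
  rw [le_div_iff₀ hη]
  have h1 := trace_mul_ridgeRight H hη
  have h2 := trace_mul_ridgeRight_eq H hη
  have h3 := mul_nonneg hη.le (frobSq_nonneg (ridgeRight η H))
  linarith [frobSq_nonneg (H * ridgeRight η H)]

theorem frobSq_ridgeRight_le (hη : 0 < η) : frobSq (ridgeRight η H) ≤ (ridgeInv η H).trace := by
  linarith [frobSq_ridgeRight H hη, mul_nonneg hη.le (frobSq_nonneg (ridgeInv η H))]

theorem frobSq_ridgeRight_mul_le (hη : 0 < η) : frobSq (ridgeRight η H * H) ≤ κ := by
  have hsymm : (ridgeRight η H * H)ᵀ = ridgeRight η H * H := by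
    rw [Matrix.transpose_mul, ridgeRight_transpose, ridgeRight, Matrix.mul_assoc]
  have h1 : frobSq (ridgeRight η H * H) = frobSq (H * ridgeRight η H) := by
    rw [frobSq_eq_trace, hsymm, frobSq_eq_trace, mul_ridgeRight_transpose H hη, Matrix.mul_assoc,
      Matrix.trace_mul_comm, Matrix.mul_assoc, Matrix.mul_assoc, Matrix.mul_assoc]
  rw [h1]
  have h2 := trace_mul_ridgeRight H hη
  have h3 := trace_mul_ridgeRight_eq H hη
  have h4 := mul_nonneg hη.le (frobSq_nonneg (ridgeRight η H))
  have h5 := mul_nonneg hη.le (trace_ridgeInv_nonneg H hη)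
  linarith

end Facts

theorem abs_le_sqrt_frobSq {m n : ℕ} (A : Matrix (Fin m) (Fin n) ℝ) (i : Fin m) (j : Fin n) :
    |A i j| ≤ √(frobSq A) := by
  refine Real.abs_le_sqrt ?_
  calc A i j ^ 2 ≤ ∑ j, A i j ^ 2 :=
        Finset.single_le_sum (f := fun j => A i j ^ 2) (fun _ _ => sq_nonneg _) (Finset.mem_univ j)
    _ ≤ frobSq A := Finset.single_le_sum (f := fun i => ∑ j, A i j ^ 2)
        (fun _ _ => Finset.sum_nonneg fun _ _ => sq_nonneg _) (Finset.mem_univ i)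

theorem frobSq_mul_le {l m n : ℕ} (A : Matrix (Fin l) (Fin m) ℝ) (B : Matrix (Fin m) (Fin n) ℝ) :
    frobSq (A * B) ≤ frobSq A * frobSq B := by
  rw [frobSq_eq_sum_cols B, frobSq, frobSq, Finset.sum_mul_sum]
  exact Finset.sum_le_sum fun i _ => Finset.sum_le_sum fun j _ =>
    Finset.sum_mul_sq_le_sq_mul_sq Finset.univ (A i) fun t => B t j

theorem continuous_ridgeInv {η : ℝ} (hη : 0 < η) {X : Type*} [TopologicalSpace X]
    {f : X → Matrix (Fin κ) (Fin s) ℝ} (hf : Continuous f) :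
    Continuous fun x => ridgeInv η (f x) := by
  have hg : Continuous fun x => f x * (f x)ᵀ + η • (1 : Matrix (Fin κ) (Fin κ) ℝ) :=
    (hf.matrix_mul hf.matrix_transpose).add continuous_const
  simp only [ridgeInv, Matrix.inv_def, Ring.inverse_eq_inv']
  exact (hg.matrix_det.inv₀ fun x => (isUnit_ridgeGram_det hη (f x)).ne_zero).smul
    hg.matrix_adjugate

/-- The derivative of an entry of `ridgeInv η H` when the column `i` of `H` moves in direction
`v`. -/
theorem hasDerivAt_ridgeInv {η : ℝ} (hη : 0 < η) (H : Matrix (Fin κ) (Fin s) ℝ) (v : Fin κ → ℝ)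
    (i : Fin s) (a b : Fin κ) :
    HasDerivAt (fun τ : ℝ => ridgeInv η (H + τ • Matrix.vecMulVec v (Pi.single i 1)) a b)
      (-((ridgeInv η H *ᵥ v) a * ridgeRight η H i b + ridgeRight η H i a * (ridgeInv η H *ᵥ v) b))
      0 := by
  set S := ridgeInv η H with hS
  set g : Fin κ → ℝ := fun c => H c i with hg
  set Hτ : ℝ → Matrix (Fin κ) (Fin s) ℝ := fun τ => H + τ • Matrix.vecMulVec v (Pi.single i 1)
    with hHτ
  set B : ℝ → Matrix (Fin κ) (Fin κ) ℝ := fun τ =>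
    Matrix.vecMulVec v g + Matrix.vecMulVec g v + τ • Matrix.vecMulVec v v with hB
  have hgram : ∀ τ, Hτ τ * (Hτ τ)ᵀ + η • (1 : Matrix (Fin κ) (Fin κ) ℝ) =
      (H * Hᵀ + η • (1 : Matrix (Fin κ) (Fin κ) ℝ)) + τ • B τ := by
    intro τ
    ext c d
    have h1 : (Hτ τ * (Hτ τ)ᵀ) c d = (H * Hᵀ) c d + τ * B τ c d := by
      have h2 : ∀ x, (H c x + τ * (v c * Pi.single (M := fun _ => ℝ) i 1 x)) *
          (H d x + τ * (v d * Pi.single (M := fun _ => ℝ) i 1 x)) = H c x * H d x +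
            if x = i then τ * (v c * H d i + H c i * v d + τ * (v c * v d)) else 0 := by
        intro x
        by_cases hx : x = i
        · subst hx; simp; ring
        · simp [hx]
      simp only [Matrix.mul_apply, Matrix.transpose_apply, hHτ, hB, Matrix.add_apply,
        Matrix.smul_apply, Matrix.vecMulVec_apply, smul_eq_mul, h2, Finset.sum_add_distrib,
        Finset.sum_ite_eq', Finset.mem_univ, if_true, hg]
    simp only [Matrix.add_apply, Matrix.smul_apply, smul_eq_mul, h1]
    ring
  -- the resolvent identity
  have hres : ∀ τ, ridgeInv η (Hτ τ) - S = -(τ • (ridgeInv η (Hτ τ) * B τ * S)) := by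
    intro τ
    have e1 : ridgeInv η (Hτ τ) * ((H * Hᵀ + η • (1 : Matrix (Fin κ) (Fin κ) ℝ)) + τ • B τ) = 1 := by
      rw [← hgram]
      exact Matrix.nonsing_inv_mul _ (isUnit_ridgeGram_det hη _)
    have e2 : (H * Hᵀ + η • (1 : Matrix (Fin κ) (Fin κ) ℝ)) * S = 1 :=
      Matrix.mul_nonsing_inv _ (isUnit_ridgeGram_det hη _)
    have e3 := congrArg (· * S) e1
    simp only [Matrix.mul_add, Matrix.add_mul, Matrix.one_mul] at e3
    rw [← Matrix.add_mul, ← Matrix.mul_add, Matrix.mul_assoc, e2, Matrix.mul_one, Matrix.mul_smul,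
      Matrix.smul_mul] at e3
    rw [eq_neg_iff_add_eq_zero, sub_add_eq_add_sub, e3, sub_self]
  rw [hasDerivAt_iff_tendsto_slope_zero]
  have hcont : Continuous fun τ : ℝ => -((ridgeInv η (Hτ τ) * B τ * S) a b) := by
    have h1 : Continuous Hτ := continuous_const.add (continuous_id.smul continuous_const)
    have h2 : Continuous B := continuous_const.add (continuous_id.smul continuous_const)
    have h3 := ((continuous_ridgeInv hη h1).matrix_mul h2).matrix_mul
      (continuous_const (y := S))
    exact (h3.matrix_elem a b).neg
  have hlim := hcont.tendsto 0
  have hval : -((ridgeInv η (Hτ 0) * B 0 * S) a b) =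
      -((S *ᵥ v) a * ridgeRight η H i b + ridgeRight η H i a * (S *ᵥ v) b) := by
    have h0 : Hτ 0 = H := by simp [hHτ]
    have hT : ∀ x y : Fin κ → ℝ, S * Matrix.vecMulVec x y * S =
        Matrix.vecMulVec (S *ᵥ x) (S *ᵥ y) := by
      intro x y
      rw [Matrix.mul_vecMulVec, Matrix.vecMulVec_mul, ← Matrix.mulVec_transpose, hS,
        ridgeInv_transpose]
    have hX : ∀ c, ridgeRight η H i c = (S *ᵥ g) c := by
      intro c
      have := congrFun (congrFun (ridgeRight_transpose (η := η) H) c) i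
      exact this
    rw [h0, ← hS]
    simp only [hB, zero_smul, add_zero]
    rw [Matrix.mul_add, Matrix.add_mul, hT, hT, hX, hX]
    simp [Matrix.vecMulVec_apply]
  rw [hval] at hlim
  refine (hlim.mono_left nhdsWithin_le_nhds).congr' ?_
  filter_upwards [self_mem_nhdsWithin] with τ hτ
  have h1 := congrFun (congrFun (hres τ) a) b
  rw [Matrix.sub_apply, Matrix.neg_apply, Matrix.smul_apply, smul_eq_mul] at h1
  have h0 : Hτ 0 = H := by simp [hHτ]
  have hτ' : τ ≠ 0 := hτ
  show _ = τ⁻¹ • (ridgeInv η (Hτ (0 + τ)) a b - ridgeInv η (Hτ 0) a b)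
  rw [zero_add, h0, ← hS, h1, smul_eq_mul]
  field_simp

/-- The derivative of the entry `(j, a)` of `ridgeRight η H` when the column `i` of `H` moves in
direction `v`. -/
noncomputable def ridgeDeriv (η : ℝ) (H : Matrix (Fin κ) (Fin s) ℝ) (i j : Fin s) (a : Fin κ)
    (v : Fin κ → ℝ) : ℝ :=
  (if j = i then (ridgeInv η H *ᵥ v) a else 0) - (ridgeRight η H *ᵥ v) j * ridgeRight η H i a -
    (ridgeRight η H * H) i j * (ridgeInv η H *ᵥ v) a

theorem hasDerivAt_ridgeRight {η : ℝ} (hη : 0 < η) (H : Matrix (Fin κ) (Fin s) ℝ) (v : Fin κ → ℝ)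
    (i j : Fin s) (a : Fin κ) :
    HasDerivAt (fun τ : ℝ => ridgeRight η (H + τ • Matrix.vecMulVec v (Pi.single i 1)) j a)
      (ridgeDeriv η H i j a v) 0 := by
  have hH : ∀ b, HasDerivAt
      (fun τ : ℝ => (H + τ • Matrix.vecMulVec v (Pi.single i 1)) b j)
      (v b * Pi.single (M := fun _ => ℝ) i 1 j) 0 := by
    intro b
    have := ((hasDerivAt_id (0 : ℝ)).mul_const
      (v b * Pi.single (M := fun _ => ℝ) i 1 j)).const_add (H b j)
    rwa [one_mul] at this
  have h := HasDerivAt.fun_sum (u := Finset.univ) fun b _ =>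
    (hH b).mul (hasDerivAt_ridgeInv hη H v i b a)
  refine HasDerivAt.congr_deriv (f := fun τ : ℝ =>
    ridgeRight η (H + τ • Matrix.vecMulVec v (Pi.single i 1)) j a) h ?_
  simp only [zero_smul, add_zero]
  have e1 : (ridgeInv η H *ᵥ v) a = ∑ b, v b * ridgeInv η H b a := by
    conv_lhs => rw [← ridgeInv_transpose, Matrix.mulVec_transpose]
    rfl
  have e2 : (ridgeRight η H *ᵥ v) j = ∑ b, H b j * (ridgeInv η H *ᵥ v) b := by
    rw [ridgeRight, ← Matrix.mulVec_mulVec]; rfl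
  have e3 : (ridgeRight η H * H) i j = ∑ b, H b j * ridgeRight η H i b := by
    rw [Matrix.mul_apply]
    exact Finset.sum_congr rfl fun b _ => mul_comm _ _
  have e4 : (if j = i then (ridgeInv η H *ᵥ v) a else 0) =
      ∑ b, v b * Pi.single (M := fun _ => ℝ) i 1 j * ridgeInv η H b a := by
    split_ifs with hj
    · subst hj; rw [e1]; simp
    · simp [hj]
  rw [ridgeDeriv, e4, e2, e3, Finset.sum_mul, Finset.sum_mul, ← Finset.sum_sub_distrib,
    ← Finset.sum_sub_distrib]
  exact Finset.sum_congr rfl fun b _ => by ring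

theorem sum_mul_ridgeDeriv {n : ℕ} (η : ℝ) (H : Matrix (Fin κ) (Fin s) ℝ) (i j : Fin s) (a : Fin κ)
    (c : Fin n → ℝ) (V : Matrix (Fin n) (Fin κ) ℝ) :
    ∑ p, c p * ridgeDeriv η H i j a (V p) =
      ridgeDeriv η H i j a (Vᵀ *ᵥ c) := by
  have hlin : ∀ {l : ℕ} (M : Matrix (Fin l) (Fin κ) ℝ) b,
      (M *ᵥ (Vᵀ *ᵥ c)) b = ∑ p, c p * (M *ᵥ V p) b := by
    intro l M b
    rw [Matrix.mulVec_mulVec]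
    show ∑ p, (M * Vᵀ) b p * c p = _
    refine Finset.sum_congr rfl fun p _ => ?_
    rw [mul_comm]
    rfl
  simp only [ridgeDeriv]
  rw [hlin, hlin, Finset.sum_mul, Finset.mul_sum]
  have h : (if j = i then ∑ p, c p * (ridgeInv η H *ᵥ V p) a else 0) =
      ∑ p, if j = i then c p * (ridgeInv η H *ᵥ V p) a else 0 := by
    split_ifs <;> simp
  rw [h, ← Finset.sum_sub_distrib, ← Finset.sum_sub_distrib]
  refine Finset.sum_congr rfl fun p _ => ?_
  split_ifs <;> ring

end Ridge

/-! ### Gaussian expectations of the regularised right inverse -/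

section Growth

variable {n s : ℕ}

/-- Continuous functions of a matrix that grow at most like the `d`-th power of its norm. -/
def PolyGrowth (d : ℕ) (f : (Fin n → Fin s → ℝ) → ℝ) : Prop :=
  Continuous f ∧ ∃ C, ∀ G, |f G| ≤ C * (1 + ‖G‖) ^ d

namespace PolyGrowth

variable {d e : ℕ} {f g : (Fin n → Fin s → ℝ) → ℝ}

theorem of_bounded (hf : Continuous f) (C : ℝ) (h : ∀ G, |f G| ≤ C) : PolyGrowth 0 f :=
  ⟨hf, C, fun G => by simpa using h G⟩

theorem mono (hf : PolyGrowth d f) (hde : d ≤ e) : PolyGrowth e f := by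
  obtain ⟨hc, C, hC⟩ := hf
  refine ⟨hc, C, fun G => (hC G).trans ?_⟩
  have hC0 : 0 ≤ C := by
    have h := (abs_nonneg _).trans (hC G)
    exact nonneg_of_mul_nonneg_left h (by positivity)
  exact mul_le_mul_of_nonneg_left
    (pow_le_pow_right₀ (by linarith [norm_nonneg G]) hde) hC0

theorem const (c : ℝ) : PolyGrowth 0 fun _ : Fin n → Fin s → ℝ => c :=
  of_bounded continuous_const |c| fun _ => le_rfl

theorem entry (p : Fin n) (i : Fin s) : PolyGrowth 1 fun G : Fin n → Fin s → ℝ => G p i := by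
  refine ⟨by fun_prop, 1, fun G => ?_⟩
  have h1 := norm_le_pi_norm (G p) i
  have h2 := norm_le_pi_norm G p
  rw [Real.norm_eq_abs] at h1
  linarith

theorem add (hf : PolyGrowth d f) (hg : PolyGrowth d g) : PolyGrowth d fun G => f G + g G := by
  obtain ⟨hc, C, hC⟩ := hf
  obtain ⟨hc', C', hC'⟩ := hg
  refine ⟨hc.add hc', C + C', fun G => (abs_add_le _ _).trans ?_⟩
  linarith [hC G, hC' G]

theorem mul (hf : PolyGrowth d f) (hg : PolyGrowth e g) :
    PolyGrowth (d + e) fun G => f G * g G := by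
  obtain ⟨hc, C, hC⟩ := hf
  obtain ⟨hc', C', hC'⟩ := hg
  refine ⟨hc.mul hc', C * C', fun G => ?_⟩
  rw [abs_mul, pow_add, mul_mul_mul_comm]
  exact mul_le_mul (hC G) (hC' G) (abs_nonneg _) ((abs_nonneg _).trans (hC G))

theorem const_mul (c : ℝ) (hf : PolyGrowth d f) : PolyGrowth d fun G => c * f G := by
  simpa using (const c).mul hf

theorem sub (hf : PolyGrowth d f) (hg : PolyGrowth d g) : PolyGrowth d fun G => f G - g G := by
  have := hf.add (hg.const_mul (-1))
  simpa [sub_eq_add_neg] using this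

theorem sum {ι : Type*} (t : Finset ι) {F : ι → (Fin n → Fin s → ℝ) → ℝ}
    (h : ∀ i ∈ t, PolyGrowth d (F i)) : PolyGrowth d fun G => ∑ i ∈ t, F i G := by
  classical
  induction t using Finset.induction_on with
  | empty => simpa using (const (0 : ℝ)).mono (Nat.zero_le d)
  | insert a t ha ih =>
    simp only [Finset.sum_insert ha]
    exact (h a (Finset.mem_insert_self a t)).add
      (ih fun i hi => h i (Finset.mem_insert_of_mem hi))

theorem integrable_sq_entry (p : Fin n) (i : Fin s) :
    Integrable (fun G : Fin n → Fin s → ℝ => G p i ^ 2) (Prog.gaussMeasure n s) := by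
  have h1 : MeasurePreserving (fun G : Fin n → Fin s → ℝ => G p i) (Prog.gaussMeasure n s)
      (gaussianReal 0 1) :=
    (measurePreserving_eval (fun _ : Fin s => gaussianReal 0 1) i).comp
      (measurePreserving_eval (fun _ : Fin n => Measure.pi fun _ : Fin s => gaussianReal 0 1) p)
  have h2 : Integrable (fun x : ℝ => x ^ 2) (gaussianReal 0 1) := by
    have := (memLp_id_gaussianReal (μ := 0) (v := 1) 2).integrable_sq
    simpa using this
  exact h1.integrable_comp_of_integrable h2

theorem integrable (hf : PolyGrowth d f) (hd : d ≤ 2) : Integrable f (Prog.gaussMeasure n s) := by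
  obtain ⟨hc, C, hC⟩ := hf.mono hd
  have hdom : Integrable (fun G : Fin n → Fin s → ℝ => |C| * (2 + 2 * ∑ p, ∑ i, G p i ^ 2))
      (Prog.gaussMeasure n s) :=
    ((integrable_const _).add ((integrable_finsetSum _ fun p _ => integrable_finsetSum _
      fun i _ => integrable_sq_entry p i).const_mul 2)).const_mul _
  refine hdom.mono' hc.aestronglyMeasurable (Filter.Eventually.of_forall fun G => ?_)
  rw [Real.norm_eq_abs]
  have hle : ‖G‖ ≤ √(∑ p, ∑ i, G p i ^ 2) := by
    refine (pi_norm_le_iff_of_nonneg (Real.sqrt_nonneg _)).2 fun p =>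
      (pi_norm_le_iff_of_nonneg (Real.sqrt_nonneg _)).2 fun i => ?_
    exact abs_le_sqrt_frobSq (Matrix.of G) p i
  have hsq : ‖G‖ ^ 2 ≤ ∑ p, ∑ i, G p i ^ 2 := by
    rw [← Real.sq_sqrt (Finset.sum_nonneg fun p _ => Finset.sum_nonneg fun i _ => sq_nonneg (G p i))]
    exact pow_le_pow_left₀ (norm_nonneg _) hle 2
  calc |f G| ≤ C * (1 + ‖G‖) ^ 2 := hC G
    _ ≤ |C| * (1 + ‖G‖) ^ 2 := mul_le_mul_of_nonneg_right (le_abs_self C) (sq_nonneg _)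
    _ ≤ _ := mul_le_mul_of_nonneg_left (by nlinarith [sq_nonneg (1 - ‖G‖)]) (abs_nonneg C)

end PolyGrowth

end Growth

section RidgeExpectation

variable {n s κ m : ℕ} {η : ℝ} (V : Matrix (Fin n) (Fin κ) ℝ)

theorem continuous_transpose_mul_of :
    Continuous fun G : Fin n → Fin s → ℝ => Vᵀ * Matrix.of G :=
  continuous_const.matrix_mul continuous_id

theorem continuous_ridgeRight (hη : 0 < η) :
    Continuous fun G : Fin n → Fin s → ℝ => ridgeRight η (Vᵀ * Matrix.of G) :=
  (continuous_transpose_mul_of V).matrix_transpose.matrix_mul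
    (continuous_ridgeInv hη (continuous_transpose_mul_of V))

theorem polyGrowth_ridgeInv (hη : 0 < η) (a b : Fin κ) :
    PolyGrowth 0 fun G : Fin n → Fin s → ℝ => ridgeInv η (Vᵀ * Matrix.of G) a b := by
  refine .of_bounded ((continuous_ridgeInv hη (continuous_transpose_mul_of V)).matrix_elem a b)
    (√(κ / η / η)) fun _ => (abs_le_sqrt_frobSq _ a b).trans (Real.sqrt_le_sqrt ?_)
  rw [le_div_iff₀' hη]
  exact (frobSq_ridgeInv_le _ hη).trans (trace_ridgeInv_le _ hη)

theorem polyGrowth_ridgeRight (hη : 0 < η) (i : Fin s) (a : Fin κ) :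
    PolyGrowth 0 fun G : Fin n → Fin s → ℝ => ridgeRight η (Vᵀ * Matrix.of G) i a :=
  .of_bounded ((continuous_ridgeRight V hη).matrix_elem i a) (√(κ / η)) fun _ =>
    (abs_le_sqrt_frobSq _ i a).trans (Real.sqrt_le_sqrt
      ((frobSq_ridgeRight_le _ hη).trans (trace_ridgeInv_le _ hη)))

theorem polyGrowth_ridgeDeriv (hη : 0 < η) (i j : Fin s) (a : Fin κ) (v : Fin κ → ℝ) :
    PolyGrowth 0 fun G : Fin n → Fin s → ℝ => ridgeDeriv η (Vᵀ * Matrix.of G) i j a v := by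
  have h1 : PolyGrowth 0 fun G : Fin n → Fin s → ℝ => (ridgeInv η (Vᵀ * Matrix.of G) *ᵥ v) a :=
    .sum Finset.univ fun b _ => (polyGrowth_ridgeInv V hη a b).mul (.const (v b))
  have h2 : PolyGrowth 0 fun G : Fin n → Fin s → ℝ => (ridgeRight η (Vᵀ * Matrix.of G) *ᵥ v) j :=
    .sum Finset.univ fun b _ => (polyGrowth_ridgeRight V hη j b).mul (.const (v b))
  have h3 : PolyGrowth 0 fun G : Fin n → Fin s → ℝ =>
      (ridgeRight η (Vᵀ * Matrix.of G) * (Vᵀ * Matrix.of G)) i j :=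
    .of_bounded (((continuous_ridgeRight V hη).matrix_mul
      (continuous_transpose_mul_of V)).matrix_elem i j) (√κ) fun _ =>
      (abs_le_sqrt_frobSq _ i j).trans (Real.sqrt_le_sqrt (frobSq_ridgeRight_mul_le _ hη))
  have h4 : PolyGrowth 0 fun G : Fin n → Fin s → ℝ =>
      if j = i then (ridgeInv η (Vᵀ * Matrix.of G) *ᵥ v) a else 0 := by
    split_ifs
    exacts [h1, .const 0]
  exact (h4.sub (h2.mul (polyGrowth_ridgeRight V hη i a))).sub (h3.mul h1)

theorem transpose_mul_of_add_smul_single (G : Fin n → Fin s → ℝ) (p : Fin n) (i : Fin s) (τ : ℝ) :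
    Vᵀ * Matrix.of (G + τ • (Pi.single p (Pi.single i 1) : Fin n → Fin s → ℝ)) =
      Vᵀ * Matrix.of G + τ • Matrix.vecMulVec (V p) (Pi.single i 1) := by
  have h : Matrix.of (Pi.single p (Pi.single i 1) : Fin n → Fin s → ℝ) =
      Matrix.vecMulVec (Pi.single p 1) (Pi.single i 1) := by
    ext q j
    by_cases hq : q = p
    · subst hq; simp [Matrix.vecMulVec_apply]
    · simp [hq, Matrix.vecMulVec_apply]
  rw [← Matrix.of_add_of, ← Matrix.smul_of, h, Matrix.mul_add, Matrix.mul_smul,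
    Matrix.mul_vecMulVec, Matrix.mulVec_single_one]
  rfl

theorem hasDerivAt_ridgeRight_single (hη : 0 < η) (G : Fin n → Fin s → ℝ) (p : Fin n)
    (i j : Fin s) (a : Fin κ) :
    HasDerivAt (fun τ : ℝ => ridgeRight η (Vᵀ * Matrix.of
      (G + τ • (Pi.single p (Pi.single i 1) : Fin n → Fin s → ℝ))) j a)
      (ridgeDeriv η (Vᵀ * Matrix.of G) i j a (V p)) 0 := by
  simp only [transpose_mul_of_add_smul_single]
  exact hasDerivAt_ridgeRight hη _ _ _ _ _

/-- Integration by parts in `κ - η tr S = tr (H X)`, where `S` and `X` are the regularised inverse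
and right inverse of `H = Vᵀ G`, bounds the expected trace of `S`, uniformly in `η`. -/
theorem integral_trace_ridgeInv_le (hη : 0 < η) (hV : Vᵀ * V = 1) :
    ((s : ℝ) - κ - 1) * ∫ G, (ridgeInv η (Vᵀ * Matrix.of G)).trace ∂Prog.gaussMeasure n s ≤ κ := by
  have hS : PolyGrowth 0 fun G : Fin n → Fin s → ℝ => (ridgeInv η (Vᵀ * Matrix.of G)).trace :=
    .sum _ fun a _ => polyGrowth_ridgeInv V hη a a
  have hparts : ∀ (p : Fin n) (i : Fin s) (a : Fin κ),
      ∫ G, G p i * ridgeRight η (Vᵀ * Matrix.of G) i a ∂Prog.gaussMeasure n s =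
        ∫ G, ridgeDeriv η (Vᵀ * Matrix.of G) i i a (V p) ∂Prog.gaussMeasure n s := fun p i a =>
    integral_entry_mul_gaussMeasure p i ((polyGrowth_ridgeRight V hη i a).integrable (by norm_num))
      (((PolyGrowth.entry p i).mul (polyGrowth_ridgeRight V hη i a)).integrable (by norm_num))
      ((polyGrowth_ridgeDeriv V hη i i a (V p)).integrable (by norm_num))
      fun G => hasDerivAt_ridgeRight_single V hη G p i i a
  have hl : ∀ G : Fin n → Fin s → ℝ, ∑ i, ∑ a, ∑ p, V p a *
      (G p i * ridgeRight η (Vᵀ * Matrix.of G) i a) =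
        κ - η * (ridgeInv η (Vᵀ * Matrix.of G)).trace := by
    intro G
    rw [← trace_mul_ridgeRight _ hη, Matrix.trace, Finset.sum_comm]
    refine Finset.sum_congr rfl fun a _ => ?_
    rw [Matrix.diag_apply, Matrix.mul_apply]
    refine Finset.sum_congr rfl fun i _ => ?_
    rw [Matrix.mul_apply, Finset.sum_mul]
    exact Finset.sum_congr rfl fun p _ => (mul_assoc _ _ _).symm
  have hr : ∀ G : Fin n → Fin s → ℝ, ((s : ℝ) - κ - 1) * (ridgeInv η (Vᵀ * Matrix.of G)).trace ≤
      ∑ i, ∑ a, ∑ p, V p a * ridgeDeriv η (Vᵀ * Matrix.of G) i i a (V p) := by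
    intro G
    set H := Vᵀ * Matrix.of G with hH
    have h1 : ∀ i a, ∑ p, V p a * ridgeDeriv η H i i a (V p) = ridgeInv η H a a -
        ridgeRight η H i a ^ 2 - (ridgeRight η H * H) i i * ridgeInv η H a a := by
      intro i a
      have he : Vᵀ *ᵥ (fun p => V p a) = Pi.single a 1 := by
        have : (fun p => V p a) = V *ᵥ Pi.single a 1 := by
          rw [Matrix.mulVec_single_one]; rfl
        rw [this, Matrix.mulVec_mulVec, hV, Matrix.one_mulVec]
      rw [sum_mul_ridgeDeriv η H i i a (fun p => V p a) V, he]
      simp only [ridgeDeriv, Matrix.mulVec_single_one, if_true, Matrix.col_apply]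
      ring
    have h2 : ∑ i, ∑ a, (ridgeInv η H a a - ridgeRight η H i a ^ 2 -
        (ridgeRight η H * H) i i * ridgeInv η H a a) = s * (ridgeInv η H).trace -
        frobSq (ridgeRight η H) - (ridgeRight η H * H).trace * (ridgeInv η H).trace := by
      simp only [Finset.sum_sub_distrib, Matrix.trace, frobSq, Matrix.diag_apply,
        Finset.sum_mul_sum]
      simp
    simp only [h1]
    rw [h2, Matrix.trace_mul_comm, trace_mul_ridgeRight H hη]
    nlinarith [frobSq_ridgeRight_le H hη, mul_nonneg hη.le (sq_nonneg (ridgeInv η H).trace)]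
  have hint1 : ∀ i a p, Integrable (fun G : Fin n → Fin s → ℝ => V p a *
      (G p i * ridgeRight η (Vᵀ * Matrix.of G) i a)) (Prog.gaussMeasure n s) := fun i a p =>
    (((PolyGrowth.entry p i).mul (polyGrowth_ridgeRight V hη i a)).const_mul _).integrable
      (by norm_num)
  have hint2 : ∀ i a p, Integrable (fun G : Fin n → Fin s → ℝ => V p a *
      ridgeDeriv η (Vᵀ * Matrix.of G) i i a (V p)) (Prog.gaussMeasure n s) := fun i a p =>
    ((polyGrowth_ridgeDeriv V hη i i a (V p)).const_mul _).integrable (by norm_num)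
  have heq : ∫ G, ∑ i, ∑ a, ∑ p, V p a * (G p i * ridgeRight η (Vᵀ * Matrix.of G) i a)
      ∂Prog.gaussMeasure n s = ∫ G, ∑ i, ∑ a, ∑ p, V p a *
        ridgeDeriv η (Vᵀ * Matrix.of G) i i a (V p) ∂Prog.gaussMeasure n s := by
    rw [integral_finsetSum _ fun i _ => integrable_finsetSum _ fun a _ =>
      integrable_finsetSum _ fun p _ => hint1 i a p, integral_finsetSum _ fun i _ =>
      integrable_finsetSum _ fun a _ => integrable_finsetSum _ fun p _ => hint2 i a p]
    refine Finset.sum_congr rfl fun i _ => ?_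
    rw [integral_finsetSum _ fun a _ => integrable_finsetSum _ fun p _ => hint1 i a p,
      integral_finsetSum _ fun a _ => integrable_finsetSum _ fun p _ => hint2 i a p]
    refine Finset.sum_congr rfl fun a _ => ?_
    rw [integral_finsetSum _ fun p _ => hint1 i a p, integral_finsetSum _ fun p _ => hint2 i a p]
    refine Finset.sum_congr rfl fun p _ => ?_
    rw [integral_const_mul, integral_const_mul, hparts]
  rw [← integral_const_mul]
  calc _ ≤ ∫ G, ∑ i, ∑ a, ∑ p, V p a * ridgeDeriv η (Vᵀ * Matrix.of G) i i a (V p)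
        ∂Prog.gaussMeasure n s :=
        integral_mono ((hS.const_mul _).integrable (by norm_num)) (integrable_finsetSum _ fun i _ =>
          integrable_finsetSum _ fun a _ => integrable_finsetSum _ fun p _ => hint2 i a p) hr
    _ = ∫ G, (κ - η * (ridgeInv η (Vᵀ * Matrix.of G)).trace) ∂Prog.gaussMeasure n s := by
        rw [← heq]; simp only [hl]
    _ ≤ ∫ _, (κ : ℝ) ∂Prog.gaussMeasure n s := by
        refine integral_mono (((integrable_const _)).sub ((hS.const_mul η).integrable (by norm_num)))
          (integrable_const _) fun G => ?_
        have := mul_nonneg hη.le (trace_ridgeInv_nonneg (Vᵀ * Matrix.of G) hη)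
        show _ - _ ≤ _
        linarith
    _ = κ := by simp

/-- If the rows of `N` are orthogonal to the columns of `V`, then `N G` and the regularised right
inverse of `Vᵀ G` behave in mean square like independent matrices. -/
theorem integral_frobSq_mul_ridgeRight (hη : 0 < η) (N : Matrix (Fin m) (Fin n) ℝ)
    (hN : N * V = 0) :
    ∫ G, frobSq (N * Matrix.of G * ridgeRight η (Vᵀ * Matrix.of G)) ∂Prog.gaussMeasure n s =
      frobSq N * ∫ G, frobSq (ridgeRight η (Vᵀ * Matrix.of G)) ∂Prog.gaussMeasure n s := by
  set X : (Fin n → Fin s → ℝ) → Matrix (Fin s) (Fin κ) ℝ := fun G =>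
    ridgeRight η (Vᵀ * Matrix.of G) with hX
  set φ : Fin m → Fin s → (Fin n → Fin s → ℝ) → ℝ := fun b i G =>
    ∑ j, ∑ a, (N * Matrix.of G) b j * (X G j a * X G i a) with hφ
  have hXg : ∀ i a, PolyGrowth 0 fun G => X G i a := polyGrowth_ridgeRight V hη
  have hNG : ∀ b j, PolyGrowth 1 fun G : Fin n → Fin s → ℝ => (N * Matrix.of G) b j := fun b j =>
    .sum Finset.univ fun q _ => (PolyGrowth.entry q j).const_mul (N b q)
  have hφg : ∀ b i, PolyGrowth 1 (φ b i) := fun b i =>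
    .sum _ fun j _ => .sum _ fun a _ => (hNG b j).mul ((hXg j a).mul (hXg i a))
  set φ' : Fin m → Fin s → Fin n → (Fin n → Fin s → ℝ) → ℝ := fun b i p G =>
    ∑ j, ∑ a, (N b p * Pi.single (M := fun _ => ℝ) i 1 j * (X G j a * X G i a) +
      (N * Matrix.of G) b j * (ridgeDeriv η (Vᵀ * Matrix.of G) i j a (V p) * X G i a +
        X G j a * ridgeDeriv η (Vᵀ * Matrix.of G) i i a (V p))) with hφ'
  have hφ'g : ∀ b i p, PolyGrowth 1 (φ' b i p) := fun b i p =>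
    .sum _ fun j _ => .sum _ fun a _ =>
      ((((hXg j a).mul (hXg i a)).const_mul _).mono (Nat.zero_le 1)).add
        ((hNG b j).mul (((polyGrowth_ridgeDeriv V hη i j a (V p)).mul (hXg i a)).add
          ((hXg j a).mul (polyGrowth_ridgeDeriv V hη i i a (V p)))))
  have hd : ∀ b i p (G : Fin n → Fin s → ℝ), HasDerivAt (fun τ : ℝ =>
      φ b i (G + τ • (Pi.single p (Pi.single i 1) : Fin n → Fin s → ℝ))) (φ' b i p G) 0 := by
    intro b i p G
    have hx : ∀ j a, HasDerivAt (fun τ : ℝ =>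
        X (G + τ • (Pi.single p (Pi.single i 1) : Fin n → Fin s → ℝ)) j a)
        (ridgeDeriv η (Vᵀ * Matrix.of G) i j a (V p)) 0 := fun j a =>
      hasDerivAt_ridgeRight_single V hη G p i j a
    have hn : ∀ j, HasDerivAt (fun τ : ℝ => (N * Matrix.of
        (G + τ • (Pi.single p (Pi.single i 1) : Fin n → Fin s → ℝ))) b j)
        (N b p * Pi.single (M := fun _ => ℝ) i 1 j) 0 := by
      intro j
      have h1 : ∀ τ : ℝ, (N * Matrix.of
          (G + τ • (Pi.single p (Pi.single i 1) : Fin n → Fin s → ℝ))) b j =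
          (N * Matrix.of G) b j + τ * (N b p * Pi.single (M := fun _ => ℝ) i 1 j) := by
        intro τ
        have := transpose_mul_of_add_smul_single Nᵀ G p i τ
        rw [Matrix.transpose_transpose] at this
        rw [this]
        rfl
      simp only [h1]
      have := ((hasDerivAt_id (0 : ℝ)).mul_const
        (N b p * Pi.single (M := fun _ => ℝ) i 1 j)).const_add ((N * Matrix.of G) b j)
      rwa [one_mul] at this
    have h := HasDerivAt.fun_sum (u := Finset.univ) fun j _ =>
      HasDerivAt.fun_sum (u := Finset.univ) fun a _ => (hn j).mul ((hx j a).mul (hx i a))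
    refine HasDerivAt.congr_deriv (f := fun τ : ℝ =>
      φ b i (G + τ • (Pi.single p (Pi.single i 1) : Fin n → Fin s → ℝ))) h ?_
    simp only [zero_smul, add_zero, Pi.mul_apply, hφ']
  have hparts : ∀ b i p, ∫ G, G p i * φ b i G ∂Prog.gaussMeasure n s =
      ∫ G, φ' b i p G ∂Prog.gaussMeasure n s := fun b i p =>
    integral_entry_mul_gaussMeasure p i ((hφg b i).integrable (by norm_num))
      (((PolyGrowth.entry p i).mul (hφg b i)).integrable (by norm_num))
      ((hφ'g b i p).integrable (by norm_num)) (hd b i p)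
  have hl : ∀ G, frobSq (N * Matrix.of G * X G) = ∑ b, ∑ i, ∑ p, N b p * (G p i * φ b i G) := by
    intro G
    rw [frobSq]
    refine Finset.sum_congr rfl fun b _ => ?_
    have h1 : ∀ i, ∑ p, N b p * (G p i * φ b i G) = (N * Matrix.of G) b i * φ b i G := by
      intro i
      rw [Matrix.mul_apply, Finset.sum_mul]
      exact Finset.sum_congr rfl fun p _ => (mul_assoc _ _ _).symm
    rw [Finset.sum_congr rfl fun i _ => h1 i]
    simp only [hφ, Finset.mul_sum]
    have h2 : ∀ a, (N * Matrix.of G * X G) b a ^ 2 =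
        ∑ i, ∑ j, (N * Matrix.of G) b i * ((N * Matrix.of G) b j * (X G j a * X G i a)) := by
      intro a
      rw [sq, Matrix.mul_apply, Finset.sum_mul_sum]
      exact Finset.sum_congr rfl fun i _ => Finset.sum_congr rfl fun j _ => by ring
    simp only [h2]
    rw [Finset.sum_comm]
    exact Finset.sum_congr rfl fun i _ => Finset.sum_comm
  have hr : ∀ G, ∑ b, ∑ i, ∑ p, N b p * φ' b i p G = frobSq N * frobSq (X G) := by
    intro G
    have hNV : ∀ b, Vᵀ *ᵥ (N b) = 0 := by
      intro b
      funext a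
      have := congrFun (congrFun hN b) a
      rw [Matrix.mul_apply] at this
      simp only [Matrix.mulVec, dotProduct, Matrix.transpose_apply]
      simpa [mul_comm] using this
    have hz : ∀ b i j a, ∑ p, N b p * ridgeDeriv η (Vᵀ * Matrix.of G) i j a (V p) = 0 := by
      intro b i j a
      rw [sum_mul_ridgeDeriv, hNV]
      simp [ridgeDeriv]
    have h1 : ∀ b i, ∑ p, N b p * φ' b i p G = (∑ p, N b p ^ 2) * ∑ a, X G i a ^ 2 := by
      intro b i
      have h2 : ∀ p, N b p * φ' b i p G = N b p ^ 2 * ∑ a, X G i a ^ 2 +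
          ∑ j, ∑ a, (((N * Matrix.of G) b j * X G i a) *
            (N b p * ridgeDeriv η (Vᵀ * Matrix.of G) i j a (V p)) +
            ((N * Matrix.of G) b j * X G j a) *
              (N b p * ridgeDeriv η (Vᵀ * Matrix.of G) i i a (V p))) := by
        intro p
        have h3 : N b p ^ 2 * ∑ a, X G i a ^ 2 =
            ∑ j, ∑ a, N b p ^ 2 * Pi.single (M := fun _ => ℝ) i 1 j * (X G j a * X G i a) := by
          rw [Finset.sum_eq_single i, Finset.mul_sum]
          · exact Finset.sum_congr rfl fun a _ => by simp [sq]
          · intro j _ hj; simp [hj]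
          · simp
        rw [h3, ← Finset.sum_add_distrib]
        simp only [hφ', Finset.mul_sum, ← Finset.sum_add_distrib]
        exact Finset.sum_congr rfl fun j _ => Finset.sum_congr rfl fun a _ => by ring
      simp only [h2]
      rw [Finset.sum_add_distrib, ← Finset.sum_mul, Finset.sum_comm, add_eq_left]
      refine Finset.sum_eq_zero fun j _ => ?_
      rw [Finset.sum_comm]
      refine Finset.sum_eq_zero fun a _ => ?_
      rw [Finset.sum_add_distrib, ← Finset.mul_sum, ← Finset.mul_sum, hz, hz, mul_zero, mul_zero,
        add_zero]
    simp only [h1]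
    rw [frobSq, frobSq, Finset.sum_mul_sum]
  have hint1 : ∀ b i p, Integrable (fun G => N b p * (G p i * φ b i G))
      (Prog.gaussMeasure n s) := fun b i p =>
    (((PolyGrowth.entry p i).mul (hφg b i)).const_mul _).integrable (by norm_num)
  have hint2 : ∀ b i p, Integrable (fun G => N b p * φ' b i p G) (Prog.gaussMeasure n s) :=
    fun b i p => ((hφ'g b i p).const_mul _).integrable (by norm_num)
  rw [← integral_const_mul]
  show ∫ G, frobSq (N * Matrix.of G * X G) ∂_ = ∫ G, frobSq N * frobSq (X G) ∂_
  simp only [hl, ← hr]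
  rw [integral_finsetSum _ fun b _ => integrable_finsetSum _ fun i _ =>
    integrable_finsetSum _ fun p _ => hint1 b i p, integral_finsetSum _ fun b _ =>
    integrable_finsetSum _ fun i _ => integrable_finsetSum _ fun p _ => hint2 b i p]
  refine Finset.sum_congr rfl fun b _ => ?_
  rw [integral_finsetSum _ fun i _ => integrable_finsetSum _ fun p _ => hint1 b i p,
    integral_finsetSum _ fun i _ => integrable_finsetSum _ fun p _ => hint2 b i p]
  refine Finset.sum_congr rfl fun i _ => ?_
  rw [integral_finsetSum _ fun p _ => hint1 b i p, integral_finsetSum _ fun p _ => hint2 b i p]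
  refine Finset.sum_congr rfl fun p _ => ?_
  rw [integral_const_mul, integral_const_mul, hparts]

end RidgeExpectation

/-! ### The error of the randomised singular value decomposition -/

section SketchError

variable {m n s κ k ρ : ℕ}

theorem IsSVD.transpose_svdTrunc_mul_sub {A : Matrix (Fin m) (Fin n) ℝ}
    {U : Matrix (Fin m) (Fin ρ) ℝ} {σ : Fin ρ → ℝ} {V : Matrix (Fin n) (Fin ρ) ℝ}
    (h : IsSVD A U σ V) (k : ℕ) :
    (svdTrunc k U σ V)ᵀ * (A - svdTrunc k U σ V) = 0 := by
  have h1 : A - svdTrunc k U σ V =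
      U * Matrix.diagonal (fun i : Fin ρ => σ i - if (i : ℕ) < k then σ i else 0) * Vᵀ := by
    conv_lhs => rw [h.eq]
    rw [svdTrunc, ← Matrix.sub_mul, ← Matrix.mul_sub, Matrix.diagonal_sub]
  rw [h1, svdTrunc]
  simp only [Matrix.transpose_mul, Matrix.transpose_transpose, Matrix.diagonal_transpose,
    Matrix.mul_assoc]
  rw [← Matrix.mul_assoc Uᵀ, h.orth_left, Matrix.one_mul, ← Matrix.mul_assoc (Matrix.diagonal _),
    Matrix.diagonal_mul_diagonal]
  have h2 : (fun i : Fin ρ => (if (i : ℕ) < k then σ i else 0) *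
      (σ i - if (i : ℕ) < k then σ i else 0)) = fun _ => 0 := by
    funext i
    split_ifs <;> simp
  rw [h2]
  simp

/-- An upper bound for the excess of the squared error of the approximate singular value
decomposition over the optimal one, as a function of the sketching matrix; here the columns of `V₁`
are the top right singular vectors. -/
noncomputable def sketchExcess (η : ℝ) (A : Matrix (Fin m) (Fin n) ℝ)
    (V₁ : Matrix (Fin n) (Fin κ) ℝ) (G : Fin n → Fin s → ℝ) : ℝ :=
  frobSq ((A - A * V₁ * V₁ᵀ) * Matrix.of G * ridgeRight η (V₁ᵀ * Matrix.of G)) +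
    η * frobSq A * (ridgeInv η (V₁ᵀ * Matrix.of G)).trace

variable {η : ℝ} {A : Matrix (Fin m) (Fin n) ℝ} {V₁ : Matrix (Fin n) (Fin κ) ℝ}

theorem sketchExcess_nonneg (hη : 0 < η) (G : Fin n → Fin s → ℝ) : 0 ≤ sketchExcess η A V₁ G :=
  add_nonneg (frobSq_nonneg _)
    (mul_nonneg (mul_nonneg hη.le (frobSq_nonneg _)) (trace_ridgeInv_nonneg _ hη))

/-- The projection to the range of the sketch competes with the matrix `A G X V₁ᵀ`, where `X` is
the regularised right inverse of `V₁ᵀ G`. -/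
theorem IsSketchSVD.frobSq_sub_le {G : Fin n → Fin s → ℝ} {U US : Matrix (Fin m) (Fin k) ℝ}
    {V : Matrix (Fin n) (Fin k) ℝ} (h : IsSketchSVD A (Matrix.of G) U US V) (hη : 0 < η)
    (hκ : κ ≤ k) (hV : V₁ᵀ * V₁ = 1) (hAV : (A * V₁)ᵀ * (A - A * V₁ * V₁ᵀ) = 0) :
    frobSq (A - A * (V * Vᵀ)) ≤ frobSq (A - A * V₁ * V₁ᵀ) + sketchExcess η A V₁ G := by
  set N := A - A * V₁ * V₁ᵀ with hN
  set S := ridgeInv η (V₁ᵀ * Matrix.of G) with hS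
  set X := ridgeRight η (V₁ᵀ * Matrix.of G) with hX
  refine (h.frobSq_le κ V₁ X hκ hV).trans ?_
  have hNV : N * V₁ = 0 := by
    rw [hN, Matrix.sub_mul, Matrix.mul_assoc _ V₁ᵀ, hV, Matrix.mul_one, sub_self]
  have h1 : A * Matrix.of G * X = N * Matrix.of G * X + (A * V₁ - A * V₁ * (η • S)) := by
    have h2 := mul_ridgeRight (V₁ᵀ * Matrix.of G) hη
    have h3 : A * V₁ * V₁ᵀ * Matrix.of G * X = A * V₁ - A * V₁ * (η • S) := by
      rw [Matrix.mul_assoc _ V₁ᵀ, Matrix.mul_assoc, h2, Matrix.mul_sub, Matrix.mul_one]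
    rw [← h3, hN, Matrix.sub_mul, Matrix.sub_mul, sub_add_cancel]
  have h4 : A - A * Matrix.of G * X * V₁ᵀ =
      N + (A * V₁ * (η • S) + -(N * Matrix.of G * X)) * V₁ᵀ := by
    rw [h1, hN]
    simp only [Matrix.add_mul, Matrix.sub_mul, Matrix.neg_mul]
    abel
  have h5 : N * ((A * V₁ * (η • S) + -(N * Matrix.of G * X)) * V₁ᵀ)ᵀ = 0 := by
    rw [Matrix.transpose_mul, Matrix.transpose_transpose, ← Matrix.mul_assoc, hNV, Matrix.zero_mul]
  have h6 : (A * V₁ * (η • S))ᵀ * -(N * Matrix.of G * X) = 0 := by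
    rw [Matrix.transpose_mul, Matrix.mul_neg, Matrix.mul_assoc, Matrix.mul_assoc,
      ← Matrix.mul_assoc _ N, hAV, Matrix.zero_mul, Matrix.mul_zero, neg_zero]
  rw [h4, frobSq_add_of_right h5, frobSq_mul_orth hV, frobSq_add_of_left h6, frobSq_neg]
  have h7 : frobSq (A * V₁ * (η • S)) ≤ η * frobSq A * S.trace := by
    have h8 : frobSq (η • S) = η * (η * frobSq S) := by
      simp only [frobSq, Matrix.smul_apply, smul_eq_mul, mul_pow, Finset.mul_sum]
      exact Finset.sum_congr rfl fun i _ => Finset.sum_congr rfl fun j _ => by ring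
    calc frobSq (A * V₁ * (η • S)) ≤ frobSq (A * V₁) * frobSq (η • S) := frobSq_mul_le _ _
      _ ≤ frobSq A * (η * S.trace) := by
          refine mul_le_mul (frobSq_mul_orth_le hV A) ?_ (frobSq_nonneg _) (frobSq_nonneg _)
          rw [h8]
          exact mul_le_mul_of_nonneg_left (frobSq_ridgeInv_le _ hη) hη.le
      _ = η * frobSq A * S.trace := by ring
  rw [sketchExcess]
  linarith

theorem polyGrowth_sketchExcess (hη : 0 < η) (A : Matrix (Fin m) (Fin n) ℝ)
    (V₁ : Matrix (Fin n) (Fin κ) ℝ) :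
    PolyGrowth 2 fun G : Fin n → Fin s → ℝ => sketchExcess η A V₁ G := by
  have h1 : ∀ b a, PolyGrowth 1 fun G : Fin n → Fin s → ℝ =>
      ((A - A * V₁ * V₁ᵀ) * Matrix.of G * ridgeRight η (V₁ᵀ * Matrix.of G)) b a := by
    intro b a
    have h2 : ∀ j, PolyGrowth 1 fun G : Fin n → Fin s → ℝ =>
        ((A - A * V₁ * V₁ᵀ) * Matrix.of G) b j := fun j =>
      .sum Finset.univ fun q _ => (PolyGrowth.entry q j).const_mul ((A - A * V₁ * V₁ᵀ) b q)
    exact .sum Finset.univ fun j _ => (h2 j).mul (polyGrowth_ridgeRight V₁ hη j a)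
  refine PolyGrowth.add ?_ (PolyGrowth.const_mul (η * frobSq A) (PolyGrowth.mono (d := 0)
    (.sum Finset.univ fun a _ => polyGrowth_ridgeInv V₁ hη a a) (Nat.zero_le 2)))
  simp only [frobSq, sq]
  exact .sum Finset.univ fun b _ => .sum Finset.univ fun a _ => (h1 b a).mul (h1 b a)

theorem integral_sketchExcess_le (hη : 0 < η) (hV : V₁ᵀ * V₁ = 1) (hs : κ + 1 < s) :
    ∫ G, sketchExcess η A V₁ G ∂Prog.gaussMeasure n s ≤
      (frobSq (A - A * V₁ * V₁ᵀ) + η * frobSq A) * (κ / ((s : ℝ) - κ - 1)) := by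
  have hs' : (0 : ℝ) < (s : ℝ) - κ - 1 := by
    have : ((κ + 1 : ℕ) : ℝ) < s := by exact_mod_cast hs
    push_cast at this
    linarith
  set N := A - A * V₁ * V₁ᵀ with hN
  have hNV : N * V₁ = 0 := by
    rw [hN, Matrix.sub_mul, Matrix.mul_assoc _ V₁ᵀ, hV, Matrix.mul_one, sub_self]
  have hS : PolyGrowth 0 fun G : Fin n → Fin s → ℝ => (ridgeInv η (V₁ᵀ * Matrix.of G)).trace :=
    .sum Finset.univ fun a _ => polyGrowth_ridgeInv V₁ hη a a
  have hX : PolyGrowth 0 fun G : Fin n → Fin s → ℝ => frobSq (ridgeRight η (V₁ᵀ * Matrix.of G)) := by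
    simp only [frobSq, sq]
    exact .sum Finset.univ fun i _ => .sum Finset.univ fun a _ =>
      (polyGrowth_ridgeRight V₁ hη i a).mul (polyGrowth_ridgeRight V₁ hη i a)
  have hSi := hS.integrable (by norm_num)
  have h2 : Integrable (fun G : Fin n → Fin s → ℝ =>
      η * frobSq A * (ridgeInv η (V₁ᵀ * Matrix.of G)).trace) (Prog.gaussMeasure n s) :=
    hSi.const_mul _
  have h1 : Integrable (fun G : Fin n → Fin s → ℝ =>
      frobSq (N * Matrix.of G * ridgeRight η (V₁ᵀ * Matrix.of G))) (Prog.gaussMeasure n s) := by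
    refine (((polyGrowth_sketchExcess hη A V₁).integrable le_rfl).sub h2).congr
      (Filter.Eventually.of_forall fun G => ?_)
    simp [sketchExcess, hN]
  have h3 : ∫ G, (ridgeInv η (V₁ᵀ * Matrix.of G)).trace ∂Prog.gaussMeasure n s ≤
      κ / ((s : ℝ) - κ - 1) := by
    rw [le_div_iff₀' hs']
    exact integral_trace_ridgeInv_le V₁ hη hV
  have h4 : ∫ G, frobSq (ridgeRight η (V₁ᵀ * Matrix.of G)) ∂Prog.gaussMeasure n s ≤
      κ / ((s : ℝ) - κ - 1) :=
    (integral_mono (hX.integrable (by norm_num)) hSi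
      fun G => frobSq_ridgeRight_le _ hη).trans h3
  simp only [sketchExcess]
  rw [integral_add h1 h2, integral_const_mul, integral_frobSq_mul_ridgeRight V₁ hη N hNV, add_mul]
  exact add_le_add (mul_le_mul_of_nonneg_left h4 (frobSq_nonneg _))
    (mul_le_mul_of_nonneg_left h3 (mul_nonneg hη.le (frobSq_nonneg _)))

end SketchError

/-! ### The expected error for a given sketch -/

section CURError

variable {m n : ℕ}

theorem IsMoorePenrose.mul_eq {p q : ℕ} {A : Matrix (Fin p) (Fin q) ℝ}
    {X Y : Matrix (Fin q) (Fin p) ℝ} (hX : IsMoorePenrose A X) (hY : IsMoorePenrose A Y) :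
    A * X = A * Y := by
  have h1 : A * X * (A * Y) = A * Y := by rw [← Matrix.mul_assoc, hX.mul_mul_self]
  have h2 : A * Y * (A * X) = A * X := by rw [← Matrix.mul_assoc, hY.mul_mul_self]
  have h3 := congrArg Matrix.transpose h1
  rw [Matrix.transpose_mul, hY.symm_left, hX.symm_left] at h3
  exact h2.symm.trans h3

/-- The orthogonal projection `C C†` to the span of the columns of `A` with indices in `J`. -/
noncomputable def colProj (A : Matrix (Fin m) (Fin n) ℝ) (J : List (Fin n)) :
    Matrix (Fin m) (Fin m) ℝ :=
  selectCols A J * (exists_isMoorePenrose (selectCols A J)).choose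

theorem isOrthProj_colProj (A : Matrix (Fin m) (Fin n) ℝ) (J : List (Fin n)) :
    IsOrthProj (colProj A J) :=
  (exists_isMoorePenrose (selectCols A J)).choose_spec.isOrthProj

theorem fixesCols_colProj (A : Matrix (Fin m) (Fin n) ℝ) (J : List (Fin n)) :
    FixesCols (colProj A J) A J :=
  (exists_isMoorePenrose (selectCols A J)).choose_spec.fixesCols

theorem trace_colProj_le (A : Matrix (Fin m) (Fin n) ℝ) (J : List (Fin n)) :
    (colProj A J).trace ≤ J.length :=
  (exists_isMoorePenrose (selectCols A J)).choose_spec.trace_le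

theorem IsMoorePenrose.mul_eq_colProj {A : Matrix (Fin m) (Fin n) ℝ} {J : List (Fin n)}
    {X : Matrix (Fin J.length) (Fin m) ℝ} (h : IsMoorePenrose (selectCols A J) X) :
    selectCols A J * X = colProj A J :=
  h.mul_eq (exists_isMoorePenrose (selectCols A J)).choose_spec

theorem IsMoorePenrose.mul_eq_rowProj {A : Matrix (Fin m) (Fin n) ℝ} {I : List (Fin m)}
    {Y : Matrix (Fin n) (Fin I.length) ℝ} (h : IsMoorePenrose (selectRows A I) Y) :
    Y * selectRows A I = colProj Aᵀ I := by
  have h1 : IsMoorePenrose (selectCols Aᵀ I) Yᵀ := h.transpose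
  have h2 := congrArg Matrix.transpose h1.mul_eq_colProj
  rw [Matrix.transpose_mul, (isOrthProj_colProj Aᵀ I).symm, Matrix.transpose_transpose] at h2
  exact h2

theorem frobSq_sub_mul_mul {P : Matrix (Fin m) (Fin m) ℝ} {Q : Matrix (Fin n) (Fin n) ℝ}
    (hP : IsOrthProj P) (hQ : IsOrthProj Q) (A : Matrix (Fin m) (Fin n) ℝ) :
    frobSq (A - P * A * Q) = frobSq ((Aᵀ - Q * Aᵀ) * P) + frobSq (A - P * A) := by
  have h1 : A - P * A * Q = P * (A - A * Q) + (A - P * A) := by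
    rw [Matrix.mul_sub, Matrix.mul_assoc]; abel
  have h2 : (Aᵀ - Q * Aᵀ) * P = (P * (A - A * Q))ᵀ := by
    rw [Matrix.transpose_mul, Matrix.transpose_sub, Matrix.transpose_mul, hP.symm, hQ.symm]
  rw [h2, frobSq_transpose, h1, frobSq_add_of_left (hP.transpose_mul_sub A _)]

theorem frobSq_sub_colProj_le {κ : ℕ} {P : Matrix (Fin m) (Fin m) ℝ} (hP : IsOrthProj P)
    (A : Matrix (Fin m) (Fin n) ℝ) {V₁ : Matrix (Fin n) (Fin κ) ℝ} (hV : V₁ᵀ * V₁ = 1) :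
    frobSq (A - P * A) ≤
      frobSq ((A - P * A) * (V₁ * V₁ᵀ)) + frobSq (A - A * V₁ * V₁ᵀ) := by
  have hT : P * (P * A * (V₁ * V₁ᵀ)) = P * A * (V₁ * V₁ᵀ) := by
    rw [← Matrix.mul_assoc P, ← Matrix.mul_assoc P, hP.idem]
  refine (hP.frobSq_sub_le A hT).trans (le_of_eq ?_)
  have h1 : A - P * A * (V₁ * V₁ᵀ) = (A - P * A) * (V₁ * V₁ᵀ) + (A - A * V₁ * V₁ᵀ) := by
    rw [Matrix.sub_mul, Matrix.mul_assoc A]; abel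
  rw [h1, frobSq_add_of_right]
  have hW := IsOrthProj.of_orth hV
  rw [Matrix.mul_assoc A, Matrix.transpose_sub, Matrix.transpose_mul, hW.symm, Matrix.mul_assoc,
    Matrix.mul_sub, ← Matrix.mul_assoc _ _ Aᵀ, hW.idem, sub_self, Matrix.mul_zero]

/-- With `16 k θ²` iterations the dual set sparsification distorts the Frobenius norm by a factor
of at most `1 + 1 / θ`. -/
theorem dualSet_factor_le {k θ : ℕ} (hk : 0 < k) (hθ : 0 < θ) :
    1 / (1 - √((k : ℝ) / (16 * k * θ ^ 2 : ℕ))) ^ 2 ≤ 1 + 1 / (θ : ℝ) := by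
  have hk' : (0 : ℝ) < k := by exact_mod_cast hk
  have hθ' : (1 : ℝ) ≤ θ := by exact_mod_cast hθ
  have h1 : √((k : ℝ) / (16 * k * θ ^ 2 : ℕ)) = (1 / θ) / 4 := by
    rw [Real.sqrt_eq_iff_mul_self_eq (by positivity) (by positivity)]
    push_cast
    field_simp
    norm_num
  rw [h1]
  have hx0 : 0 < 1 / (θ : ℝ) := by positivity
  have hx1 : 1 / (θ : ℝ) ≤ 1 := by rw [div_le_one (by linarith)]; exact hθ'
  generalize 1 / (θ : ℝ) = x at hx0 hx1
  have h2 : 0 < 1 - x / 4 := by linarith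
  rw [div_le_iff₀ (by positivity)]
  have h3 : (1 + x) * (1 - x / 4) ^ 2 - 1 = x * (1 - x) / 2 + x ^ 2 * (1 + x) / 16 := by ring
  nlinarith [mul_nonneg hx0.le (sub_nonneg.2 hx1), mul_nonneg (sq_nonneg x) (by linarith : 0 ≤ 1 + x)]

/-- The squared error to which the adaptive sampling is applied, when the optimal squared error is
`N` and the approximate singular value decomposition exceeds it by `y`. -/
theorem residual_bound {θ e N y κ b : ℝ} (hθ : 1 ≤ θ) (hN : 0 ≤ N) (hy : 0 ≤ y) (he : e ≤ N + y)
    (he0 : 0 ≤ e) (hb : b ≤ y) (hκ : κ ≤ 1 + 1 / θ) :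
    e + (1 + 1 / (1 / θ)) * b + (1 + 1 / θ) * (κ * e) ≤ (2 + 3 / θ) * N + (θ + 6) * y := by
  have hx1 : 1 / θ ≤ 1 := by rw [div_le_one (by linarith)]; exact hθ
  have hx0 : 0 < 1 / θ := by positivity
  have h3 : 3 / θ = 3 * (1 / θ) := by ring
  rw [one_div_one_div, h3]
  generalize 1 / θ = x at *
  have h1 : κ * e ≤ (1 + x) * (N + y) :=
    (mul_le_mul_of_nonneg_right hκ he0).trans (mul_le_mul_of_nonneg_left he (by linarith))
  have h2 : (1 + x) * (κ * e) ≤ (1 + 3 * x) * (N + y) := by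
    refine (mul_le_mul_of_nonneg_left h1 (by linarith)).trans ?_
    rw [← mul_assoc]
    exact mul_le_mul_of_nonneg_right (by nlinarith) (by linarith)
  have h4 : (1 + θ) * b ≤ (1 + θ) * y := mul_le_mul_of_nonneg_left hb (by linarith)
  nlinarith [mul_nonneg hy (sub_nonneg.2 hx1)]

/-- The fast CUR algorithm after the approximate singular value decomposition. -/
def curTailP {R : Type} {k : ℕ} (A E : Matrix (Fin m) (Fin n) R) (U : Matrix (Fin m) (Fin k) R)
    (V : Matrix (Fin n) (Fin k) R) (par : CURParams) : Prog R (CUROutput R m n) := do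
  let J ← selectP A E V par.c₁ par.c₂
  let I ← selectP Aᵀ Eᵀ U par.r₁ par.r₂
  let X ← pinvP (selectCols A J)
  let Y ← pinvP (selectRows A I)
  pure { cols := J, rows := I, Cdag := X, Rdag := Y }

theorem fastCURP_eq {R : Type} (A : Matrix (Fin m) (Fin n) R) (k : ℕ) (par : CURParams) :
    fastCURP A k par = gaussP n par.sketch >>= fun G => sketchSVDP A k G >>= fun p =>
      matMulP p.2.1 p.2.2ᵀ >>= fun Ak => matSubP A Ak >>= fun E =>
        curTailP A E p.1 p.2.2 par := rfl

theorem Prog.runs_curTailP {k : ℕ} (A E : Matrix (Fin m) (Fin n) ℝ) {U : Matrix (Fin m) (Fin k) ℝ}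
    {V : Matrix (Fin n) (Fin k) ℝ} {par : CURParams} (hk : 0 < k) (hkm : k ≤ m) (hkn : k ≤ n)
    (hU : Uᵀ * U = 1) (hV : Vᵀ * V = 1) (hc : k < par.c₁) (hr : k < par.r₁) :
    (curTailP A E U V par).Runs
      (60 * (par.c₁ * (n * k ^ 2)) + 13 * (m * par.c₁ ^ 2) + 20 * (m * n * par.c₁) + par.c₂ * n +
        (60 * (par.r₁ * (m * k ^ 2)) + 13 * (n * par.r₁ ^ 2) + 20 * (n * m * par.r₁) + par.r₂ * m +
        ((13 * (m * par.c ^ 2) + 2) + ((13 * (n * par.r ^ 2) + 2) + 0))))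
      fun out => out.cols.length ≤ par.c ∧ out.rows.length ≤ par.r ∧
        IsMoorePenrose (out.C A) out.Cdag ∧ IsMoorePenrose (out.R A) out.Rdag := by
  refine (runs_selectP A E par.c₂ (hk.trans_le hkm) hk hkn hV hc).bind fun J hJ =>
    (runs_selectP Aᵀ Eᵀ par.r₂ (hk.trans_le hkn) hk hkm hU hr).bind fun I hI =>
    (((runs_pinvP (selectCols A J)).of_le ?_).bind fun X hX =>
    ((runs_pinvP' (selectRows A I)).of_le ?_).bind fun Y hY => Runs.pure ⟨hJ, hI, hX, hY⟩)
  · have : m * J.length ^ 2 ≤ m * par.c ^ 2 := by gcongr; exact hJ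
    omega
  · have : n * I.length ^ 2 ≤ n * par.r ^ 2 := by gcongr; exact hI
    omega

end CURError

section CURExpectation

variable {m n k κ : ℕ}

theorem CUROutput.frobNorm_sub_le {A : Matrix (Fin m) (Fin n) ℝ} {out : CUROutput ℝ m n}
    (hC : IsMoorePenrose (out.C A) out.Cdag) (hR : IsMoorePenrose (out.R A) out.Rdag) {a : ℝ}
    (ha : 0 < a) :
    frobNorm (A - out.C A * out.U A * out.R A) ≤
      1 / (2 * a) * frobSq ((Aᵀ - colProj Aᵀ out.rows * Aᵀ) * colProj A out.cols) +
        (1 / (2 * a) * frobSq (A - colProj A out.cols * A) + a / 2) := by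
  have h1 : out.C A * out.U A * out.R A = colProj A out.cols * A * colProj Aᵀ out.rows := by
    have h2 : selectCols A out.cols * out.Cdag = _ := IsMoorePenrose.mul_eq_colProj hC
    have h3 : out.Rdag * selectRows A out.rows = _ := IsMoorePenrose.mul_eq_rowProj hR
    rw [← h2, ← h3, CUROutput.U, CUROutput.C, CUROutput.R]
    simp only [Matrix.mul_assoc]
  have h4 := frobSq_sub_mul_mul (isOrthProj_colProj A out.cols) (isOrthProj_colProj Aᵀ out.rows) A
  rw [← h1, ← frobNorm_sq] at h4
  generalize frobNorm (A - out.C A * out.U A * out.R A) = x at h4 ⊢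
  have h5 : x ≤ 1 / (2 * a) * x ^ 2 + a / 2 := by
    have : 1 / (2 * a) * x ^ 2 + a / 2 - x = (x - a) ^ 2 / (2 * a) := by field_simp; ring
    have h6 : 0 ≤ (x - a) ^ 2 / (2 * a) := by positivity
    linarith
  rw [h4] at h5
  linarith [mul_add (1 / (2 * a)) (frobSq ((Aᵀ - colProj Aᵀ out.rows * Aᵀ) * colProj A out.cols))
    (frobSq (A - colProj A out.cols * A))]

/-- The expected error, when the optimal squared error is `N` and the approximate singular value
decomposition exceeds it by at most `y`. The two steps of adaptive sampling contribute
`k / c₂` and `c / r₂` times the bound of `residual_bound`. The Frobenius norm is controlled by its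
square through the inequality `2 x ≤ x² / a + a`. -/
theorem Prog.expect_curTailP_le {A : Matrix (Fin m) (Fin n) ℝ} {s : ℕ}
    {G : Matrix (Fin n) (Fin s) ℝ} {U US : Matrix (Fin m) (Fin k) ℝ} {V : Matrix (Fin n) (Fin k) ℝ}
    (h : IsSketchSVD A G U US V) (hk : 0 < k) (hkm : k ≤ m) (hkn : k ≤ n) {θ : ℕ} (hθ : 0 < θ)
    {par : CURParams} (hc₁ : par.c₁ = 16 * k * θ ^ 2) (hr₁ : par.r₁ = 16 * k * θ ^ 2)
    (hc₂ : 0 < par.c₂) (hr₂ : 0 < par.r₂) {V₁ : Matrix (Fin n) (Fin κ) ℝ} (hκ : κ ≤ k)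
    (hV₁ : V₁ᵀ * V₁ = 1)
    (hEY : ∀ P : Matrix (Fin m) (Fin m) ℝ, IsOrthProj P → P.trace ≤ k →
      frobSq (A - A * V₁ * V₁ᵀ) ≤ frobSq (A - P * A))
    {y : ℝ} (hy : 0 ≤ y) (he : frobSq (A - A * (V * Vᵀ)) ≤ frobSq (A - A * V₁ * V₁ᵀ) + y)
    {a : ℝ} (ha : 0 < a) :
    (curTailP A (A - US * Vᵀ) U V par).expect
        (fun out => ENNReal.ofReal (frobNorm (A - out.C A * out.U A * out.R A))) ≤
      ENNReal.ofReal (1 / (2 * a) * (frobSq (A - A * V₁ * V₁ᵀ) +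
        ((k : ℝ) / par.c₂ + par.c / par.r₂) *
          ((2 + 3 / θ) * frobSq (A - A * V₁ * V₁ᵀ) + (θ + 6) * y)) + a / 2) := by
  set N := frobSq (A - A * V₁ * V₁ᵀ) with hN
  set Bd := (2 + 3 / (θ : ℝ)) * N + (θ + 6) * y with hBd
  set E := A - US * Vᵀ with hE
  have hθ' : (1 : ℝ) ≤ θ := by exact_mod_cast hθ
  have hN0 : 0 ≤ N := frobSq_nonneg _
  have hBd0 : 0 ≤ Bd := by positivity
  have hE' : E = A - A * (V * Vᵀ) := by rw [hE, h.eq_mul, Matrix.mul_assoc]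
  have ha' : 0 ≤ 1 / (2 * a) := by positivity
  have hkc : k < 16 * k * θ ^ 2 := by
    have : 0 < θ ^ 2 := by positivity
    nlinarith
  have hfac := dualSet_factor_le hk hθ
  have hcol : frobSq E + (1 + 1 / (1 / (θ : ℝ))) * frobSq (E * V) +
      (1 + 1 / (θ : ℝ)) * (1 / (1 - √((k : ℝ) / par.c₁)) ^ 2 * frobSq E) ≤ Bd := by
    have h1 : E * V = 0 := by
      rw [hE', Matrix.sub_mul, Matrix.mul_assoc A, Matrix.mul_assoc V, h.orth_right, Matrix.mul_one,
        sub_self]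
    rw [hc₁]
    refine residual_bound hθ' hN0 hy (hE' ▸ he) (frobSq_nonneg _) ?_ hfac
    rw [h1]
    simpa [frobSq] using hy
  have hrow : frobSq Eᵀ + (1 + 1 / (1 / (θ : ℝ))) * frobSq (Eᵀ * U) +
      (1 + 1 / (θ : ℝ)) * (1 / (1 - √((k : ℝ) / par.r₁)) ^ 2 * frobSq Eᵀ) ≤ Bd := by
    rw [hr₁, frobSq_transpose]
    refine residual_bound hθ' hN0 hy (hE' ▸ he) (frobSq_nonneg _) ?_ hfac
    -- what is left of `E` outside the range of `U` is no better than an optimal approximation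
    have h1 := frobSq_sub_mul_proj h.orth_left Eᵀ
    have h2 : Eᵀ - Eᵀ * (U * Uᵀ) = (A - U * Uᵀ * A)ᵀ := by
      rw [hE]
      simp only [Matrix.transpose_sub, Matrix.sub_mul, Matrix.transpose_mul,
        Matrix.transpose_transpose]
      have h3 : V * USᵀ * (U * Uᵀ) = V * USᵀ := by
        have h4 := congrArg Matrix.transpose h.mul_eq
        simp only [Matrix.transpose_mul, Matrix.transpose_transpose] at h4
        rw [Matrix.mul_assoc, h4]
      rw [h3]
      abel
    rw [h2, frobSq_transpose, frobSq_transpose, hE'] at h1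
    have h5 := hEY (U * Uᵀ) (IsOrthProj.of_orth h.orth_left) (trace_of_orth h.orth_left).le
    rw [hE']
    linarith
  have hAV : A = US * Vᵀ + E := by rw [hE]; abel
  have hAU : Aᵀ = V * USᵀ * U * Uᵀ + Eᵀ := by
    have h4 := congrArg Matrix.transpose h.mul_eq
    simp only [Matrix.transpose_mul, Matrix.transpose_transpose] at h4
    rw [hE, Matrix.transpose_sub, Matrix.transpose_mul, Matrix.transpose_transpose,
      Matrix.mul_assoc _ U, Matrix.mul_assoc V, h4]
    abel
  -- the expectation over the rows, for given columns
  have hinner : ∀ J : List (Fin n), J.length ≤ par.c →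
      (selectP Aᵀ Eᵀ U par.r₁ par.r₂ >>= fun I => pinvP (selectCols A J) >>= fun X =>
        pinvP (selectRows A I) >>= fun Y =>
        (pure { cols := J, rows := I, Cdag := X, Rdag := Y } : Prog ℝ (CUROutput ℝ m n))).expect
        (fun out => ENNReal.ofReal (frobNorm (A - out.C A * out.U A * out.R A))) ≤
      ENNReal.ofReal (1 / (2 * a) * frobSq ((A - colProj A J * A) * (V₁ * V₁ᵀ)) +
        (1 / (2 * a) * (par.c / par.r₂ * Bd + N) + a / 2)) := by
    intro J hJ
    refine (expect_bind _ _ _).le.trans ?_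
    have hP := isOrthProj_colProj A J
    have hstep : ∀ I, (pinvP (selectCols A J) >>= fun X => pinvP (selectRows A I) >>= fun Y =>
        (pure { cols := J, rows := I, Cdag := X, Rdag := Y } : Prog ℝ (CUROutput ℝ m n))).expect
        (fun out => ENNReal.ofReal (frobNorm (A - out.C A * out.U A * out.R A))) ≤
        ENNReal.ofReal (1 / (2 * a) * frobSq ((Aᵀ - colProj Aᵀ I * Aᵀ) * colProj A J) +
          (1 / (2 * a) * frobSq (A - colProj A J * A) + a / 2)) := fun I =>
      (runs_pinvP (selectCols A J)).expect_bind_le fun X hX =>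
        (runs_pinvP (selectRows A I)).expect_bind_le fun Y hY => ENNReal.ofReal_le_ofReal
          (CUROutput.frobNorm_sub_le (out := ⟨J, I, X, Y⟩) hX hY ha)
    refine (expect_selectP_le hk hkm h.orth_left (hr₁ ▸ hkc) hr₂ hAU (by positivity) hrow
      (isOrthProj_colProj Aᵀ) (fixesCols_colProj Aᵀ) hP ha'
      (add_nonneg (mul_nonneg ha' (frobSq_nonneg (A - colProj A J * A))) (by positivity))
      hstep).trans (ENNReal.ofReal_le_ofReal ?_)
    have h1 : (colProj A J).trace / par.r₂ * Bd ≤ par.c / par.r₂ * Bd := by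
      have h2 : (colProj A J).trace ≤ par.c :=
        (trace_colProj_le A J).trans (by exact_mod_cast hJ)
      gcongr
    have h3 := mul_le_mul_of_nonneg_left
      (add_le_add h1 (frobSq_sub_colProj_le hP A hV₁)) ha'
    linarith
  refine (expect_bind _ _ _).le.trans ?_
  set F : List (Fin n) → ℝ≥0∞ := fun J => ENNReal.ofReal
    (1 / (2 * a) * frobSq ((A - colProj A J * A) * (V₁ * V₁ᵀ)) +
        (1 / (2 * a) * (par.c / par.r₂ * Bd + N) + a / 2)) with hF
  refine (Always.expect_le (Q := fun J => J.length ≤ par.c) (g := F) hinner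
    (runs_selectP A E par.c₂ (hk.trans_le hkm) hk hkn h.orth_right (hc₁ ▸ hkc)).always).trans ?_
  refine (expect_selectP_le hk hkn h.orth_right (hc₁ ▸ hkc) hc₂ hAV (by positivity) hcol
    (isOrthProj_colProj A) (fixesCols_colProj A) (IsOrthProj.of_orth hV₁) ha' (by positivity)
    fun J => le_rfl).trans (ENNReal.ofReal_le_ofReal ?_)
  rw [trace_of_orth hV₁]
  have h1 : (κ : ℝ) / par.c₂ * Bd ≤ k / par.c₂ * Bd := by
    have h2 : (κ : ℝ) ≤ k := by exact_mod_cast hκ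
    gcongr
  have h3 := mul_le_mul_of_nonneg_left h1 ha'
  linarith

end CURExpectation

/-! ### The expected error of the fast CUR algorithm -/

section FastCUR

variable {m n k ρ : ℕ}

theorem cur_error_le {θ ε ν F Y η δ q : ℝ} (hθ : 1 ≤ θ) (hε : 0 < ε) (hν : 0 ≤ ν) (hδ : 0 ≤ δ)
    (hF : 0 ≤ F) (hη : 0 ≤ η) (hY : Y ≤ (ν ^ 2 + η * F) * (1 / θ ^ 2)) (hq0 : 0 ≤ q)
    (hq : q ≤ 2 * (ε / (2 + 10 / θ))) (hηF : 7 * ε * (η * F) ≤ δ ^ 2) :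
    ν ^ 2 + q * ((2 + 3 / θ) * ν ^ 2 + (θ + 6) * Y) ≤ ((1 + ε) * ν + δ) ^ 2 := by
  have hx0 : 0 < 1 / θ := by positivity
  have hx1 : 1 / θ ≤ 1 := by rw [div_le_one (by linarith)]; exact hθ
  have hηF0 : 0 ≤ η * F := mul_nonneg hη hF
  have h1 : (θ + 6) * Y ≤ 7 * (1 / θ) * (ν ^ 2 + η * F) := by
    have h2 : (θ + 6) * (1 / θ ^ 2) ≤ 7 * (1 / θ) := by
      have : (θ + 6) * (1 / θ ^ 2) = 1 / θ + 6 * (1 / θ * (1 / θ)) := by field_simp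
      rw [this]
      nlinarith
    calc (θ + 6) * Y ≤ (θ + 6) * ((ν ^ 2 + η * F) * (1 / θ ^ 2)) :=
          mul_le_mul_of_nonneg_left hY (by linarith)
      _ = (θ + 6) * (1 / θ ^ 2) * (ν ^ 2 + η * F) := by ring
      _ ≤ _ := mul_le_mul_of_nonneg_right h2 (by positivity)
  have h3 : (2 + 3 / θ) * ν ^ 2 + (θ + 6) * Y ≤ (2 + 10 / θ) * (ν ^ 2 + 7 / 2 * (η * F)) := by
    have e3 : 3 / θ = 3 * (1 / θ) := by ring
    have e10 : 10 / θ = 10 * (1 / θ) := by ring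
    rw [e3, e10]
    nlinarith [mul_nonneg hx0.le hηF0, mul_nonneg (sub_nonneg.2 hx1) hηF0]
  have hμ : 0 < 2 + 10 / θ := by positivity
  calc ν ^ 2 + q * ((2 + 3 / θ) * ν ^ 2 + (θ + 6) * Y)
      ≤ ν ^ 2 + q * ((2 + 10 / θ) * (ν ^ 2 + 7 / 2 * (η * F))) := by gcongr
    _ ≤ ν ^ 2 + 2 * (ε / (2 + 10 / θ)) * ((2 + 10 / θ) * (ν ^ 2 + 7 / 2 * (η * F))) := by gcongr
    _ = ν ^ 2 + 2 * ε * ν ^ 2 + 7 * ε * (η * F) := by field_simp; ring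
    _ ≤ ((1 + ε) * ν + δ) ^ 2 := by
        have h4 : 0 ≤ (1 + ε) * ν * δ := by positivity
        have h5 : 0 ≤ ε ^ 2 * ν ^ 2 := by positivity
        linarith [show ((1 + ε) * ν + δ) ^ 2 = ν ^ 2 + 2 * ε * ν ^ 2 + ε ^ 2 * ν ^ 2 +
          2 * ((1 + ε) * ν * δ) + δ ^ 2 by ring]

/-- The expected error of the fast CUR algorithm, for any parameters that are large enough. The
regularisation `η` of the competitor in `IsSketchSVD.frobSq_sub_le` tends to zero. -/
theorem Prog.expect_fastCURP_le {A : Matrix (Fin m) (Fin n) ℝ} {U : Matrix (Fin m) (Fin ρ) ℝ}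
    {σ : Fin ρ → ℝ} {V : Matrix (Fin n) (Fin ρ) ℝ} (h : IsSVD A U σ V) (hk : 0 < k) (hkm : k ≤ m)
    (hkn : k ≤ n) {ε : ℝ} (hε : 0 < ε) {θ : ℕ} (hθ : 0 < θ) {par : CURParams}
    (hs : par.sketch = k + 1 + k * θ ^ 2) (hc₁ : par.c₁ = 16 * k * θ ^ 2)
    (hr₁ : par.r₁ = 16 * k * θ ^ 2) (hc₂ : k * (2 + 10 / (θ : ℝ)) / ε ≤ par.c₂)
    (hr₂ : par.c * (2 + 10 / (θ : ℝ)) / ε ≤ par.r₂) :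
    (fastCURP A k par).expect
        (fun out => ENNReal.ofReal (frobNorm (A - out.C A * out.U A * out.R A))) ≤
      ENNReal.ofReal ((1 + ε) * frobNorm (A - svdTrunc k U σ V)) := by
  obtain ⟨κ, V₁, hκ, hV₁, hsvd⟩ := h.exists_svdTrunc_eq k
  have hEY := fun P hP hk => h.frobSq_sub_svdTrunc_le (k := k) (P := P) hP hk
  have hAV : (A * V₁)ᵀ * (A - A * V₁ * V₁ᵀ) = 0 := by
    have h1 : A * V₁ = svdTrunc k U σ V * V₁ := by
      rw [hsvd, Matrix.mul_assoc _ V₁ᵀ, hV₁, Matrix.mul_one]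
    rw [← hsvd, h1, Matrix.transpose_mul, Matrix.mul_assoc, h.transpose_svdTrunc_mul_sub,
      Matrix.mul_zero]
  rw [hsvd] at hEY ⊢
  set ν := frobNorm (A - A * V₁ * V₁ᵀ) with hν
  have hν0 : 0 ≤ ν := frobNorm_nonneg _
  have hνsq : frobSq (A - A * V₁ * V₁ᵀ) = ν ^ 2 := (frobNorm_sq _).symm
  have hk' : (0 : ℝ) < k := by exact_mod_cast hk
  have hθ' : (1 : ℝ) ≤ θ := by exact_mod_cast hθ
  have hμ : 0 < 2 + 10 / (θ : ℝ) := by positivity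
  have hc₂' : (0 : ℝ) < par.c₂ := lt_of_lt_of_le (by positivity) hc₂
  have hc' : (0 : ℝ) < par.c := by
    have : (par.c₂ : ℝ) ≤ par.c := by exact_mod_cast Nat.le_add_left par.c₂ par.c₁
    linarith
  have hr₂' : (0 : ℝ) < par.r₂ := lt_of_lt_of_le (by positivity) hr₂
  have hq : (k : ℝ) / par.c₂ + par.c / par.r₂ ≤ 2 * (ε / (2 + 10 / (θ : ℝ))) := by
    have h1 : ∀ {x y : ℝ}, 0 < y → x * (2 + 10 / (θ : ℝ)) / ε ≤ y →
        x / y ≤ ε / (2 + 10 / (θ : ℝ)) := by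
      intro x y hy hxy
      rw [div_le_div_iff₀ hy hμ, mul_comm ε]
      rwa [div_le_iff₀ hε] at hxy
    linarith [h1 hc₂' hc₂, h1 hr₂' hr₂]
  refine ENNReal.le_of_forall_pos_le_add fun δ hδ _ => ?_
  have hδ' : (0 : ℝ) < δ := by exact_mod_cast hδ
  set F := frobSq A with hF
  have hF0 : 0 ≤ F := frobSq_nonneg A
  set η : ℝ := (δ : ℝ) ^ 2 / (7 * ε * F + 1) with hη
  have hη0 : 0 < η := by positivity
  have hηF : 7 * ε * (η * F) ≤ (δ : ℝ) ^ 2 := by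
    have h1 : 7 * ε * (η * F) = (δ : ℝ) ^ 2 * (7 * ε * F / (7 * ε * F + 1)) := by
      rw [hη]; ring
    have h2 : 7 * ε * F / (7 * ε * F + 1) ≤ 1 := by
      rw [div_le_one (by positivity)]; linarith
    rw [h1]
    exact mul_le_of_le_one_right (by positivity) h2
  set a := (1 + ε) * ν + δ with ha
  have ha0 : 0 < a := by positivity
  set q := (k : ℝ) / par.c₂ + par.c / par.r₂ with hqd
  have hq0 : 0 ≤ q := by positivity
  set g : (Fin n → Fin par.sketch → ℝ) → ℝ := fun G =>
    1 / (2 * a) * (ν ^ 2 + q * ((2 + 3 / θ) * ν ^ 2 + (θ + 6) * sketchExcess η A V₁ G)) + a / 2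
    with hg
  have hgrowth := polyGrowth_sketchExcess (s := par.sketch) hη0 A V₁
  have hint := hgrowth.integrable le_rfl
  have hgm : Measurable fun G => ENNReal.ofReal (g G) :=
    ((continuous_const.mul (continuous_const.add (continuous_const.mul
      (continuous_const.add (continuous_const.mul hgrowth.1))))).add
        continuous_const).measurable.ennreal_ofReal
  have hg0 : ∀ G, 0 ≤ g G := by
    intro G
    have := sketchExcess_nonneg (A := A) (V₁ := V₁) hη0 G
    positivity
  have hpoint : ∀ G : Fin n → Fin par.sketch → ℝ, (sketchSVDP A k (Matrix.of G) >>= fun p =>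
      matMulP p.2.1 p.2.2ᵀ >>= fun Ak => matSubP A Ak >>= fun E =>
        curTailP A E p.1 p.2.2 par).expect
        (fun out => ENNReal.ofReal (frobNorm (A - out.C A * out.U A * out.R A))) ≤
      ENNReal.ofReal (g G) := by
    intro G
    have hks : k ≤ par.sketch := by rw [hs]; omega
    refine (runs_sketchSVDP A hk hkm hkn hks (Matrix.of G)).expect_bind_le fun p hp => ?_
    refine (runs_matMulP _ _).expect_bind_le fun Ak hAk => ?_
    refine (runs_matSubP _ _).expect_bind_le fun E hE => ?_
    subst hAk hE
    have h1 := expect_curTailP_le hp hk hkm hkn hθ hc₁ hr₁ (by exact_mod_cast hc₂')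
      (by exact_mod_cast hr₂') hκ hV₁ hEY (sketchExcess_nonneg hη0 G)
      (hp.frobSq_sub_le hη0 hκ hV₁ hAV) ha0
    rw [hνsq] at h1
    exact h1
  rw [fastCURP_eq]
  have hnn : (δ : ℝ≥0∞) = ENNReal.ofReal δ := (ENNReal.ofReal_coe_nnreal).symm
  rw [hnn, ← ENNReal.ofReal_add (by positivity) hδ'.le]
  refine (upperIntegral_le (μ := gaussMeasure n par.sketch) hgm hpoint).trans ?_
  have hgi : Integrable g (gaussMeasure n par.sketch) :=
    (((integrable_const (ν ^ 2)).add (((integrable_const ((2 + 3 / (θ : ℝ)) * ν ^ 2)).add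
      (hint.const_mul ((θ : ℝ) + 6))).const_mul q)).const_mul (1 / (2 * a))).add (integrable_const _)
  rw [← ofReal_integral_eq_lintegral_ofReal hgi (Filter.Eventually.of_forall hg0)]
  refine ENNReal.ofReal_le_ofReal ?_
  set Y := ∫ G, sketchExcess η A V₁ G ∂gaussMeasure n par.sketch with hY
  have hgY : ∫ G, g G ∂gaussMeasure n par.sketch =
      1 / (2 * a) * (ν ^ 2 + q * ((2 + 3 / θ) * ν ^ 2 + (θ + 6) * Y)) + a / 2 := by
    have h1 : ∀ G, g G = (1 / (2 * a) * (ν ^ 2 + q * ((2 + 3 / θ) * ν ^ 2)) + a / 2) +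
        1 / (2 * a) * q * (θ + 6) * sketchExcess η A V₁ G := by
      intro G; simp only [hg]; ring
    simp only [h1]
    rw [integral_add (integrable_const _) (hint.const_mul _), integral_const_mul, integral_const]
    simp only [probReal_univ, one_smul]
    ring
  have hYle : Y ≤ (ν ^ 2 + η * F) * (1 / (θ : ℝ) ^ 2) := by
    have h1 : (κ : ℝ) ≤ k := by exact_mod_cast hκ
    have h2 : (k : ℝ) * θ ^ 2 ≤ (par.sketch : ℝ) - κ - 1 := by
      rw [hs]; push_cast; linarith
    have h3 : κ + 1 < par.sketch := by
      have : 0 < k * θ ^ 2 := by positivity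
      rw [hs]; omega
    have h4 := integral_sketchExcess_le (A := A) hη0 hV₁ h3
    rw [hνsq] at h4
    refine h4.trans (mul_le_mul_of_nonneg_left ?_ (by positivity))
    rw [div_le_div_iff₀ (lt_of_lt_of_le (by positivity) h2) (by positivity)]
    nlinarith [mul_le_mul_of_nonneg_right h1 (sq_nonneg (θ : ℝ))]
  have hmain := cur_error_le hθ' hε hν0 hδ'.le hF0 hη0.le hYle hq0 hq hηF
  rw [hgY]
  have h1 : 1 / (2 * a) * (ν ^ 2 + q * ((2 + 3 / θ) * ν ^ 2 + (θ + 6) * Y)) ≤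
      1 / (2 * a) * a ^ 2 := mul_le_mul_of_nonneg_left hmain (by positivity)
  have h2 : 1 / (2 * a) * a ^ 2 = a / 2 := by field_simp
  linarith

end FastCUR

/-! ### Parameters and running time -/

section Parameters

/-- The accuracy parameter: an integer of the order of `ε ^ (-1 / 3)`. -/
noncomputable def curTheta (ε : ℝ) : ℕ := ⌈ε ^ (-(1 / 3) : ℝ)⌉₊

/-- The number of columns drawn by adaptive sampling. -/
noncomputable def curC₂ (k : ℕ) (ε : ℝ) : ℕ := ⌈k * (2 + 10 / (curTheta ε : ℝ)) / ε⌉₊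

/-- The parameters of the fast CUR algorithm. The sketch has an excess error of relative size `θ⁻²`,
with `θ = curTheta ε`, and `16 k θ²` iterations of dual set sparsification distort by a factor of at
most `1 + 1 / θ` (`dualSet_factor_le`). All these losses are absorbed by the correction `10 / θ` in
the numbers of sampled columns and rows (`cur_error_le`). -/
noncomputable def curParams (k : ℕ) (ε : ℝ) : CURParams where
  sketch := k + 1 + k * curTheta ε ^ 2
  c₁ := 16 * k * curTheta ε ^ 2
  c₂ := curC₂ k ε
  r₁ := 16 * k * curTheta ε ^ 2
  r₂ := ⌈((16 * k * curTheta ε ^ 2 + curC₂ k ε : ℕ) : ℝ) * (2 + 10 / (curTheta ε : ℝ)) / ε⌉₊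

/-- The size of the parameters, in terms of `t = ε ^ (-1 / 3)`. -/
structure CURParamBounds (k : ℕ) (t : ℝ) (par : CURParams) : Prop where
  sketch_le : (par.sketch : ℝ) ≤ 6 * (k * t ^ 2)
  c₁_le : (par.c₁ : ℝ) ≤ 64 * (k * t ^ 2)
  r₁_le : (par.r₁ : ℝ) ≤ 64 * (k * t ^ 2)
  le_c₂ : 2 * k * t ^ 3 ≤ (par.c₂ : ℝ)
  c₂_le : (par.c₂ : ℝ) ≤ 2 * k * t ^ 3 + 11 * (k * t ^ 2)
  le_r₂ : 2 * par.c * t ^ 3 ≤ (par.r₂ : ℝ)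
  r₂_le : (par.r₂ : ℝ) ≤ 2 * par.c * t ^ 3 + 11 * (par.c * t ^ 2)

theorem CURParamBounds.of_ceil {k θ : ℕ} {t ε : ℝ} (hk : 0 < k) (ht : 1 ≤ t) (hε : ε = 1 / t ^ 3)
    (hθ : t ≤ θ) (hθ' : (θ : ℝ) ≤ 2 * t) {par : CURParams} (hs : par.sketch = k + 1 + k * θ ^ 2)
    (hc₁ : par.c₁ = 16 * k * θ ^ 2) (hr₁ : par.r₁ = 16 * k * θ ^ 2)
    (hc₂ : par.c₂ = ⌈k * (2 + 10 / (θ : ℝ)) / ε⌉₊)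
    (hr₂ : par.r₂ = ⌈(par.c : ℝ) * (2 + 10 / (θ : ℝ)) / ε⌉₊) : CURParamBounds k t par := by
  have hk' : (1 : ℝ) ≤ k := by exact_mod_cast hk
  have ht0 : 0 < t := by linarith
  have hθ0 : (0 : ℝ) < θ := by linarith
  have ht2 : 1 ≤ t ^ 2 := one_le_pow₀ ht
  have hθ2 : (θ : ℝ) ^ 2 ≤ 4 * t ^ 2 := by
    have := pow_le_pow_left₀ hθ0.le hθ' 2
    linarith [mul_pow 2 t 2]
  have hkθ : (k : ℝ) * θ ^ 2 ≤ 4 * (k * t ^ 2) := by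
    have := mul_le_mul_of_nonneg_left hθ2 (by linarith : (0 : ℝ) ≤ k)
    linarith
  have hkt : (k : ℝ) ≤ k * t ^ 2 := le_mul_of_one_le_right (by linarith) ht2
  have key : ∀ x : ℝ, 1 ≤ x → 2 * x * t ^ 3 ≤ (⌈x * (2 + 10 / (θ : ℝ)) / ε⌉₊ : ℝ) ∧
      (⌈x * (2 + 10 / (θ : ℝ)) / ε⌉₊ : ℝ) ≤ 2 * x * t ^ 3 + 11 * (x * t ^ 2) := by
    intro x hx
    have hx0 : 0 < x := by linarith
    have h1 : x * (2 + 10 / (θ : ℝ)) / ε = 2 * x * t ^ 3 + 10 * (x * (t ^ 3 / θ)) := by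
      rw [hε]; field_simp
    have h2 : t ^ 3 / θ ≤ t ^ 2 := by
      rw [div_le_iff₀ hθ0]
      calc t ^ 3 = t ^ 2 * t := by ring
        _ ≤ t ^ 2 * θ := by gcongr
    have h3 : x * (t ^ 3 / θ) ≤ x * t ^ 2 := by gcongr
    have h4 : 0 ≤ x * (t ^ 3 / θ) := by positivity
    have h5 : 1 ≤ x * t ^ 2 := by nlinarith
    have h6 : 0 ≤ 2 * x * t ^ 3 + 10 * (x * (t ^ 3 / θ)) := by positivity
    rw [h1]
    constructor
    · linarith [Nat.le_ceil (2 * x * t ^ 3 + 10 * (x * (t ^ 3 / θ)))]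
    · linarith [Nat.ceil_lt_add_one h6]
  have hc : (1 : ℝ) ≤ par.c := by
    have h1 : 1 ≤ par.c₁ := by
      have : 0 < θ := by exact_mod_cast hθ0
      rw [hc₁]
      exact Nat.succ_le_of_lt (by positivity)
    exact_mod_cast h1.trans (Nat.le_add_right _ _)
  refine ⟨?_, ?_, ?_, ?_, ?_, ?_, ?_⟩
  · rw [hs]; push_cast; linarith
  · rw [hc₁]; push_cast; linarith
  · rw [hr₁]; push_cast; linarith
  · rw [hc₂]; exact (key k hk').1
  · rw [hc₂]; exact (key k hk').2
  · rw [hr₂]; exact (key par.c hc).1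
  · rw [hr₂]; exact (key par.c hc).2

theorem CURParamBounds.c_le {k : ℕ} {t : ℝ} {par : CURParams} (h : CURParamBounds k t par) :
    (par.c : ℝ) ≤ 2 * k * t ^ 3 + 75 * (k * t ^ 2) := by
  have h1 : (par.c : ℝ) = par.c₁ + par.c₂ := by rw [CURParams.c]; push_cast; rfl
  linarith [h.c₁_le, h.c₂_le]

theorem CURParamBounds.abs_sub_le {k : ℕ} {t : ℝ} {par : CURParams} (h : CURParamBounds k t par)
    (ht : 1 ≤ t) :
    |(par.c₂ : ℝ) - 2 * k * t ^ 3| ≤ 50 / t * (2 * k * t ^ 3) ∧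
      |(par.c : ℝ) - 2 * k * t ^ 3| ≤ 50 / t * (2 * k * t ^ 3) ∧
      |(par.r₂ : ℝ) - 2 * par.c * t ^ 3| ≤ 50 / t * (2 * par.c * t ^ 3) ∧
      |(par.r : ℝ) - 2 * par.c * t ^ 3| ≤ 50 / t * (2 * par.c * t ^ 3) := by
  have ht0 : 0 < t := by linarith
  have e : ∀ x : ℝ, 50 / t * (2 * x * t ^ 3) = 100 * (x * t ^ 2) := by
    intro x; field_simp; ring
  have hkt : 0 ≤ (k : ℝ) * t ^ 2 := by positivity
  have hct : 0 ≤ (par.c : ℝ) * t ^ 2 := by positivity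
  have h1 : (par.c : ℝ) = par.c₁ + par.c₂ := by rw [CURParams.c]; push_cast; rfl
  have h2 : (par.r : ℝ) = par.r₁ + par.r₂ := by rw [CURParams.r]; push_cast; rfl
  have h3 : (0 : ℝ) ≤ par.c₁ := Nat.cast_nonneg _
  have h4 : (0 : ℝ) ≤ par.r₁ := Nat.cast_nonneg _
  have h5 : (k : ℝ) * t ^ 2 ≤ par.c * t ^ 2 := by
    have h6 : (k : ℝ) ≤ k * t ^ 3 := le_mul_of_one_le_right (Nat.cast_nonneg _) (one_le_pow₀ ht)
    have h7 : (0 : ℝ) ≤ k := Nat.cast_nonneg _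
    refine mul_le_mul_of_nonneg_right ?_ (by positivity)
    linarith [h.le_c₂]
  rw [e, e]
  refine ⟨abs_le.2 ⟨?_, ?_⟩, abs_le.2 ⟨?_, ?_⟩, abs_le.2 ⟨?_, ?_⟩, abs_le.2 ⟨?_, ?_⟩⟩ <;>
  linarith [h.c₁_le, h.r₁_le, h.le_c₂, h.c₂_le, h.le_r₂, h.r₂_le]

/-- A bound for the number of steps of the fast CUR algorithm: the sum of the bounds for its parts,
in the order of execution. -/
def curSteps (m n k : ℕ) (par : CURParams) : ℕ :=
  n * par.sketch + (60 * (m * par.sketch * n + m * par.sketch ^ 2 + n * par.sketch ^ 2 +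
    par.sketch ^ 3) + (m * (n * (2 * k + 1)) + (m * n +
      (60 * (par.c₁ * (n * k ^ 2)) + 13 * (m * par.c₁ ^ 2) + 20 * (m * n * par.c₁) + par.c₂ * n +
        (60 * (par.r₁ * (m * k ^ 2)) + 13 * (n * par.r₁ ^ 2) + 20 * (n * m * par.r₁) + par.r₂ * m +
        ((13 * (m * par.c ^ 2) + 2) + ((13 * (n * par.r ^ 2) + 2) + 0)))))))

theorem Prog.runs_fastCURP {m n k : ℕ} (A : Matrix (Fin m) (Fin n) ℝ) {par : CURParams} (hk : 0 < k)
    (hkm : k ≤ m) (hkn : k ≤ n) (hs : k ≤ par.sketch) (hc : k < par.c₁) (hr : k < par.r₁) :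
    (fastCURP A k par).Runs (curSteps m n k par) fun out =>
      out.cols.length ≤ par.c ∧ out.rows.length ≤ par.r ∧
        IsMoorePenrose (out.C A) out.Cdag ∧ IsMoorePenrose (out.R A) out.Rdag := by
  rw [fastCURP_eq]
  exact (runs_gaussP n par.sketch).bind fun G _ => (runs_sketchSVDP A hk hkm hkn hs G).bind
    fun p hp => (runs_matMulP _ _).bind fun Ak _ => (runs_matSubP _ _).bind fun E _ =>
      runs_curTailP A E hk hkm hkn hp.orth_left hp.orth_right hc hr

theorem curSteps_le {m n k : ℕ} {t : ℝ} {par : CURParams} (h : CURParamBounds k t par) (hk : 0 < k)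
    (hkm : k ≤ m) (hkn : k ≤ n) (ht : 1 ≤ t) :
    (curSteps m n k par : ℝ) ≤ 20000000 * (m * n * k * t ^ 2 + (m + n) * k ^ 3 * t ^ 2 +
      m * k ^ 2 * t ^ 6 + n * k ^ 2 * t ^ 12) := by
  have hk' : (1 : ℝ) ≤ k := by exact_mod_cast hk
  have hkm' : (k : ℝ) ≤ m := by exact_mod_cast hkm
  have hkn' : (k : ℝ) ≤ n := by exact_mod_cast hkn
  have hm' : (1 : ℝ) ≤ m := hk'.trans hkm'
  have hn' : (1 : ℝ) ≤ n := hk'.trans hkn'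
  have ht0 : 0 < t := by linarith
  have t02 : (1 : ℝ) ≤ t ^ 2 := one_le_pow₀ ht
  have hkk : (k : ℝ) ≤ k ^ 2 := by nlinarith
  have hc : (par.c : ℝ) ≤ 77 * (k * t ^ 3) := by
    have : (k : ℝ) * t ^ 2 ≤ k * t ^ 3 := by gcongr; norm_num
    linarith [h.c_le]
  have hc₂ : (par.c₂ : ℝ) ≤ 13 * (k * t ^ 3) := by
    have : (k : ℝ) * t ^ 2 ≤ k * t ^ 3 := by gcongr; norm_num
    linarith [h.c₂_le]
  have hr₂ : (par.r₂ : ℝ) ≤ 1001 * (k * t ^ 6) := by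
    have h1 : (par.c : ℝ) * t ^ 2 ≤ par.c * t ^ 3 := by gcongr; norm_num
    have h2 : (par.c : ℝ) * t ^ 3 ≤ 77 * (k * t ^ 3) * t ^ 3 := by gcongr
    have h3 : 77 * (k * t ^ 3) * t ^ 3 = 77 * (k * t ^ 6) := by ring
    linarith [h.r₂_le]
  have hr : (par.r : ℝ) ≤ 1065 * (k * t ^ 6) := by
    have h1 : (par.r : ℝ) = par.r₁ + par.r₂ := by rw [CURParams.r]; push_cast; rfl
    have h2 : (k : ℝ) * t ^ 2 ≤ k * t ^ 6 := by gcongr; norm_num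
    linarith [h.r₁_le]
  have hs := h.sketch_le
  have hc₁ := h.c₁_le
  have hr₁ := h.r₁_le
  have b1 : (n : ℝ) * par.sketch ≤ 6 * (m * n * k * t ^ 2) := by
    calc (n : ℝ) * par.sketch ≤ n * (6 * (k * t ^ 2)) := by gcongr
      _ = 6 * (1 * n * k * t ^ 2) := by ring
      _ ≤ 6 * (m * n * k * t ^ 2) := by gcongr
  have b2 : (m : ℝ) * par.sketch * n ≤ 6 * (m * n * k * t ^ 2) := by
    calc (m : ℝ) * par.sketch * n ≤ m * (6 * (k * t ^ 2)) * n := by gcongr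
      _ = _ := by ring
  have b3 : (m : ℝ) * par.sketch ^ 2 ≤ 36 * (m * k ^ 2 * t ^ 6) := by
    calc (m : ℝ) * par.sketch ^ 2 ≤ m * (6 * (k * t ^ 2)) ^ 2 := by gcongr
      _ = 36 * (m * k ^ 2 * t ^ 4) := by ring
      _ ≤ _ := by gcongr; norm_num
  have b4 : (n : ℝ) * par.sketch ^ 2 ≤ 36 * (n * k ^ 2 * t ^ 12) := by
    calc (n : ℝ) * par.sketch ^ 2 ≤ n * (6 * (k * t ^ 2)) ^ 2 := by gcongr
      _ = 36 * (n * k ^ 2 * t ^ 4) := by ring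
      _ ≤ _ := by gcongr; norm_num
  have b5 : (par.sketch : ℝ) ^ 3 ≤ 216 * (m * k ^ 2 * t ^ 6) := by
    calc (par.sketch : ℝ) ^ 3 ≤ (6 * (k * t ^ 2)) ^ 3 := by gcongr
      _ = 216 * (k * k ^ 2 * t ^ 6) := by ring
      _ ≤ _ := by gcongr
  have b6 : (m : ℝ) * (n * (2 * k + 1)) ≤ 3 * (m * n * k * t ^ 2) := by
    calc (m : ℝ) * (n * (2 * k + 1)) ≤ m * (n * (2 * k + k)) := by gcongr
      _ = 3 * (m * n * k * 1) := by ring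
      _ ≤ _ := by gcongr
  have b7 : (m : ℝ) * n ≤ m * n * k * t ^ 2 := by
    calc (m : ℝ) * n = m * n * 1 * 1 := by ring
      _ ≤ _ := by gcongr
  have b8 : (par.c₁ : ℝ) * (n * k ^ 2) + par.r₁ * (m * k ^ 2) ≤ 64 * ((m + n) * k ^ 3 * t ^ 2) := by
    calc (par.c₁ : ℝ) * (n * k ^ 2) + par.r₁ * (m * k ^ 2) ≤
          64 * (k * t ^ 2) * (n * k ^ 2) + 64 * (k * t ^ 2) * (m * k ^ 2) := by gcongr
      _ = _ := by ring
  have b9 : (m : ℝ) * par.c₁ ^ 2 ≤ 4096 * (m * k ^ 2 * t ^ 6) := by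
    calc (m : ℝ) * par.c₁ ^ 2 ≤ m * (64 * (k * t ^ 2)) ^ 2 := by gcongr
      _ = 4096 * (m * k ^ 2 * t ^ 4) := by ring
      _ ≤ _ := by gcongr; norm_num
  have b10 : (n : ℝ) * par.r₁ ^ 2 ≤ 4096 * (n * k ^ 2 * t ^ 12) := by
    calc (n : ℝ) * par.r₁ ^ 2 ≤ n * (64 * (k * t ^ 2)) ^ 2 := by gcongr
      _ = 4096 * (n * k ^ 2 * t ^ 4) := by ring
      _ ≤ _ := by gcongr; norm_num
  have b11 : (m : ℝ) * n * par.c₁ ≤ 64 * (m * n * k * t ^ 2) := by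
    calc (m : ℝ) * n * par.c₁ ≤ m * n * (64 * (k * t ^ 2)) := by gcongr
      _ = _ := by ring
  have b12 : (n : ℝ) * m * par.r₁ ≤ 64 * (m * n * k * t ^ 2) := by
    calc (n : ℝ) * m * par.r₁ ≤ n * m * (64 * (k * t ^ 2)) := by gcongr
      _ = _ := by ring
  have b13 : (par.c₂ : ℝ) * n ≤ 13 * (n * k ^ 2 * t ^ 12) := by
    calc (par.c₂ : ℝ) * n ≤ 13 * (k * t ^ 3) * n := by gcongr
      _ = 13 * (n * k * t ^ 3) := by ring
      _ ≤ _ := by gcongr; norm_num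
  have b14 : (par.r₂ : ℝ) * m ≤ 1001 * (m * k ^ 2 * t ^ 6) := by
    calc (par.r₂ : ℝ) * m ≤ 1001 * (k * t ^ 6) * m := by gcongr
      _ = 1001 * (m * k * t ^ 6) := by ring
      _ ≤ _ := by gcongr
  have b15 : (m : ℝ) * par.c ^ 2 ≤ 5929 * (m * k ^ 2 * t ^ 6) := by
    calc (m : ℝ) * par.c ^ 2 ≤ m * (77 * (k * t ^ 3)) ^ 2 := by gcongr
      _ = _ := by ring
  have b16 : (n : ℝ) * par.r ^ 2 ≤ 1134225 * (n * k ^ 2 * t ^ 12) := by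
    calc (n : ℝ) * par.r ^ 2 ≤ n * (1065 * (k * t ^ 6)) ^ 2 := by gcongr
      _ = _ := by ring
  have b17 : (1 : ℝ) ≤ m * n := by nlinarith
  have p1 : 0 ≤ (m : ℝ) * n * k * t ^ 2 := by positivity
  have p3 : 0 ≤ (m : ℝ) * k ^ 2 * t ^ 6 := by positivity
  have p4 : 0 ≤ (n : ℝ) * k ^ 2 * t ^ 12 := by positivity
  have p2 : 0 ≤ ((m : ℝ) + n) * k ^ 3 * t ^ 2 := by positivity
  rw [curSteps]
  push_cast
  linarith

end Parameters

theorem mainTheorem3 :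
    ∃ (par : ℕ → ℝ → CURParams) (δ : ℝ → ℝ) (K : ℝ),
      Filter.Tendsto δ (𝓝[>] 0) (𝓝 0) ∧
      ∀ (k : ℕ) (ε : ℝ), 0 < k → 0 < ε → ε ≤ 1 →
        (k < (par k ε).c₁ ∧ k < (par k ε).r₁ ∧
          |((par k ε).c₂ : ℝ) - 2 * k / ε| ≤ δ ε * (2 * k / ε) ∧
          |((par k ε).c : ℝ) - 2 * k / ε| ≤ δ ε * (2 * k / ε) ∧
          |((par k ε).r₂ : ℝ) - 2 * (par k ε).c / ε| ≤ δ ε * (2 * (par k ε).c / ε) ∧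
          |((par k ε).r : ℝ) - 2 * (par k ε).c / ε| ≤ δ ε * (2 * (par k ε).c / ε)) ∧
        ∀ (m n : ℕ), k ≤ m → k ≤ n → ∀ (A : Matrix (Fin m) (Fin n) ℝ),
          (fastCURP A k (par k ε)).Always (fun out =>
            out.cols.length ≤ (par k ε).c ∧ out.rows.length ≤ (par k ε).r ∧
            IsMoorePenrose (out.C A) out.Cdag ∧ IsMoorePenrose (out.R A) out.Rdag) ∧
          (∀ (ρ : ℕ) (U : Matrix (Fin m) (Fin ρ) ℝ) (σ : Fin ρ → ℝ) (V : Matrix (Fin n) (Fin ρ) ℝ),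
            IsSVD A U σ V →
            (fastCURP A k (par k ε)).expect
                (fun out => ENNReal.ofReal (frobNorm (A - out.C A * out.U A * out.R A)))
              ≤ ENNReal.ofReal ((1 + ε) * frobNorm (A - svdTrunc k U σ V))) ∧
          ∃ T : ℕ, (fastCURP A k (par k ε)).steps ≤ (T : ℕ∞) ∧
            (T : ℝ) ≤ K * (m * n * k * ε ^ (-(2 / 3) : ℝ) + (m + n) * k ^ 3 * ε ^ (-(2 / 3) : ℝ)
              + m * k ^ 2 * ε ^ (-2 : ℝ) + n * k ^ 2 * ε ^ (-4 : ℝ)) := by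
  refine ⟨curParams, fun ε => 50 * ε ^ (1 / 3 : ℝ), 20000000, ?_, fun k ε hk hε hε1 => ?_⟩
  · have h := (Real.continuous_rpow_const (q := (1 / 3 : ℝ)) (by norm_num)).tendsto 0
    rw [Real.zero_rpow (by norm_num)] at h
    simpa using (h.const_mul 50).mono_left nhdsWithin_le_nhds
  -- all bounds are polynomial in `t`
  set t : ℝ := ε ^ (-(1 / 3) : ℝ) with ht
  have ht1 : 1 ≤ t := Real.one_le_rpow_of_pos_of_le_one_of_nonpos hε hε1 (by norm_num)
  have ht0 : 0 < t := by linarith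
  have hpow : ∀ i : ℕ, t ^ i = ε ^ (-(1 / 3) * i : ℝ) := fun i => by
    rw [ht, ← Real.rpow_natCast, ← Real.rpow_mul hε.le]
  have hε3 : ε = 1 / t ^ 3 := by
    rw [hpow, one_div, ← Real.rpow_neg hε.le]
    norm_num
  have hδ : 50 * ε ^ (1 / 3 : ℝ) = 50 / t := by
    rw [ht, Real.rpow_neg hε.le, div_inv_eq_mul]
  have h2 : ε ^ (-(2 / 3) : ℝ) = t ^ 2 := by rw [hpow]; norm_num
  have h6 : ε ^ (-2 : ℝ) = t ^ 6 := by rw [hpow]; norm_num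
  have h12 : ε ^ (-4 : ℝ) = t ^ 12 := by rw [hpow]; norm_num
  have hθ : t ≤ curTheta ε := Nat.le_ceil _
  have hθ' : (curTheta ε : ℝ) ≤ 2 * t := by
    have : (curTheta ε : ℝ) < t + 1 := Nat.ceil_lt_add_one ht0.le
    linarith
  have hθ0 : 0 < curTheta ε := by exact_mod_cast ht0.trans_le hθ
  have hkθ : 0 < k * curTheta ε ^ 2 := by positivity
  have hkk : k ≤ k * curTheta ε ^ 2 := Nat.le_mul_of_pos_right _ (by positivity)
  have hb : CURParamBounds k t (curParams k ε) :=
    .of_ceil hk ht1 hε3 hθ hθ' rfl rfl rfl rfl rfl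
  have hc₁ : k < (curParams k ε).c₁ := by
    show k < 16 * k * curTheta ε ^ 2
    rw [Nat.mul_assoc]
    omega
  have hr₁ : k < (curParams k ε).r₁ := hc₁
  have hs : k ≤ (curParams k ε).sketch := by
    show k ≤ k + 1 + k * curTheta ε ^ 2
    omega
  have hdiv : ∀ x : ℝ, 2 * x / ε = 2 * x * t ^ 3 := by
    intro x
    rw [hε3]
    field_simp
  refine ⟨⟨hc₁, hr₁, ?_⟩, fun m n hkm hkn A => ?_⟩
  · simp only [hδ, hdiv]
    exact hb.abs_sub_le ht1
  · have hruns := Prog.runs_fastCURP A hk hkm hkn hs hc₁ hr₁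
    refine ⟨hruns.always, fun ρ U σ V h => ?_, curSteps m n k (curParams k ε), hruns.steps_le, ?_⟩
    · exact Prog.expect_fastCURP_le h hk hkm hkn hε hθ0 rfl rfl rfl (Nat.le_ceil _) (Nat.le_ceil _)
    · rw [h2, h6, h12]
      exact curSteps_le hb hk hkm hkn ht1
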